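/- Setting. Let $S\subseteq\mathbb R^d$ be a domain (open, connected, non-empty) and $D\subset S$ a compact set whose boundary is Lebesgue-null. A function on a closed set is called $C^r$ if it is the restriction of a $C^r$ function on the whole space. Let $\mu$ be a Radon measure on $S$ and $K:S^2\to\mathbb C$ a measurable, locally square integrable kernel, with associated integral operators $\mathcal K_C$ on $L^2(C,\mu)$, $C\subset S$ compact, and $\mathcal K$ on $S$. (H1) $K(x,y)=\overline{K(y,x)}$ $\mu^{\otimes2}$-a.e.; $\mathcal K$ is locally of trace class; its spectrum is contained in $[0,1)$, i.e. there is $\kappa<1$ such that all eigenvalues of all $\mathcal K_C$ lie in $[0,\kappa]$. The kernel is chosen such that, for each compact $C\subset S$, with $(\lambda_j)$ the eigenvalues and $(\varphi_j)$ an orthonormal eigenbasis of $\mathcal K_C$, $K(x,y)=\sum_j\lambda_j\varphi_j(x)\overline{\varphi_j(y)}$ for all $x,y\in C$ outside a $\mu$-null set. (H2) $\mu$ has a density $\rho$ with respect to Lebesgue measure which is strictly positive and $C^1$ on $D$. Let $\mathbf X$ be the determinantal point process on $S$ with kernel $K$, i.e. the simple locally finite point process whose correlation functions with respect to $\mu$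 are $\rho_k(x_1,\dots,x_k)=\det(K(x_i,x_j))_{i,j}$. Let $\mathbf X^D=\mathbf X\cap D=\{X_1,\dots,X_{\mathbf X(D)}\}$, let $P_D$ be its law on the finite configurations, and let $L^2_D=L^2(P_D)$ (real). Let $J$ be the kernel of $(\mathrm{Id}-\mathcal K_D)^{-1}\mathcal K_D$, given by $J(x,y)=\sum_j\frac{\lambda_j}{1-\lambda_j}\varphi_j(x)\overline{\varphi_j(y)}$ for $x,y\in D$ outside a null set, $(\lambda_j,\varphi_j)$ being as above for $C=D$, and put $\det J(x_1,\dots,x_n)=\det(J(x_i,x_j))_{i,j}$. (H3) For every $n\ge1$, $(x_1,\dots,x_n)\mapsto\det J(x_1,\dots,x_n)$ is $C^1$ on $D^n$. (I) For all $n\ge1$, $1\le i,j\le n$, $1\le h,k\le d$: $$\int_{D^n}\left|\frac{\partial_{x_i^{(h)}}\det J\;\partial_{x_j^{(k)}}\det J}{\det J}\right|\mathbf 1_{\{\det J>0\}}\,d\mu^{\otimes n}<\infty .$$ Test functionals. Let $\mathcal D$ be the set of smooth functions $\varphi$ on $D$ for which $$\int_D g\,(-\Delta\varphi)\,dx=\int_D\nabla\varphi\cdot\nabla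 g\,dx\qquad\text{for all smooth functions } g \text{ on } D$$ (a weak form of the vanishing of the normal derivative on $\partial D$). Let $\tilde{\mathcal S}_D$ be the set of functionals $$F(\mathbf X^D)=f\Big(\sum_{k=1}^{\mathbf X(D)}\varphi_1(X_k),\dots,\sum_{k=1}^{\mathbf X(D)}\varphi_M(X_k)\Big)\mathbf 1_{\{\mathbf X(D)\le N\}}$$ with integers $M,N\ge1$, $\varphi_1,\dots,\varphi_M\in\mathcal D$, and $f\in C_b^\infty(\mathbb R^M)$ (bounded with all its derivatives). For such $F$ let $\nabla_{X_i}F$ and $\Delta_{X_i}F$ be the gradient and the Laplacian in the position of the point $X_i$, the other points being fixed. Put $$\mathcal HF=\sum_{i=1}^{\mathbf X(D)}\Big(-\frac{\nabla\rho(X_i)}{\rho(X_i)}\cdot\nabla_{X_i}F-\Delta_{X_i}F-\frac{\nabla_{X_i}\det J(\mathbf X^D)}{\det J(\mathbf X^D)}\cdot\nabla_{X_i}F\Big),$$ $$\mathcal E(F,G)=\mathrm E\Big[\sum_{i=1}^{\mathbf X(D)}\nabla_{X_i}F\cdot\nabla_{X_i}G\Big].$$ Theorem. Assume (H1), (H2),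 (H3) and (I). (i) $\mathcal H$ is a well-defined linear operator $\tilde{\mathcal S}_D\to L^2_D$ (in particular $\tilde{\mathcal S}_D\subset L_D^2$, $\mathcal H(\tilde{\mathcal S}_D)\subset L^2_D$, and $\mathcal HF$ depends only on the $P_D$-class of $F$); it is symmetric and non-negative definite. In particular it has a square root: there is a non-negative self-adjoint operator $R$ on $L^2_D$ with $R(RF)=\mathcal HF$ for all $F\in\tilde{\mathcal S}_D$. The restriction of $R$ to $\tilde{\mathcal S}_D$ is denoted by $\mathcal H^{1/2}$. (ii) $\mathcal E$ is a well-defined (finite, and depending only on the $P_D$-classes), symmetric, non-negative definite bilinear form on $\tilde{\mathcal S}_D\times\tilde{\mathcal S}_D$. (iii) $\mathcal E$ is closable and, for each choice of $R$ in (i), $\mathcal H^{1/2}$ is closable, the domain of the closure $\overline{\mathcal E}$ is $\mathrm{Dom}(\overline{\mathcal H^{1/2}})$, and $$\overline{\mathcal E}(\mathbf F,\mathbf G)=\mathrm E\big[\overline{\mathcal H^{1/2}}\mathbf F\;\overline{\mathcal H^{1/2}}\mathbf G\big],\qquad \mathbf F,\mathbf G\in\mathrm{Dom}(\overline{\mathcal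 H^{1/2}}).$$ (iv) $(\overline{\mathcal E},\mathrm{Dom}(\overline{\mathcal H^{1/2}}))$ is a symmetric Dirichlet form on $L^2_D$: it is densely defined, symmetric, non-negative definite, closed, satisfies the weak sector condition, and for every $\mathbf F$ in its domain $\mathbf F^+\wedge1$ is in its domain and $\overline{\mathcal E}(\mathbf F^+\wedge1,\mathbf F^+\wedge1)\le\overline{\mathcal E}(\mathbf F,\mathbf F)$. -/

import Mathlib

open MeasureTheory Set Filter Topology
open scoped ENNReal ComplexConjugate InnerProductSpace

/-- Euclidean space `ℝ^d`. -/
abbrev Eucl (d : ℕ) := EuclideanSpace ℝ (Fin d)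

/-! ## Configurations and point processes -/

/-- Locally finite configurations of points of `S`. -/
def LFConfig {d : ℕ} (S : Set (Eucl d)) : Type :=
  {B : Set (Eucl d) // B ⊆ S ∧ ∀ C : Set (Eucl d), IsCompact C → C ⊆ S → (B ∩ C).Finite}

/-- The σ-field generated by the events `♯(B ∩ C) = m`, with `C ⊆ S` compact. -/
instance {d : ℕ} (S : Set (Eucl d)) : MeasurableSpace (LFConfig S) :=
  MeasurableSpace.generateFrom
    {A | ∃ (C : Set (Eucl d)) (m : ℕ), IsCompact C ∧ C ⊆ S ∧
      A = {ω : LFConfig S | (ω.1 ∩ C).ncard = m}}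

/-- Finite configurations of points of `ℝ^d`. -/
structure FinConfig (d : ℕ) where
  /-- the points of the configuration -/
  pts : Finset (Eucl d)

/-- The σ-field generated by the events `♯(B ∩ C) = m`, with `C` compact. -/
instance (d : ℕ) : MeasurableSpace (FinConfig d) :=
  MeasurableSpace.generateFrom
    {A | ∃ (C : Set (Eucl d)) (m : ℕ), IsCompact C ∧
      A = {B : FinConfig d | ((B.pts : Set (Eucl d)) ∩ C).ncard = m}}

open Classical in
/-- The restriction `ω ∩ D` of a configuration to `D`. The default value is never used when
`D ⊆ S` is compact. -/
noncomputable def restrictTo {d : ℕ} {S : Set (Eucl d)} (D : Set (Eucl d)) (ω : LFConfig S) :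
    FinConfig d :=
  if h : (ω.1 ∩ D).Finite then ⟨h.toFinset⟩ else ⟨∅⟩

theorem coe_restrictTo {d : ℕ} {S D : Set (Eucl d)} (hD : IsCompact D) (hDS : D ⊆ S)
    (ω : LFConfig S) : ((restrictTo D ω).pts : Set (Eucl d)) = ω.1 ∩ D := by
  have h : (ω.1 ∩ D).Finite := ω.2.2 D hD hDS
  simp [restrictTo, h]

theorem measurable_restrictTo {d : ℕ} {S D : Set (Eucl d)} (hD : IsCompact D) (hDS : D ⊆ S) :
    Measurable (restrictTo D : LFConfig S → FinConfig d) := by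
  refine measurable_generateFrom ?_
  rintro A ⟨C, m, hC, rfl⟩
  refine MeasurableSpace.measurableSet_generateFrom
    ⟨D ∩ C, m, hD.inter hC, inter_subset_left.trans hDS, ?_⟩
  ext ω
  simp only [mem_preimage, mem_ofPred_eq, coe_restrictTo hD hDS, inter_assoc]

/-- The law `P_D` of the restriction to `D` of a point process with law `P`. -/
noncomputable def lawOn {d : ℕ} {S : Set (Eucl d)} (P : Measure (LFConfig S))
    (D : Set (Eucl d)) : Measure (FinConfig d) :=
  P.map (restrictTo D)

/-! ## Kernels, integral operators, determinantal processes -/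

/-- `(lam i)` and `(φ i)` are the eigenvalues and an orthonormal basis of `L²(D, μ)` made of
eigenfunctions of the integral operator with kernel `K` on `L²(D, μ)`. -/
structure IsEigenbasis {d : ℕ} (μ : Measure (Eucl d)) (K : Eucl d → Eucl d → ℂ)
    (D : Set (Eucl d)) {ι : Type} (lam : ι → ℝ) (φ : ι → Eucl d → ℂ) : Prop where
  measurable : ∀ i, Measurable (φ i)
  memLp : ∀ i, MemLp (φ i) 2 (μ.restrict D)
  norm_eq_one : ∀ i, ∫ x in D, φ i x * conj (φ i x) ∂μ = 1
  orthogonal : ∀ i j, i ≠ j → ∫ x in D, φ i x * conj (φ j x) ∂μ = 0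
  complete : ∀ f : Eucl d → ℂ, MemLp f 2 (μ.restrict D) →
    (∀ i, ∫ x in D, f x * conj (φ i x) ∂μ = 0) → f =ᵐ[μ.restrict D] 0
  eigen : ∀ i, ∀ᵐ x ∂μ.restrict D, ∫ y in D, K x y * φ i y ∂μ = lam i * φ i x

/-- The kernel `k` is given by `k(x,y) = ∑ c_i φ_i(x) conj(φ_i(y))` for all `x, y ∈ D` outside
a `μ`-null set. In particular this determines `k(x,x)` for `μ`-a.e. `x ∈ D`. -/
def HasKernelExpansion {d : ℕ} (μ : Measure (Eucl d)) (k : Eucl d → Eucl d → ℂ)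
    (D : Set (Eucl d)) {ι : Type} (c : ι → ℝ) (φ : ι → Eucl d → ℂ) : Prop :=
  ∃ N : Set (Eucl d), μ N = 0 ∧ ∀ x ∈ D \ N, ∀ y ∈ D \ N,
    HasSum (fun i => (c i : ℂ) * φ i x * conj (φ i y)) (k x y)

/-- Standing assumption on the kernel: `K` is a Hermitian, locally square integrable kernel, whose integral operator
is locally of trace class, with `0 ≤ 𝒦` and `‖𝒦‖ < 1`; the kernel is chosen such that it is given
on compact sets by its expansion in eigenfunctions. -/
structure KernelAssumption {d : ℕ} (S : Set (Eucl d)) (μ : Measure (Eucl d))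
    (K : Eucl d → Eucl d → ℂ) : Prop where
  measurable : Measurable (Function.uncurry K)
  locally_sq_integrable : ∀ D : Set (Eucl d), IsCompact D → D ⊆ S →
    ∫⁻ x in D, ∫⁻ y in D, ‖K x y‖ₑ ^ 2 ∂μ ∂μ < ∞
  hermitian : ∀ᵐ p ∂μ.prod μ, K p.1 p.2 = conj (K p.2 p.1)
  spectrum : ∃ κ : ℝ, κ < 1 ∧ ∀ D : Set (Eucl d), IsCompact D → D ⊆ S →
    ∃ (ι : Type) (lam : ι → ℝ) (φ : ι → Eucl d → ℂ), Countable ι ∧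
      IsEigenbasis μ K D lam φ ∧ (∀ i, 0 ≤ lam i ∧ lam i ≤ κ) ∧ Summable (fun i => |lam i|) ∧
      HasKernelExpansion μ K D lam φ

/-- `P` is the law of the determinantal point process on `S` with kernel `K` with respect to `μ`:
its correlation functions are `ρ_k(x_1,…,x_k) = det (K(x_i,x_j))`. -/
def IsDeterminantal {d : ℕ} (S : Set (Eucl d)) (μ : Measure (Eucl d))
    (K : Eucl d → Eucl d → ℂ) (P : Measure (LFConfig S)) : Prop :=
  ∀ k : ℕ, 1 ≤ k → ∀ B : Fin k → Set (Eucl d), (∀ i, MeasurableSet (B i)) → (∀ i, B i ⊆ S) →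
    Pairwise (fun i j => Disjoint (B i) (B j)) →
    ∫⁻ ω, ∏ i, ((ω.1 ∩ B i).encard : ℝ≥0∞) ∂P =
      ∫⁻ x in Set.pi univ B,
        ENNReal.ofReal (Matrix.det (Matrix.of fun i j => K (x i) (x j))).re
          ∂Measure.pi (fun _ : Fin k => μ)

/-- `J` is the kernel of the local interaction operator `𝒥[D] = (Id - 𝒦_D)⁻¹ 𝒦_D`: it has the
eigenfunctions of `𝒦_D`, with eigenvalues `λ / (1 - λ)`. -/
def IsInteractionKernel {d : ℕ} (μ : Measure (Eucl d)) (K : Eucl d → Eucl d → ℂ)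
    (D : Set (Eucl d)) (J : Eucl d → Eucl d → ℂ) : Prop :=
  Measurable (Function.uncurry J) ∧
  ∃ (ι : Type) (lam : ι → ℝ) (φ : ι → Eucl d → ℂ), Countable ι ∧
    IsEigenbasis μ K D lam φ ∧ HasKernelExpansion μ J D (fun i => lam i / (1 - lam i)) φ

/-! ## Differential calculus -/

/-- `f` is of class `C^r` on the closed set `D`, i.e. on `D` it coincides with a `C^r` function
on the whole space. -/
def IsCrOn {V : Type} [NormedAddCommGroup V] [NormedSpace ℝ V] (r : WithTop ℕ∞) (f : V → ℝ)
    (D : Set V) : Prop :=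
  ∃ g : V → ℝ, ContDiff ℝ r g ∧ EqOn f g D

/-- `μ` is a Radon measure on `S` with density `ρ` with respect to the Lebesgue
measure, and `ρ` is positive and `C¹` on `D`. -/
structure DensityAssumption {d : ℕ} (S : Set (Eucl d)) (μ : Measure (Eucl d)) (ρ : Eucl d → ℝ)
    (D : Set (Eucl d)) : Prop where
  measurable : Measurable ρ
  nonneg : ∀ x ∈ S, 0 ≤ ρ x
  density : μ = (volume.restrict S).withDensity (fun x => ENNReal.ofReal (ρ x))
  radon : ∀ C : Set (Eucl d), IsCompact C → C ⊆ S → μ C < ∞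
  pos : ∀ x ∈ D, 0 < ρ x
  c1 : IsCrOn 1 ρ D

/-- The function `(x_1,…,x_n) ↦ det J(x_1,…,x_n)`. -/
noncomputable def detTuple {d : ℕ} (J : Eucl d → Eucl d → ℂ) (n : ℕ) (x : Fin n → Eucl d) : ℝ :=
  (Matrix.det (Matrix.of fun i j => J (x i) (x j))).re

/-- `(x_1,…,x_n) ↦ det J(x_1,…,x_n)` is `C¹` on `D^n` for all `n ≥ 1`. -/
def SmoothDetAssumption {d : ℕ} (J : Eucl d → Eucl d → ℂ) (D : Set (Eucl d)) : Prop :=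
  ∀ n : ℕ, 1 ≤ n → IsCrOn 1 (detTuple J n) (Set.pi univ fun _ => D)

/-- The partial derivative of `g` with respect to the `h`-th coordinate of the `i`-th point. -/
noncomputable def pderivTuple {d n : ℕ} (g : (Fin n → Eucl d) → ℝ) (i : Fin n) (h : Fin d)
    (x : Fin n → Eucl d) : ℝ :=
  fderiv ℝ g x (Pi.single i (EuclideanSpace.single h 1))

/-- The integrability condition on the partial derivatives of `det J`. -/
def IntegrabilityCondition {d : ℕ} (μ : Measure (Eucl d)) (J : Eucl d → Eucl d → ℂ)
    (D : Set (Eucl d)) : Prop :=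
  ∀ n : ℕ, 1 ≤ n → ∀ (i j : Fin n) (h k : Fin d),
    ∫⁻ x in {x : Fin n → Eucl d | (∀ l, x l ∈ D) ∧ 0 < detTuple J n x},
      ENNReal.ofReal |pderivTuple (detTuple J n) i h x * pderivTuple (detTuple J n) j k x /
        detTuple J n x| ∂Measure.pi (fun _ : Fin n => μ) < ∞

open Classical in
/-- The configuration `B` with the point `x` moved to `y`. -/
noncomputable def FinConfig.move {d : ℕ} (B : FinConfig d) (x y : Eucl d) : FinConfig d :=
  ⟨insert y (B.pts.erase x)⟩

/-- The gradient `∇_x F(B)` of a functional in the direction of the point `x` of `B`. -/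
noncomputable def configGrad {d : ℕ} (F : FinConfig d → ℝ) (B : FinConfig d) (x : Eucl d) :
    Eucl d :=
  gradient (fun y => F (B.move x y)) x

/-- The Laplacian `Δ_x F(B)` of a functional in the direction of the point `x` of `B`. -/
noncomputable def configLaplacian {d : ℕ} (F : FinConfig d → ℝ) (B : FinConfig d) (x : Eucl d) :
    ℝ :=
  Laplacian.laplacian (fun y => F (B.move x y)) x

open Classical in
/-- `det J` as a function of the configuration. -/
noncomputable def detConfig {d : ℕ} (J : Eucl d → Eucl d → ℂ) (B : FinConfig d) : ℝ :=
  (Matrix.det (Matrix.of fun x y : B.pts => J x y)).re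

/-- The vector field `β^μ = ∇ρ / ρ`. -/
noncomputable def beta {d : ℕ} (ρ : Eucl d → ℝ) (x : Eucl d) : Eucl d :=
  (ρ x)⁻¹ • gradient ρ x

/-- The gradient of the potential energy `U = - log det J` at the point `x` of `B`,
`- ∇_x det J / det J`. -/
noncomputable def gradU {d : ℕ} (J : Eucl d → Eucl d → ℂ) (B : FinConfig d) (x : Eucl d) :
    Eucl d :=
  -((detConfig J B)⁻¹ • configGrad (detConfig J) B x)

/-- The Laplace operator `ℋ` on functionals. -/
noncomputable def lapH {d : ℕ} (ρ : Eucl d → ℝ) (J : Eucl d → Eucl d → ℂ)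
    (F : FinConfig d → ℝ) (B : FinConfig d) : ℝ :=
  ∑ x ∈ B.pts, (-⟪beta ρ x, configGrad F B x⟫_ℝ - configLaplacian F B x
    + ⟪gradU J B x, configGrad F B x⟫_ℝ)

/-- The energy density `∑_i ∇_{X_i} F · ∇_{X_i} G`. -/
noncomputable def energyDensity {d : ℕ} (F G : FinConfig d → ℝ) (B : FinConfig d) : ℝ :=
  ∑ x ∈ B.pts, ⟪configGrad F B x, configGrad G B x⟫_ℝ

/-- The smooth functions `φ` on `D` for which `-Δφ = div ∇φ`, where `div` is the adjoint of the
gradient on `D`: `∫_D g (-Δφ) dx = ∫_D ∇φ · ∇g dx` for all smooth `g` (a weak form of the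
vanishing of the normal derivative of `φ` on the boundary). -/
def IsTestFunction {d : ℕ} (D : Set (Eucl d)) (φ : Eucl d → ℝ) : Prop :=
  ContDiff ℝ ((⊤ : ℕ∞) : WithTop ℕ∞) φ ∧ ∀ g : Eucl d → ℝ, ContDiff ℝ ((⊤ : ℕ∞) : WithTop ℕ∞) g →
    ∫ x in D, g x * (-Laplacian.laplacian φ x) =
      ∫ x in D, ⟪gradient φ x, gradient g x⟫_ℝ

/-- `C_b^∞`: smooth functions which are bounded together with all their derivatives. -/
def IsCbInfty {M : ℕ} (f : (Fin M → ℝ) → ℝ) : Prop :=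
  ContDiff ℝ ((⊤ : ℕ∞) : WithTop ℕ∞) f ∧ ∀ n : ℕ, ∃ C : ℝ, ∀ x, ‖iteratedFDeriv ℝ n f x‖ ≤ C

open Classical in
/-- The functionals `f(∑ φ_1(X_k), …, ∑ φ_M(X_k)) 1_{X(D) ≤ N}`. -/
noncomputable def cylinder {d M : ℕ} (f : (Fin M → ℝ) → ℝ) (φ : Fin M → Eucl d → ℝ) (N : ℕ)
    (B : FinConfig d) : ℝ :=
  if B.pts.card ≤ N then f (fun m => ∑ x ∈ B.pts, φ m x) else 0

/-- The class of test functionals `S̃_D`. -/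
def testFunctionals {d : ℕ} (D : Set (Eucl d)) : Set (FinConfig d → ℝ) :=
  {F | ∃ (M N : ℕ) (f : (Fin M → ℝ) → ℝ) (φ : Fin M → Eucl d → ℝ), 1 ≤ M ∧ 1 ≤ N ∧
    IsCbInfty f ∧ (∀ m, IsTestFunction D (φ m)) ∧ F = cylinder f φ N}

/-! ## Operators and bilinear forms on a Hilbert space -/

section Forms

variable {H : Type} [NormedAddCommGroup H] [InnerProductSpace ℝ H]

/-- A (partially defined) bilinear form on a Hilbert space. -/
structure PForm (H : Type) [NormedAddCommGroup H] [InnerProductSpace ℝ H] where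
  /-- the domain -/
  domain : Submodule ℝ H
  /-- the values -/
  form : domain →ₗ[ℝ] domain →ₗ[ℝ] ℝ

namespace PForm

/-- Symmetry. -/
def IsSymm (a : PForm H) : Prop := ∀ x y : a.domain, a.form x y = a.form y x

/-- Non-negative definiteness. -/
def IsNonneg (a : PForm H) : Prop := ∀ x : a.domain, 0 ≤ a.form x x

/-- `𝒜₁(x,y) = 𝒜(x,y) + ⟨x,y⟩`. -/
noncomputable def form1 (a : PForm H) (x y : a.domain) : ℝ := a.form x y + ⟪(x : H), (y : H)⟫_ℝ

/-- `u` is a Cauchy sequence for the norm `‖x‖_𝒜 = √𝒜₁(x,x)`. -/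
def IsCauchy (a : PForm H) (u : ℕ → a.domain) : Prop :=
  ∀ ε > 0, ∃ N, ∀ m ≥ N, ∀ n ≥ N, √(a.form1 (u m - u n) (u m - u n)) < ε

/-- The form is closed: its domain is complete for the norm `‖·‖_𝒜`. -/
def IsClosed (a : PForm H) : Prop :=
  ∀ u : ℕ → a.domain, a.IsCauchy u →
    ∃ x : a.domain, Tendsto (fun n => √(a.form1 (u n - x) (u n - x))) atTop (𝓝 0)

/-- The form is closable. -/
def IsClosable (a : PForm H) : Prop :=
  ∀ u : ℕ → a.domain, Tendsto (fun n => (u n : H)) atTop (𝓝 0) → a.IsCauchy u →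
    Tendsto (fun n => a.form (u n) (u n)) atTop (𝓝 0)

/-- `b` is the closure of the closable form `a`: its domain is the completion of the domain of `a`
for the norm `‖·‖_𝒜`, realised inside `H`, and its values are the limits of those of `a`. -/
def IsClosureOf (b a : PForm H) : Prop :=
  (∀ x : H, x ∈ b.domain ↔
    ∃ u : ℕ → a.domain, a.IsCauchy u ∧ Tendsto (fun n => (u n : H)) atTop (𝓝 x)) ∧
  ∀ (x y : b.domain) (u v : ℕ → a.domain),
    a.IsCauchy u → Tendsto (fun n => (u n : H)) atTop (𝓝 (x : H)) →
    a.IsCauchy v → Tendsto (fun n => (v n : H)) atTop (𝓝 (y : H)) →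
    Tendsto (fun n => a.form (u n) (v n)) atTop (𝓝 (b.form x y))

/-- The weak sector condition. -/
def WeakSector (a : PForm H) : Prop :=
  ∃ c : ℝ, 0 < c ∧ ∀ x y : a.domain,
    |a.form1 x y| ≤ c * √(a.form1 x x) * √(a.form1 y y)

/-- Symmetric Dirichlet forms on a real `L²` space. -/
structure IsSymmetricDirichletForm {B : Type} [MeasurableSpace B] {β : Measure B}
    (a : PForm (Lp ℝ 2 β)) : Prop where
  dense : Dense (a.domain : Set (Lp ℝ 2 β))
  symm : a.IsSymm
  nonneg : a.IsNonneg
  closed : a.IsClosed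
  weakSector : a.WeakSector
  markov : ∀ u : a.domain, ∃ v : a.domain,
    (v : Lp ℝ 2 β) =ᵐ[β] (fun x => min (max ((u : Lp ℝ 2 β) x) 0) 1) ∧ a.form v v ≤ a.form u u

end PForm

/-- `R` is a square root of the symmetric non-negative operator `A`: a non-negative self-adjoint
operator such that `R (R u) = A u` for all `u` in the domain of `A`. The operator `A^{1/2}` on the
domain of `A` is then the restriction of `R` to this domain. -/
def IsSquareRoot [CompleteSpace H] (A R : H →ₗ.[ℝ] H) : Prop :=
  IsSelfAdjoint R ∧ (∀ u : R.domain, 0 ≤ ⟪R u, (u : H)⟫_ℝ) ∧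
  ∀ u : A.domain, ∃ (hu : (u : H) ∈ R.domain) (hRu : R ⟨u, hu⟩ ∈ R.domain),
    R ⟨R ⟨u, hu⟩, hRu⟩ = A u

end Forms

/-!
# The Dirichlet form of a determinantal point process

**The law of the process on `D`.** Everything rests on the fact that `P_D` has Janossy densities
proportional to `det J`: on the configurations of `n` points it is the image of the measure
`c (n!)⁻¹ det J dμ^n` on `D^n` (`exists_lawOn_eq_janossy`). The σ-field on finite configurations is
generated by the π-system of the events `{no point in U}`, `U` open (`generateFrom_voidSet_open`),
so only the probabilities of these events have to be compared. For the determinantal process,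
inclusion-exclusion along finer and finer partitions gives the Fredholm determinant `det (1 - K 1_U)`
(`HasCorrelation.measure_voidSet`); for the Janossy measure one gets `c det (1 + J 1_{Uᶜ})`. They
agree by the identity `det (1 - K 1_U) = det (1 - K) det (1 + J 1_{Uᶜ})`, where `J = (1 - K)⁻¹ K`.
It is linear algebra for kernels of finite rank (`det_one_sub_eq`), and Hadamard's inequality allows
the passage to the limit (`fredholm_complement`). The expansions of `K` and `J` may use different
eigenbases; `HasKernelExpansion.change_basis` shows that this does not matter.

**Green's formula.** A test functional is, on configurations of `n` points, a smooth function of the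
points which satisfies the integration by parts formula on `D` in each of them, because the class of
functions satisfying this formula is stable under composition (`IsTestFunction.integral_comp_eq`).
Integrating by parts on `D^n` against the `C¹` density `det J ∏ ρ` produces exactly the drift of `ℋ`.
The density is non-negative, so at its zeros in the interior the gradient of `det J` vanishes, and
the division by `det J` loses nothing; the boundary of `D` is null. The integrability condition puts
`ℋF` in `L²`. This gives `E[ℋF G] = ℰ(F, G)` (`IsRegularJanossy.integrable_energyDensity_and`).

**The operator.** Indicators of the events `{no point in U}` are limits of test functionals, which
are therefore dense in `L²` (`IsRegularJanossy.dense_testSubmodule`). With Green's formula this shows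
that the class of `ℋF` depends only on the class of `F`, and linearly
(`IsRegularJanossy.exists_operator`); it also gives symmetry and non-negativity.

**Square root and closure.** For a densely defined symmetric non-negative `A`, the completion of its
domain for `⟨Au, v⟩ + ⟨u, v⟩`, mapped to the Hilbert space by `j`, yields the bounded operator
`T = j j†`, the resolvent `(1 + R²)⁻¹` of a non-negative self-adjoint `R` with `R R u = A u`, for
which the domain of `A` is a core (`exists_isSquareRoot_core`). Hence the closure of the form of `A`
is `‖R ·‖²`. For an arbitrary square root `R'` one still has `‖R' u‖² = ⟨Au, u⟩` on the domain of
`A`, so that the closure of the restriction of `R'` computes the same form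
(`IsSquareRoot.sqForm_eq_closure`).

**Markov property.** Smooth contractions `φ` with `φ 0 = 0` map test functionals to test functionals
and decrease the energy. Those approximating `t ↦ (t ∨ 0) ∧ 1` uniformly, together with the lower
semicontinuity of `‖R ·‖²`, give the claim (`IsRegularJanossy.markov`).
-/

/-! ### Square roots of bounded and unbounded operators -/

/-- The scalar iteration `s ↦ (1 + s²) / 2`, which majorises the operator iteration of
`sqrtIter`. -/
noncomputable def sqrtMajorant : ℕ → ℝ
  | 0 => 0
  | n + 1 => (1 + sqrtMajorant n ^ 2) / 2

theorem sqrtMajorant_mem (n : ℕ) : 0 ≤ sqrtMajorant n ∧ sqrtMajorant n ≤ 1 := by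
  induction n with
  | zero => simp [sqrtMajorant]
  | succ n ih => simp only [sqrtMajorant]; constructor <;> nlinarith [ih.1, ih.2]

theorem sqrtMajorant_mono : Monotone sqrtMajorant := by
  refine monotone_nat_of_le_succ fun n => ?_
  simp only [sqrtMajorant]
  nlinarith [sq_nonneg (sqrtMajorant n - 1)]

/-- The iteration `s ↦ (x + s²) / 2`, whose limit `s` satisfies `(1 - s)² = 1 - x`. -/
noncomputable def sqrtIter {𝔸 : Type*} [NormedRing 𝔸] [NormedAlgebra ℝ 𝔸] (x : 𝔸) : ℕ → 𝔸
  | 0 => 0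
  | n + 1 => (2⁻¹ : ℝ) • (x + sqrtIter x n ^ 2)

theorem commute_sqrtIter {𝔸 : Type*} [NormedRing 𝔸] [NormedAlgebra ℝ 𝔸] {x y : 𝔸}
    (h : Commute y x) (n : ℕ) : Commute y (sqrtIter x n) := by
  induction n with
  | zero => simp [sqrtIter]
  | succ n ih => exact (h.add_right (ih.pow_right 2)).smul_right _

theorem norm_sqrtIter_le {𝔸 : Type*} [NormedRing 𝔸] [NormedAlgebra ℝ 𝔸] {x : 𝔸}
    (hx : ‖x‖ ≤ 1) (n : ℕ) : ‖sqrtIter x n‖ ≤ sqrtMajorant n := by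
  induction n with
  | zero => simp [sqrtIter, sqrtMajorant]
  | succ n ih =>
    have h1 : ‖x + sqrtIter x n ^ 2‖ ≤ 1 + sqrtMajorant n ^ 2 := by
      refine (norm_add_le _ _).trans (add_le_add hx ?_)
      rw [sq]
      refine (norm_mul_le _ _).trans ?_
      nlinarith [norm_nonneg (sqrtIter x n)]
    simp only [sqrtIter, sqrtMajorant, norm_smul]
    norm_num
    linarith

/-- The increments of the iteration are majorised by those of the scalar iteration, which is monotone
and bounded. Hence the iteration converges. -/
theorem norm_sqrtIter_succ_sub_le {𝔸 : Type*} [NormedRing 𝔸] [NormedAlgebra ℝ 𝔸] {x : 𝔸}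
    (hx : ‖x‖ ≤ 1) (n : ℕ) :
    ‖sqrtIter x (n + 1) - sqrtIter x n‖ ≤ sqrtMajorant (n + 1) - sqrtMajorant n := by
  induction n with
  | zero =>
    have := norm_sqrtIter_le hx 1
    simpa [sqrtIter, sqrtMajorant] using this
  | succ n ih =>
    have hc : Commute (sqrtIter x (n + 1)) (sqrtIter x n) :=
      commute_sqrtIter (commute_sqrtIter (Commute.refl x) (n + 1)).symm n
    have e : sqrtIter x (n + 2) - sqrtIter x (n + 1) = (2⁻¹ : ℝ) •
        ((sqrtIter x (n + 1) - sqrtIter x n) * (sqrtIter x (n + 1) + sqrtIter x n)) := by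
      have : (sqrtIter x (n + 1) - sqrtIter x n) * (sqrtIter x (n + 1) + sqrtIter x n) =
          sqrtIter x (n + 1) ^ 2 - sqrtIter x n ^ 2 := by
        rw [sub_mul, mul_add, mul_add, hc.eq]
        noncomm_ring
      rw [this]
      change (2⁻¹ : ℝ) • (x + sqrtIter x (n + 1) ^ 2) - (2⁻¹ : ℝ) • (x + sqrtIter x n ^ 2) = _
      rw [← smul_sub]
      congr 1
      abel
    rw [e, norm_smul]
    have h1 := norm_sqrtIter_le hx n
    have h2 := norm_sqrtIter_le hx (n + 1)
    have h3 : ‖sqrtIter x (n + 1) + sqrtIter x n‖ ≤ sqrtMajorant (n + 1) + sqrtMajorant n :=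
      (norm_add_le _ _).trans (add_le_add h2 h1)
    have h4 := norm_mul_le (sqrtIter x (n + 1) - sqrtIter x n)
      (sqrtIter x (n + 1) + sqrtIter x n)
    have h5 := mul_le_mul ih h3 (norm_nonneg _) (by
      have := sqrtMajorant_mono (Nat.le_succ n); simp only [Nat.succ_eq_add_one] at this; linarith)
    have e2 : sqrtMajorant (n + 2) - sqrtMajorant (n + 1) = 2⁻¹ *
        ((sqrtMajorant (n + 1) - sqrtMajorant n) * (sqrtMajorant (n + 1) + sqrtMajorant n)) := by
      change (1 + sqrtMajorant (n + 1) ^ 2) / 2 - (1 + sqrtMajorant n ^ 2) / 2 = _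
      ring
    rw [e2]
    norm_num
    linarith

theorem exists_tendsto_sqrtIter {𝔸 : Type*} [NormedRing 𝔸] [NormedAlgebra ℝ 𝔸] [CompleteSpace 𝔸]
    {x : 𝔸} (hx : ‖x‖ ≤ 1) : ∃ s, Tendsto (sqrtIter x) atTop (𝓝 s) := by
  have hb : BddAbove (range sqrtMajorant) := ⟨1, by rintro _ ⟨n, rfl⟩; exact (sqrtMajorant_mem n).2⟩
  have hsum : Summable fun n => sqrtMajorant (n + 1) - sqrtMajorant n := by
    refine summable_of_sum_range_le (c := 1)
      (fun n => sub_nonneg.2 (sqrtMajorant_mono (Nat.le_succ n))) fun n => ?_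
    rw [Finset.sum_range_sub]
    simpa [sqrtMajorant] using (sqrtMajorant_mem n).2
  refine cauchySeq_tendsto_of_complete (cauchySeq_of_summable_dist ?_)
  refine Summable.of_nonneg_of_le (fun _ => dist_nonneg) (fun n => ?_) hsum
  rw [dist_comm, dist_eq_norm]
  exact norm_sqrtIter_succ_sub_le hx n

section

variable {H : Type} [NormedAddCommGroup H] [InnerProductSpace ℝ H] [CompleteSpace H]

/-- A self-adjoint operator `T` with `‖1 - T‖ ≤ 1` has a non-negative square root, which commutes
with everything that commutes with `T`. No functional calculus is used, since `H` is real. -/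
theorem exists_bounded_sqrt {T : H →L[ℝ] H} (hT : IsSelfAdjoint T) (h1 : ‖1 - T‖ ≤ 1) :
    ∃ C : H →L[ℝ] H, IsSelfAdjoint C ∧ C * C = T ∧ ‖1 - C‖ ≤ 1 ∧ (∀ f, 0 ≤ ⟪C f, f⟫_ℝ) ∧
      ∀ Y, Commute Y T → Commute Y C := by
  obtain ⟨s, hs⟩ := exists_tendsto_sqrtIter h1
  have hfix : s = (2⁻¹ : ℝ) • ((1 - T) + s ^ 2) := by
    have h2 : Tendsto (fun n => sqrtIter (1 - T) (n + 1)) atTop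
        (𝓝 ((2⁻¹ : ℝ) • ((1 - T) + s ^ 2))) :=
      (tendsto_const_nhds.add (hs.pow 2)).const_smul _
    exact tendsto_nhds_unique ((tendsto_add_atTop_iff_nat 1).2 hs) h2
  have hsn : ‖s‖ ≤ 1 := le_of_tendsto hs.norm
    (Eventually.of_forall fun n => (norm_sqrtIter_le h1 n).trans (sqrtMajorant_mem n).2)
  have hsa : IsSelfAdjoint s := by
    have : ∀ n, IsSelfAdjoint (sqrtIter (1 - T) n) := by
      intro n
      induction n with
      | zero => exact IsSelfAdjoint.zero _
      | succ n ih =>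
        exact IsSelfAdjoint.smul (by simp [IsSelfAdjoint])
          ((((IsSelfAdjoint.one _).sub hT)).add (ih.pow 2))
    exact (isClosed_eq continuous_star continuous_id).mem_of_tendsto hs
      (Eventually.of_forall this)
  refine ⟨1 - s, (IsSelfAdjoint.one _).sub hsa, ?_, by simpa using hsn, fun f => ?_, fun Y hY => ?_⟩
  · have : (2 : ℝ) • s = (1 - T) + s ^ 2 := by
      conv_lhs => rw [hfix]
      rw [smul_smul]; norm_num
    have h2 : s + s = (1 - T) + s * s := by rw [← two_smul ℝ, this, sq]
    have h3 : (1 - s) * (1 - s) = 1 - (s + s) + s * s := by noncomm_ring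
    rw [h3, h2]; abel
  · have h3 : ⟪s f, f⟫_ℝ ≤ ⟪f, f⟫_ℝ := by
      rw [real_inner_self_eq_norm_mul_norm]
      refine (real_inner_le_norm _ _).trans (mul_le_mul_of_nonneg_right ?_ (norm_nonneg _))
      exact (s.le_opNorm f).trans (mul_le_of_le_one_left (norm_nonneg _) hsn)
    simp only [sub_apply, one_apply_eq_self, inner_sub_left]
    linarith
  · refine (Commute.one_right _).sub_right ?_
    have h4 : ∀ n, Y * sqrtIter (1 - T) n = sqrtIter (1 - T) n * Y := fun n =>
      commute_sqrtIter ((Commute.one_right _).sub_right hY) n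
    exact tendsto_nhds_unique (hs.const_mul Y) ((hs.mul_const Y).congr fun n => (h4 n).symm)

/-- For a contraction `T` as in `exists_bounded_sqrt` which is moreover injective, the operator
`R = √(1 - T) (√T)⁻¹` is non-negative and self-adjoint. Formally `T = (1 + R²)⁻¹`. -/
theorem exists_selfAdjoint_of_resolvent {T : H →L[ℝ] H} (hT : IsSelfAdjoint T)
    (h0 : ‖T‖ ≤ 1) (h1 : ‖1 - T‖ ≤ 1) (hinj : ∀ f, T f = 0 → f = 0) :
    ∃ (C S : H →L[ℝ] H) (R : H →ₗ.[ℝ] H), IsSelfAdjoint C ∧ IsSelfAdjoint S ∧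
      C * C = T ∧ S * S = 1 - T ∧ Commute C S ∧ DenseRange C ∧
      IsSelfAdjoint R ∧ (∀ u : R.domain, 0 ≤ ⟪R u, (u : H)⟫_ℝ) ∧
      (∀ f, ∃ h : C f ∈ R.domain, R ⟨C f, h⟩ = S f) ∧ ∀ x ∈ R.domain, ∃ f, x = C f := by
  obtain ⟨C, hC, hCC, hC1, hCpos, hCcomm⟩ := exists_bounded_sqrt hT h1
  obtain ⟨S, hS, hSS, -, hSpos, hScomm⟩ := exists_bounded_sqrt
    (T := 1 - T) ((IsSelfAdjoint.one _).sub hT) (by simpa using h0)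
  obtain ⟨B, hB, hBB, -, -, hBcomm⟩ := exists_bounded_sqrt hC hC1
  have hTC : Commute T C := hCcomm T (Commute.refl T)
  have hCS : Commute C S := hScomm C ((Commute.one_right _).sub_right hTC.symm)
  have hSB : Commute S B := hBcomm S hCS.symm
  have hsymm : ∀ {A : H →L[ℝ] H}, IsSelfAdjoint A → ∀ x y, ⟪A x, y⟫_ℝ = ⟪x, A y⟫_ℝ :=
    fun hA x y => (ContinuousLinearMap.isSelfAdjoint_iff_isSymmetric.1 hA) x y
  have hCCa : ∀ f, C (C f) = T f := fun f => by rw [← hCC]; rfl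
  have hSSa : ∀ f, S (S f) = f - T f := fun f => by
    have := congrArg (fun A : H →L[ℝ] H => A f) hSS
    simpa using this
  have hCSa : ∀ f, C (S f) = S (C f) := fun f =>
    congrArg (fun A : H →L[ℝ] H => A f) hCS.eq
  have hCinj : Function.Injective C := by
    refine (injective_iff_map_eq_zero C).2 fun f hf => hinj f ?_
    rw [← hCCa, hf, map_zero]
  have hCd : DenseRange C := by
    have h2 : (LinearMap.range (C : H →ₗ[ℝ] H)).topologicalClosure = ⊤ := by
      rw [Submodule.topologicalClosure_eq_top_iff, Submodule.eq_bot_iff]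
      intro x hx
      refine hCinj ?_
      rw [map_zero]
      refine ext_inner_left ℝ fun y => ?_
      rw [inner_zero_right, ← hsymm hC]
      exact hx (C y) ⟨y, rfl⟩
    exact Submodule.dense_iff_topologicalClosure_eq_top.2 h2
  let e := LinearEquiv.ofInjective (C : H →ₗ[ℝ] H) hCinj
  let R : H →ₗ.[ℝ] H := ⟨LinearMap.range (C : H →ₗ[ℝ] H), (S : H →ₗ[ℝ] H).comp e.symm.toLinearMap⟩
  have hRC : ∀ f, ∃ h : C f ∈ R.domain, R ⟨C f, h⟩ = S f := by
    intro f
    refine ⟨⟨f, rfl⟩, ?_⟩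
    change S (e.symm _) = S f
    congr 1
    rw [LinearEquiv.symm_apply_eq]
    rfl
  have hRd : ∀ x ∈ R.domain, ∃ f, x = C f := by rintro x ⟨f, rfl⟩; exact ⟨f, rfl⟩
  have hRdense : Dense (R.domain : Set H) := hCd
  refine ⟨C, S, R, hC, hS, hCC, hSS, hCS, hCd, ?_, ?_, hRC, hRd⟩
  · rw [LinearPMap.isSelfAdjoint_def]
    refine le_antisymm ?_ ?_
    · refine ⟨fun u hu => ?_, fun x y hxy => ?_⟩
      all_goals
        have key : ∀ x : R.adjoint.domain, (x : H) = C (C x + S (R.adjoint x)) ∧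
            R.adjoint x = S (C x + S (R.adjoint x)) := by
          intro x
          -- If `(x, w)` lies in the graph of the adjoint, then `S x = C w`, whence
          -- `(x, w) = (C f, S f)` for `f = C x + S w`.
          have h3 : S x = C (R.adjoint x) := by
            refine ext_inner_right ℝ fun f => ?_
            obtain ⟨h, hf⟩ := hRC f
            have := R.adjoint_isFormalAdjoint hRdense x ⟨C f, h⟩
            rw [hsymm hS, ← hf, ← this, hsymm hC]
          constructor
          · rw [map_add, hCSa, ← h3, hCCa, hSSa]; abel
          · rw [map_add, ← hCSa, h3, hCCa, hSSa]; abel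
      · obtain ⟨h, -⟩ := hRC (C u + S (R.adjoint ⟨u, hu⟩))
        rwa [← (key ⟨u, hu⟩).1] at h
      · obtain ⟨h, hf⟩ := hRC (C x + S (R.adjoint x))
        have e1 : y = ⟨C (C x + S (R.adjoint x)), h⟩ := Subtype.ext (hxy.symm.trans (key x).1)
        rw [e1, hf]
        exact (key x).2
    · refine LinearPMap.IsFormalAdjoint.le_adjoint hRdense fun x y => ?_
      obtain ⟨f, hf⟩ := hRd x x.2
      obtain ⟨g, hg⟩ := hRd y y.2
      obtain ⟨h, hf'⟩ := hRC f
      obtain ⟨h', hg'⟩ := hRC g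
      have ex : x = ⟨C f, h⟩ := Subtype.ext hf
      have ey : y = ⟨C g, h'⟩ := Subtype.ext hg
      rw [ex, ey, hf', hg']
      change ⟪S f, C g⟫_ℝ = ⟪C f, S g⟫_ℝ
      rw [← hsymm hC, hCSa, hsymm hS]
  · intro u
    obtain ⟨f, hf⟩ := hRd u u.2
    obtain ⟨h, hf'⟩ := hRC f
    have ex : u = ⟨C f, h⟩ := Subtype.ext hf
    rw [ex, hf']
    change 0 ≤ ⟪S f, C f⟫_ℝ
    -- With `B = √C` the scalar product is `⟨S B f, B f⟩`.
    have h5 : C f = B (B f) := by rw [← hBB]; rfl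
    have h6 : B (S f) = S (B f) := congrArg (fun A : H →L[ℝ] H => A f) hSB.eq.symm
    rw [h5, ← hsymm hB, h6]
    exact hSpos _

end

section

variable {H : Type} [NormedAddCommGroup H] [InnerProductSpace ℝ H] [CompleteSpace H]

/-- The Friedrichs construction. Let the pre-Hilbert space `V` embed densely and contractively into
`H`, and suppose that each functional `⟪v, ·⟫` on `V` is continuous for the norm of `H`, hence given
by a vector `h v`. If `J` is the extension of the embedding to the completion of `V`, then
`T = J J†` is the resolvent `(1 + R²)⁻¹` of a non-negative self-adjoint operator `R`. -/
theorem exists_selfAdjoint_of_embedding {V : Type} [NormedAddCommGroup V] [InnerProductSpace ℝ V]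
    (ι : V →L[ℝ] H) (hι : ∀ v, ‖ι v‖ ≤ ‖v‖) (hd : DenseRange ι) (h : V → H)
    (hh : ∀ v w, ⟪h v, ι w⟫_ℝ = ⟪v, w⟫_ℝ) :
    ∃ R : H →ₗ.[ℝ] H, IsSelfAdjoint R ∧ (∀ u : R.domain, 0 ≤ ⟪R u, (u : H)⟫_ℝ) ∧
      (∀ v, ∃ (hv : ι v ∈ R.domain) (hR : R ⟨ι v, hv⟩ ∈ R.domain),
        R ⟨R ⟨ι v, hv⟩, hR⟩ = h v - ι v) ∧
      ∀ x : R.domain, ∃ u : ℕ → V, Tendsto (fun n => ι (u n)) atTop (𝓝 (x : H)) ∧ CauchySeq u := by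
  let W := UniformSpace.Completion V
  let e : V →L[ℝ] W := UniformSpace.Completion.toComplL
  have he : DenseRange e := UniformSpace.Completion.denseRange_coe
  have hei : IsUniformInducing e := UniformSpace.Completion.isUniformInducing_coe V
  have hen : ∀ v, ‖e v‖ = ‖v‖ := UniformSpace.Completion.norm_coe
  have heinner : ∀ v w, ⟪e v, e w⟫_ℝ = ⟪v, w⟫_ℝ := UniformSpace.Completion.inner_coe
  let J : W →L[ℝ] H := ι.extend e
  have hJe : ∀ v, J (e v) = ι v := fun v => ContinuousLinearMap.extend_eq _ he hei v
  have hJn : ∀ w, ‖J w‖ ≤ ‖w‖ := fun w => he.induction_on (p := fun w => ‖J w‖ ≤ ‖w‖) w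
    (isClosed_le (by fun_prop) (by fun_prop)) fun v => by rw [hJe, hen]; exact hι v
  let J' : H →L[ℝ] W := J.adjoint
  have hJ' : ∀ f w, ⟪J' f, w⟫_ℝ = ⟪f, J w⟫_ℝ := fun f w => J.adjoint_inner_left w f
  have hJ'n : ∀ f, ‖J' f‖ ≤ ‖f‖ := by
    intro f
    have h1 : ‖J' f‖ ≤ ‖J'‖ * ‖f‖ := J'.le_opNorm f
    have h2 : ‖J'‖ ≤ 1 := by
      simp only [J', LinearIsometryEquiv.norm_map]
      exact J.opNorm_le_bound zero_le_one (by simpa using hJn)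
    exact h1.trans (mul_le_of_le_one_left (norm_nonneg _) h2)
  have hJ'inj : ∀ f, J' f = 0 → f = 0 := by
    intro f hf
    refine hd.eq_zero_of_inner_left ℝ fun v => ?_
    rw [← hJe, ← hJ', hf, inner_zero_left]
  let T : H →L[ℝ] H := J ∘L J'
  have hTT : ∀ f g, ⟪T f, g⟫_ℝ = ⟪J' f, J' g⟫_ℝ := fun f g => by
    rw [real_inner_comm]
    change ⟪g, J (J' f)⟫_ℝ = _
    rw [← hJ', real_inner_comm]
  have hTsa : IsSelfAdjoint T := by
    refine ContinuousLinearMap.isSelfAdjoint_iff_isSymmetric.2 fun f g => ?_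
    change ⟪T f, g⟫_ℝ = ⟪f, T g⟫_ℝ
    rw [hTT, real_inner_comm _ f, hTT, real_inner_comm]
  have hT0 : ‖T‖ ≤ 1 := T.opNorm_le_bound zero_le_one fun f => by
    rw [one_mul]; exact (hJn _).trans (hJ'n f)
  have hT1 : ‖1 - T‖ ≤ 1 := (1 - T).opNorm_le_bound zero_le_one fun f => by
    rw [one_mul]
    refine le_of_sq_le_sq ?_ (norm_nonneg _)
    have h1 : ‖f - T f‖ ^ 2 = ‖f‖ ^ 2 - 2 * ⟪f, T f⟫_ℝ + ‖T f‖ ^ 2 := norm_sub_sq_real f (T f)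
    have h2 : ⟪f, T f⟫_ℝ = ‖J' f‖ ^ 2 := by
      rw [real_inner_comm, hTT, real_inner_self_eq_norm_sq]
    have h3 : ‖T f‖ ^ 2 ≤ ‖J' f‖ ^ 2 := pow_le_pow_left₀ (norm_nonneg _) (hJn _) 2
    change ‖f - T f‖ ^ 2 ≤ _
    nlinarith [sq_nonneg ‖J' f‖]
  have hTinj : ∀ f, T f = 0 → f = 0 := by
    intro f hf
    refine hJ'inj f ?_
    rw [← inner_self_eq_zero (𝕜 := ℝ), ← hTT, hf, inner_zero_left]
  obtain ⟨C, S, R, hC, hS, hCC, hSS, hCS, hCd, hRsa, hRpos, hRC, hRd⟩ :=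
    exists_selfAdjoint_of_resolvent hTsa hT0 hT1 hTinj
  have hCCa : ∀ f, C (C f) = T f := fun f => by rw [← hCC]; rfl
  have hSSa : ∀ f, S (S f) = f - T f := fun f => congrArg (fun A : H →L[ℝ] H => A f) hSS
  have hCSa : ∀ f, C (S f) = S (C f) := fun f => congrArg (fun A : H →L[ℝ] H => A f) hCS.eq
  have hJ'h : ∀ v, J' (h v) = e v := by
    intro v
    refine ext_inner_right ℝ fun w => ?_
    refine he.induction_on (p := fun w => ⟪J' (h v), w⟫_ℝ = ⟪e v, w⟫_ℝ) w
      (isClosed_eq (by fun_prop) (by fun_prop)) fun w => ?_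
    rw [hJ', hJe, hh, heinner]
  have hTh : ∀ v, ι v = C (C (h v)) := fun v => by
    rw [hCCa]; change _ = J (J' (h v)); rw [hJ'h, hJe]
  refine ⟨R, hRsa, hRpos, fun v => ?_, fun x => ?_⟩
  · obtain ⟨h1, h2⟩ := hRC (C (h v))
    obtain ⟨h3, h4⟩ := hRC (S (h v))
    have e1 : (⟨ι v, by rw [hTh]; exact h1⟩ : R.domain) = ⟨C (C (h v)), h1⟩ := Subtype.ext (hTh v)
    have e2 : R ⟨ι v, by rw [hTh]; exact h1⟩ = C (S (h v)) := by rw [e1, h2, hCSa]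
    refine ⟨by rw [hTh]; exact h1, by rw [e2]; exact h3, ?_⟩
    have e3 : (⟨R ⟨ι v, by rw [hTh]; exact h1⟩, by rw [e2]; exact h3⟩ : R.domain) =
        ⟨C (S (h v)), h3⟩ := Subtype.ext e2
    rw [e3, h4, hSSa, ← hCCa, ← hTh]
  · -- Write `x = C f` and approximate `f` by `C hₙ`. Since `‖J† h‖ = ‖C h‖`, the vectors `J† hₙ`
    -- converge to some `w` in the completion, and `x = J w`.
    obtain ⟨f, hf⟩ := hRd x x.2
    have hiso : ∀ g, ‖J' g‖ = ‖C g‖ := by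
      intro g
      have h1 : ‖J' g‖ ^ 2 = ‖C g‖ ^ 2 := by
        rw [← real_inner_self_eq_norm_sq, ← hTT, ← hCCa, ← real_inner_self_eq_norm_sq]
        exact (ContinuousLinearMap.isSelfAdjoint_iff_isSymmetric.1 hC) _ _
      exact (pow_left_inj₀ (norm_nonneg _) (norm_nonneg _) two_ne_zero).1 h1
    obtain ⟨g, hg, hgf⟩ := mem_closure_iff_seq_limit.1 (hCd f)
    choose k hk using hg
    have hkC : Tendsto (fun n => C (k n)) atTop (𝓝 f) := by simpa only [hk] using hgf
    have hcau : CauchySeq fun n => J' (k n) := by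
      have := hkC.cauchySeq
      rw [Metric.cauchySeq_iff] at this ⊢
      intro ε hε
      obtain ⟨N, hN⟩ := this ε hε
      refine ⟨N, fun m hm n hn => ?_⟩
      rw [dist_eq_norm, ← map_sub, hiso, map_sub, ← dist_eq_norm]
      exact hN m hm n hn
    obtain ⟨w, hw⟩ := cauchySeq_tendsto_of_complete hcau
    have hJw : J w = x := by
      have h1 : Tendsto (fun n => J (J' (k n))) atTop (𝓝 (J w)) := (J.continuous.tendsto w).comp hw
      have h2 : Tendsto (fun n => C (C (k n))) atTop (𝓝 (C f)) := (C.continuous.tendsto f).comp hkC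
      rw [hf]
      refine tendsto_nhds_unique h1 (h2.congr fun n => ?_)
      rw [hCCa]; rfl
    obtain ⟨y, hy, hyw⟩ := mem_closure_iff_seq_limit.1 (he w)
    choose u hu using hy
    have huw : Tendsto (fun n => e (u n)) atTop (𝓝 w) := by simpa only [hu] using hyw
    refine ⟨u, ?_, ?_⟩
    · have := (J.continuous.tendsto w).comp huw
      rw [hJw] at this
      exact this.congr fun n => hJe _
    · exact hei.cauchy_map_iff.1 (by rw [Filter.map_map]; exact huw.cauchySeq)

/-- A copy of the domain of an operator, to carry the form norm. -/
def FormSpace (A : H →ₗ.[ℝ] H) : Type := A.domain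

instance (A : H →ₗ.[ℝ] H) : AddCommGroup (FormSpace A) := inferInstanceAs (AddCommGroup A.domain)

instance (A : H →ₗ.[ℝ] H) : Module ℝ (FormSpace A) := inferInstanceAs (Module ℝ A.domain)

/-- The scalar product `⟪A u, v⟫ + ⟪u, v⟫` on the domain of a symmetric non-negative operator. -/
noncomputable abbrev formCore (A : H →ₗ.[ℝ] H)
    (hs : ∀ u v : A.domain, ⟪A u, (v : H)⟫_ℝ = ⟪(u : H), A v⟫_ℝ)
    (hp : ∀ u : A.domain, 0 ≤ ⟪A u, (u : H)⟫_ℝ) : InnerProductSpace.Core ℝ (FormSpace A) where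
  inner u v := ⟪A (show A.domain from u), ((show A.domain from v : A.domain) : H)⟫_ℝ +
    ⟪((show A.domain from u : A.domain) : H), ((show A.domain from v : A.domain) : H)⟫_ℝ
  conj_inner_symm u v := by
    exact congrArg₂ (· + ·) ((hs v u).trans (real_inner_comm _ _)) (real_inner_comm _ _)
  re_inner_nonneg u := by
    simp only [RCLike.re_to_real]
    exact add_nonneg (hp _) real_inner_self_nonneg
  add_left u v w := by
    change ⟪A ((show A.domain from u) + (show A.domain from v)), _⟫_ℝ +
      ⟪(((show A.domain from u) + (show A.domain from v) : A.domain) : H), _⟫_ℝ = _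
    rw [LinearPMap.map_add, Submodule.coe_add, inner_add_left, inner_add_left]
    ring
  smul_left u v r := by
    change ⟪A (r • (show A.domain from u)), _⟫_ℝ +
      ⟪((r • (show A.domain from u) : A.domain) : H), _⟫_ℝ = _
    rw [LinearPMap.map_smul, Submodule.coe_smul, real_inner_smul_left, real_inner_smul_left]
    simp only [conj_trivial]
    ring
  definite u hu := by
    have h1 := hp u
    have h2 : (0 : ℝ) ≤ ⟪((show A.domain from u : A.domain) : H), (show A.domain from u : A.domain)⟫_ℝ :=
      real_inner_self_nonneg
    have h3 : ⟪((show A.domain from u : A.domain) : H), (show A.domain from u : A.domain)⟫_ℝ = 0 :=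
      le_antisymm (by linarith) h2
    exact Subtype.ext (inner_self_eq_zero.1 h3)

theorem IsSquareRoot.inner_eq {A R : H →ₗ.[ℝ] H} (hR : IsSquareRoot A R) (u v : A.domain) :
    ⟪R ⟨u, (hR.2.2 u).1⟩, R ⟨v, (hR.2.2 v).1⟩⟫_ℝ = ⟪A u, (v : H)⟫_ℝ := by
  obtain ⟨hu, hRu, h⟩ := hR.2.2 u
  obtain ⟨hv, -, -⟩ := hR.2.2 v
  have hsa := hR.1
  have key := R.adjoint_isFormalAdjoint hsa.dense_domain
  rw [LinearPMap.isSelfAdjoint_def.1 hsa] at key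
  rw [← key ⟨R ⟨u, hu⟩, hRu⟩ ⟨v, hv⟩, h]

theorem IsSquareRoot.norm_sq_eq {A R : H →ₗ.[ℝ] H} (hR : IsSquareRoot A R) (u : A.domain) :
    ‖R ⟨u, (hR.2.2 u).1⟩‖ ^ 2 = ⟪A u, (u : H)⟫_ℝ := by
  rw [← real_inner_self_eq_norm_sq, hR.inner_eq]

/-- A symmetric non-negative densely defined operator has a square root `R` (that of its Friedrichs
extension) for which its domain is a core. -/
theorem exists_isSquareRoot_core {A : H →ₗ.[ℝ] H} (hd : Dense (A.domain : Set H))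
    (hs : ∀ u v : A.domain, ⟪A u, (v : H)⟫_ℝ = ⟪(u : H), A v⟫_ℝ)
    (hp : ∀ u : A.domain, 0 ≤ ⟪A u, (u : H)⟫_ℝ) :
    ∃ (R : H →ₗ.[ℝ] H) (hR : IsSquareRoot A R), ∀ x : R.domain, ∃ u : ℕ → A.domain,
      Tendsto (fun n => (u n : H)) atTop (𝓝 (x : H)) ∧
      Tendsto (fun n => R ⟨u n, (hR.2.2 (u n)).1⟩) atTop (𝓝 (R x)) := by
  let c := formCore A hs hp
  let _ : NormedAddCommGroup (FormSpace A) := c.toNormedAddCommGroup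
  let _ : InnerProductSpace ℝ (FormSpace A) := InnerProductSpace.ofCore c.toCore
  have hinner : ∀ u v : A.domain, ⟪(show FormSpace A from u), (show FormSpace A from v)⟫_ℝ =
      ⟪A u, (v : H)⟫_ℝ + ⟪(u : H), (v : H)⟫_ℝ := fun u v => rfl
  have hnorm : ∀ u : A.domain, ‖(show FormSpace A from u)‖ ^ 2 =
      ⟪A u, (u : H)⟫_ℝ + ‖(u : H)‖ ^ 2 := fun u => by
    rw [← real_inner_self_eq_norm_sq, hinner, real_inner_self_eq_norm_sq]
  let ι₀ : FormSpace A →ₗ[ℝ] H := A.domain.subtype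
  have hι : ∀ v : FormSpace A, ‖ι₀ v‖ ≤ ‖v‖ := fun v => by
    refine le_of_sq_le_sq ?_ (norm_nonneg _)
    have := hnorm v
    have h2 := hp v
    change ‖((show A.domain from v : A.domain) : H)‖ ^ 2 ≤ ‖v‖ ^ 2
    change ‖v‖ ^ 2 = _ at this
    rw [this]
    exact le_add_of_nonneg_left h2
  let ι : FormSpace A →L[ℝ] H := ι₀.mkContinuous 1 (by simpa using hι)
  have hιd : DenseRange ι := by
    have : range ι = (A.domain : Set H) := by
      ext x; constructor
      · rintro ⟨u, rfl⟩; exact (show A.domain from u).2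
      · intro hx; exact ⟨(⟨x, hx⟩ : A.domain), rfl⟩
    rw [DenseRange, this]; exact hd
  obtain ⟨R, hRsa, hRpos, hRR, hcore⟩ := exists_selfAdjoint_of_embedding ι hι hιd
    (fun v => A (show A.domain from v) + ((show A.domain from v : A.domain) : H)) (fun v w => by
      rw [inner_add_left]; rfl)
  have hR : IsSquareRoot A R := ⟨hRsa, hRpos, fun u => by
    obtain ⟨h1, h2, h3⟩ := hRR u
    exact ⟨h1, h2, h3.trans (add_sub_cancel_right _ _)⟩⟩
  refine ⟨R, hR, fun x => ?_⟩
  obtain ⟨u, hux, hcau⟩ := hcore x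
  refine ⟨fun n => (u n : FormSpace A), hux, ?_⟩
  have hRcau : CauchySeq fun n => R ⟨(show A.domain from u n : A.domain), (hR.2.2 (u n)).1⟩ := by
    rw [Metric.cauchySeq_iff] at hcau ⊢
    intro ε hε
    obtain ⟨N, hN⟩ := hcau ε hε
    refine ⟨N, fun m hm n hn => lt_of_le_of_lt ?_ (hN m hm n hn)⟩
    rw [dist_eq_norm, dist_eq_norm, ← LinearPMap.map_sub]
    refine le_of_sq_le_sq ?_ (norm_nonneg _)
    have h1 := hR.norm_sq_eq ((show A.domain from u m) - (show A.domain from u n))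
    have h2 := hnorm ((show A.domain from u m) - (show A.domain from u n))
    change ‖u m - u n‖ ^ 2 = _ at h2
    rw [h2]
    refine (le_of_eq h1).trans (le_add_of_nonneg_right (sq_nonneg _))
  obtain ⟨y, hy⟩ := cauchySeq_tendsto_of_complete hRcau
  have hcl : _root_.IsClosed (R.graph : Set (H × H)) := hRsa.isClosed
  have hmem : ((x : H), y) ∈ R.graph := hcl.mem_of_tendsto (hux.prodMk_nhds hy)
    (Eventually.of_forall fun n => R.mem_graph ⟨(show A.domain from u n : A.domain), _⟩)
  have : R x = y := by
    obtain ⟨z, hz1, hz2⟩ := (LinearPMap.mem_graph_iff R).1 hmem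
    have : z = x := Subtype.ext hz1
    rw [← this]; exact hz2
  rw [this]; exact hy

end

/-! ### The form of a symmetric non-negative operator and its closure -/

section

variable {H : Type} [NormedAddCommGroup H] [InnerProductSpace ℝ H]

/-- The form `(u, v) ↦ ⟪A u, v⟫` on the domain of `A`. -/
noncomputable def opForm (A : H →ₗ.[ℝ] H) : PForm H where
  domain := A.domain
  form := LinearMap.mk₂ ℝ (fun u v => ⟪A u, (v : H)⟫_ℝ)
    (fun u v w => by rw [LinearPMap.map_add, inner_add_left])
    (fun r u v => by rw [LinearPMap.map_smul, real_inner_smul_left, smul_eq_mul])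
    (fun u v w => by rw [Submodule.coe_add, inner_add_right])
    (fun r u v => by rw [Submodule.coe_smul, real_inner_smul_right, smul_eq_mul])

/-- The form `(u, v) ↦ ⟪R u, R v⟫` on the domain of `R`. -/
noncomputable def sqForm (R : H →ₗ.[ℝ] H) : PForm H where
  domain := R.domain
  form := LinearMap.mk₂ ℝ (fun u v => ⟪R u, R v⟫_ℝ)
    (fun u v w => by rw [LinearPMap.map_add, inner_add_left])
    (fun r u v => by rw [LinearPMap.map_smul, real_inner_smul_left, smul_eq_mul])
    (fun u v w => by rw [LinearPMap.map_add, inner_add_right])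
    (fun r u v => by rw [LinearPMap.map_smul, real_inner_smul_right, smul_eq_mul])

theorem opForm_form (A : H →ₗ.[ℝ] H) (u v : A.domain) :
    (opForm A).form u v = ⟪A u, (v : H)⟫_ℝ := rfl

theorem sqForm_form1_self (R : H →ₗ.[ℝ] H) (u : R.domain) :
    (sqForm R).form1 u u = ‖R u‖ ^ 2 + ‖(u : H)‖ ^ 2 := by
  rw [← real_inner_self_eq_norm_sq, ← real_inner_self_eq_norm_sq]; rfl

theorem sqForm_isSymm (R : H →ₗ.[ℝ] H) : (sqForm R).IsSymm := fun _ _ => real_inner_comm _ _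

theorem sqForm_isNonneg (R : H →ₗ.[ℝ] H) : (sqForm R).IsNonneg := fun _ => real_inner_self_nonneg

theorem sqForm_weakSector (R : H →ₗ.[ℝ] H) : (sqForm R).WeakSector := by
  refine ⟨1, one_pos, fun x y => ?_⟩
  rw [show (sqForm R).form1 x x = _ from sqForm_form1_self R x,
    show (sqForm R).form1 y y = _ from sqForm_form1_self R y, one_mul, ← Real.sqrt_mul (by positivity)]
  refine Real.abs_le_sqrt ?_
  change (⟪R x, R y⟫_ℝ + ⟪(x : H), (y : H)⟫_ℝ) ^ 2 ≤ _
  have h1 := abs_real_inner_le_norm (R x) (R y)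
  have h2 := abs_real_inner_le_norm (x : H) (y : H)
  have h3 : |⟪R x, R y⟫_ℝ + ⟪(x : H), (y : H)⟫_ℝ| ≤ ‖R x‖ * ‖R y‖ + ‖(x : H)‖ * ‖(y : H)‖ :=
    (abs_add_le _ _).trans (add_le_add h1 h2)
  have h4 := sq_le_sq' (by linarith [neg_abs_le (⟪R x, R y⟫_ℝ + ⟪(x : H), (y : H)⟫_ℝ)])
    ((le_abs_self _).trans h3)
  nlinarith [sq_nonneg (‖R x‖ * ‖(y : H)‖ - ‖(x : H)‖ * ‖R y‖)]

theorem le_sqrt_add_sq (a b : ℝ) : b ≤ √(a ^ 2 + b ^ 2) :=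
  Real.le_sqrt_of_sq_le (by nlinarith [sq_nonneg a])

/-- If the form norm is the graph norm of `R`, a sequence `u` is Cauchy for it if and only if both `u`
and `R u` are Cauchy. -/
theorem isCauchy_of_norm {a : PForm H} {R : H →ₗ.[ℝ] H} (hdom : ∀ x ∈ a.domain, x ∈ R.domain)
    (ha : ∀ x : a.domain, a.form1 x x = ‖R ⟨x, hdom x x.2⟩‖ ^ 2 + ‖(x : H)‖ ^ 2)
    (u : ℕ → a.domain) :
    a.IsCauchy u ↔ CauchySeq (fun n => (u n : H)) ∧ CauchySeq fun n => R ⟨u n, hdom _ (u n).2⟩ := by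
  have hsub : ∀ m n, R ⟨(u m - u n : a.domain), hdom _ (u m - u n).2⟩ =
      R ⟨u m, hdom _ (u m).2⟩ - R ⟨u n, hdom _ (u n).2⟩ := fun m n => by
    rw [← LinearPMap.map_sub]; rfl
  have hF : ∀ m n, a.form1 (u m - u n) (u m - u n) =
      ‖R ⟨u m, hdom _ (u m).2⟩ - R ⟨u n, hdom _ (u n).2⟩‖ ^ 2 + ‖(u m : H) - u n‖ ^ 2 :=
    fun m n => by rw [ha, hsub]; rfl
  simp only [PForm.IsCauchy, Metric.cauchySeq_iff, hF, dist_eq_norm]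
  constructor
  · intro h
    refine ⟨fun ε hε => ?_, fun ε hε => ?_⟩
    · obtain ⟨N, hN⟩ := h ε hε
      exact ⟨N, fun m hm n hn => (le_sqrt_add_sq _ _).trans_lt (hN m hm n hn)⟩
    · obtain ⟨N, hN⟩ := h ε hε
      refine ⟨N, fun m hm n hn => lt_of_le_of_lt ?_ (hN m hm n hn)⟩
      rw [add_comm]
      exact le_sqrt_add_sq _ _
  · rintro ⟨h1, h2⟩ ε hε
    obtain ⟨N1, hN1⟩ := h1 (ε / 2) (half_pos hε)
    obtain ⟨N2, hN2⟩ := h2 (ε / 2) (half_pos hε)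
    refine ⟨max N1 N2, fun m hm n hn => ?_⟩
    have e1 := hN1 m (le_of_max_le_left hm) n (le_of_max_le_left hn)
    have e2 := hN2 m (le_of_max_le_right hm) n (le_of_max_le_right hn)
    refine (Real.sqrt_lt_sqrt (by positivity) ?_).trans_le (Real.sqrt_sq hε.le).le
    nlinarith [norm_nonneg ((u m : H) - u n),
      norm_nonneg (R ⟨u m, hdom _ (u m).2⟩ - R ⟨u n, hdom _ (u n).2⟩)]

theorem tendsto_of_isClosed {R : H →ₗ.[ℝ] H} (hR : R.IsClosed) {u : ℕ → R.domain} {x y : H}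
    (hx : Tendsto (fun n => (u n : H)) atTop (𝓝 x)) (hy : Tendsto (fun n => R (u n)) atTop (𝓝 y)) :
    ∃ h : x ∈ R.domain, R ⟨x, h⟩ = y := by
  have hmem : (x, y) ∈ R.graph := _root_.IsClosed.mem_of_tendsto (s := (R.graph : Set (H × H))) hR
    (hx.prodMk_nhds hy) (Eventually.of_forall fun n => R.mem_graph (u n))
  obtain ⟨z, hz1, hz2⟩ := (LinearPMap.mem_graph_iff R).1 hmem
  dsimp only at hz1 hz2
  subst hz1
  exact ⟨z.2, hz2⟩

variable [CompleteSpace H]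

theorem sqForm_isClosed {R : H →ₗ.[ℝ] H} (hR : R.IsClosed) : (sqForm R).IsClosed := by
  intro u hu
  obtain ⟨h1, h2⟩ := (isCauchy_of_norm (R := R) (fun _ h => h) (sqForm_form1_self R) u).1 hu
  obtain ⟨x, hx⟩ := cauchySeq_tendsto_of_complete h1
  obtain ⟨y, hy⟩ := cauchySeq_tendsto_of_complete h2
  obtain ⟨hxd, hxy⟩ := tendsto_of_isClosed hR (u := u) hx hy
  refine ⟨⟨x, hxd⟩, ?_⟩
  have h3 : ∀ n, (sqForm R).form1 (u n - ⟨x, hxd⟩) (u n - ⟨x, hxd⟩) =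
      ‖R (u n) - y‖ ^ 2 + ‖(u n : H) - x‖ ^ 2 := fun n => by
    have hs : R ((show R.domain from u n) - ⟨x, hxd⟩) = R (u n) - y := by
      rw [LinearPMap.map_sub, hxy]
    rw [← hs]
    exact sqForm_form1_self R ((show R.domain from u n) - ⟨x, hxd⟩)
  simp only [h3]
  have h4 : Tendsto (fun n => √(‖R (u n) - y‖ ^ 2 + ‖(u n : H) - x‖ ^ 2)) atTop
      (𝓝 √(‖y - y‖ ^ 2 + ‖x - x‖ ^ 2)) :=
    (Real.continuous_sqrt.tendsto _).comp
      ((((hy.sub_const y).norm).pow 2).add (((hx.sub_const x).norm).pow 2))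
  simpa using h4

section SquareRoot

variable {A R : H →ₗ.[ℝ] H}

theorem IsSquareRoot.isCauchy_iff (hR : IsSquareRoot A R) (u : ℕ → A.domain) :
    (opForm A).IsCauchy u ↔ CauchySeq (fun n => (u n : H)) ∧
      CauchySeq fun n => R ⟨u n, (hR.2.2 (u n)).1⟩ := by
  refine isCauchy_of_norm (a := opForm A) (R := R) (fun x hx => (hR.2.2 ⟨x, hx⟩).1) (fun x => ?_) u
  change ⟪A x, (x : H)⟫_ℝ + ⟪(x : H), (x : H)⟫_ℝ = _
  rw [real_inner_self_eq_norm_sq]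
  congr 1
  exact (hR.norm_sq_eq x).symm

theorem IsSquareRoot.opForm_isClosable (hR : IsSquareRoot A R) : (opForm A).IsClosable := by
  intro u hu hc
  obtain ⟨-, h2⟩ := (hR.isCauchy_iff u).1 hc
  obtain ⟨y, hy⟩ := cauchySeq_tendsto_of_complete h2
  obtain ⟨h0, hy0⟩ := tendsto_of_isClosed (IsSelfAdjoint.isClosed hR.1) hu hy
  have hy00 : y = 0 := by rw [← hy0]; exact R.map_zero
  have h3 : Tendsto (fun n => ‖R ⟨u n, (hR.2.2 (u n)).1⟩‖ ^ 2) atTop (𝓝 0) := by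
    simpa [hy00] using hy.norm.pow 2
  exact h3.congr fun n => hR.norm_sq_eq (u n)

/-- A limit of a sequence that is Cauchy for the form norm lies in the domain of `R`. -/
theorem IsSquareRoot.tendsto_of_isCauchy (hR : IsSquareRoot A R) {u : ℕ → A.domain} {x : H}
    (hc : (opForm A).IsCauchy u) (hu : Tendsto (fun n => (u n : H)) atTop (𝓝 x)) :
    ∃ h : x ∈ R.domain, Tendsto (fun n => R ⟨u n, (hR.2.2 (u n)).1⟩) atTop (𝓝 (R ⟨x, h⟩)) := by
  obtain ⟨-, h2⟩ := (hR.isCauchy_iff u).1 hc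
  obtain ⟨y, hy⟩ := cauchySeq_tendsto_of_complete h2
  obtain ⟨h0, hy0⟩ := tendsto_of_isClosed (IsSelfAdjoint.isClosed hR.1) hu hy
  exact ⟨h0, by rw [hy0]; exact hy⟩

theorem IsSquareRoot.tendsto_opForm (hR : IsSquareRoot A R) {u v : ℕ → A.domain} {y z : H}
    (hu : Tendsto (fun n => R ⟨u n, (hR.2.2 (u n)).1⟩) atTop (𝓝 y))
    (hv : Tendsto (fun n => R ⟨v n, (hR.2.2 (v n)).1⟩) atTop (𝓝 z)) :
    Tendsto (fun n => (opForm A).form (u n) (v n)) atTop (𝓝 ⟪y, z⟫_ℝ) :=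
  (hu.inner hv).congr fun _ => hR.inner_eq _ _

/-- The domain of `A` is a core of the square root `R`. -/
def IsSquareRoot.HasOpCore (hR : IsSquareRoot A R) : Prop :=
  ∀ x : R.domain, ∃ u : ℕ → A.domain, Tendsto (fun n => (u n : H)) atTop (𝓝 (x : H)) ∧
    Tendsto (fun n => R ⟨u n, (hR.2.2 (u n)).1⟩) atTop (𝓝 (R x))

/-- If the domain of `A` is a core of `R`, the form `‖R ·‖²` is the closure of the form of `A`. -/
theorem IsSquareRoot.sqForm_isClosureOf (hR : IsSquareRoot A R) (hc : hR.HasOpCore) :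
    (sqForm R).IsClosureOf (opForm A) := by
  refine ⟨fun x => ⟨fun hx => ?_, ?_⟩, fun x y u v hu hux hv hvy => ?_⟩
  · obtain ⟨u, h1, h2⟩ := hc ⟨x, hx⟩
    exact ⟨u, (hR.isCauchy_iff u).2 ⟨h1.cauchySeq, h2.cauchySeq⟩, h1⟩
  · rintro ⟨u, hu, hux⟩
    exact (hR.tendsto_of_isCauchy hu hux).1
  · exact hR.tendsto_opForm (hR.tendsto_of_isCauchy hu hux).2 (hR.tendsto_of_isCauchy hv hvy).2

theorem IsSquareRoot.isClosable_domRestrict (hR : IsSquareRoot A R) :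
    (R.domRestrict A.domain).IsClosable :=
  ((IsSelfAdjoint.isClosed hR.1).isClosable).leIsClosable LinearPMap.domRestrict_le

theorem IsSquareRoot.exists_seq_closure (hR : IsSquareRoot A R)
    (x : (R.domRestrict A.domain).closure.domain) : ∃ u : ℕ → A.domain,
      Tendsto (fun n => (u n : H)) atTop (𝓝 (x : H)) ∧
      Tendsto (fun n => R ⟨u n, (hR.2.2 (u n)).1⟩) atTop
        (𝓝 ((R.domRestrict A.domain).closure x)) := by
  have h1 := LinearPMap.mem_graph _ x
  rw [← hR.isClosable_domRestrict.graph_closure_eq_closure_graph] at h1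
  obtain ⟨p, hp, hpx⟩ := mem_closure_iff_seq_limit.1
    (show ((x : H), _) ∈ closure ((R.domRestrict A.domain).graph : Set (H × H)) from h1)
  choose z hz1 hz2 using fun n => (LinearPMap.mem_graph_iff _).1 (hp n)
  have hpx' := (Prod.tendsto_iff _ _).1 hpx
  refine ⟨fun n => ⟨z n, (z n).2.1⟩, hpx'.1.congr fun n => (hz1 n).symm,
    hpx'.2.congr fun n => ?_⟩
  rw [← hz2 n]
  rfl

/-- The closed form expressed through the closure of the restriction of an arbitrary square root. -/
theorem IsSquareRoot.sqForm_eq_closure {R' : H →ₗ.[ℝ] H} (hR : IsSquareRoot A R)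
    (hc : hR.HasOpCore) (hR' : IsSquareRoot A R') :
    (sqForm R).domain = (R'.domRestrict A.domain).closure.domain ∧
      ∀ (u v : (sqForm R).domain) (u' v' : (R'.domRestrict A.domain).closure.domain),
        (u : H) = u' → (v : H) = v' → (sqForm R).form u v =
          ⟪(R'.domRestrict A.domain).closure u', (R'.domRestrict A.domain).closure v'⟫_ℝ := by
  have hcl := hR.sqForm_isClosureOf hc
  refine ⟨?_, fun u v u' v' huu hvv => ?_⟩
  · ext x
    rw [hcl.1]
    constructor
    · rintro ⟨u, hu, hux⟩
      obtain ⟨h, hlim⟩ := hR'.tendsto_of_isCauchy hu hux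
      have hle := (R'.domRestrict A.domain).le_closure
      refine (tendsto_of_isClosed (R := (R'.domRestrict A.domain).closure)
        hR'.isClosable_domRestrict.closure_isClosed
        (u := fun n => ⟨u n, hle.1 ⟨(u n).2, (hR'.2.2 (u n)).1⟩⟩) hux
        (hlim.congr fun n => ?_)).1
      exact hle.2 (x := ⟨u n, (u n).2, (hR'.2.2 (u n)).1⟩) rfl
    · intro hx
      obtain ⟨u, h1, h2⟩ := hR'.exists_seq_closure ⟨x, hx⟩
      exact ⟨u, (hR'.isCauchy_iff u).2 ⟨h1.cauchySeq, h2.cauchySeq⟩, h1⟩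
  · obtain ⟨p, hp1, hp2⟩ := hR'.exists_seq_closure u'
    obtain ⟨q, hq1, hq2⟩ := hR'.exists_seq_closure v'
    refine tendsto_nhds_unique (hcl.2 u v p q
      ((hR'.isCauchy_iff p).2 ⟨hp1.cauchySeq, hp2.cauchySeq⟩) (by rw [huu]; exact hp1)
      ((hR'.isCauchy_iff q).2 ⟨hq1.cauchySeq, hq2.cauchySeq⟩) (by rw [hvv]; exact hq1)) ?_
    exact hR'.tendsto_opForm hp2 hq2

end SquareRoot

/-- Lower semicontinuity of the form `‖R ·‖²` of a self-adjoint operator `R`. -/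
theorem mem_domain_of_tendsto_of_norm_le {R : H →ₗ.[ℝ] H} (hR : IsSelfAdjoint R)
    {v : ℕ → R.domain} {x : H} {M : ℕ → ℝ} {m : ℝ} (hv : Tendsto (fun n => (v n : H)) atTop (𝓝 x))
    (hM : ∀ n, ‖R (v n)‖ ≤ M n) (hm : Tendsto M atTop (𝓝 m)) :
    ∃ h : x ∈ R.domain, ‖R ⟨x, h⟩‖ ≤ m := by
  have hsa := LinearPMap.isSelfAdjoint_def.1 hR
  have hd := hR.dense_domain
  have hsymm : ∀ u w : R.domain, ⟪R u, (w : H)⟫_ℝ = ⟪(u : H), R w⟫_ℝ := by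
    have := R.adjoint_isFormalAdjoint hd
    rw [hsa] at this
    exact this
  have hbound : ∀ w : R.domain, |⟪x, R w⟫_ℝ| ≤ m * ‖(w : H)‖ := by
    intro w
    refine le_of_tendsto_of_tendsto (hv.inner tendsto_const_nhds).abs (hm.mul_const _)
      (Eventually.of_forall fun n => ?_)
    dsimp only
    rw [← hsymm]
    exact (abs_real_inner_le_norm _ _).trans
      (mul_le_mul_of_nonneg_right (hM n) (norm_nonneg _))
  have hx : x ∈ R.domain := by
    rw [← hsa, LinearPMap.mem_adjoint_domain_iff]
    exact AddMonoidHomClass.continuous_of_bound ((innerₛₗ ℝ x).comp R.toFun) m hbound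
  refine ⟨hx, ?_⟩
  have h1 : ∀ w : H, ⟪R ⟨x, hx⟩, w⟫_ℝ ≤ m * ‖w‖ := by
    intro w
    have hcl : _root_.IsClosed {w : H | ⟪R ⟨x, hx⟩, w⟫_ℝ ≤ m * ‖w‖} :=
      isClosed_le (by fun_prop) (by fun_prop)
    refine closure_minimal (fun w hw => ?_) hcl (hd w)
    exact (hsymm ⟨x, hx⟩ ⟨w, hw⟩).le.trans ((le_abs_self _).trans (hbound ⟨w, hw⟩))
  have h2 := h1 (R ⟨x, hx⟩)
  rw [real_inner_self_eq_norm_mul_norm] at h2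
  by_contra hcon
  push Not at hcon
  have hm0 : 0 ≤ m := ge_of_tendsto hm (Eventually.of_forall fun n => (norm_nonneg _).trans (hM n))
  nlinarith [norm_nonneg (R ⟨x, hx⟩)]

end

/-! ### The σ-field on finite configurations -/

section

variable {d : ℕ}

open Classical in
/-- The configuration of the values of a tuple. -/
noncomputable def FinConfig.ofTuple {n : ℕ} (x : Fin n → Eucl d) : FinConfig d :=
  ⟨Finset.univ.image x⟩

/-- The configurations without points in `U`. -/
def voidSet (U : Set (Eucl d)) : Set (FinConfig d) := {B | ∀ x ∈ B.pts, x ∉ U}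

theorem voidSet_union (U V : Set (Eucl d)) : voidSet (U ∪ V) = voidSet U ∩ voidSet V := by
  ext B
  simp only [voidSet, mem_ofPred_eq, mem_inter_iff, mem_union, not_or]
  exact ⟨fun h => ⟨fun x hx => (h x hx).1, fun x hx => (h x hx).2⟩,
    fun h x hx => ⟨h.1 x hx, h.2 x hx⟩⟩

theorem mem_pts_ofTuple {n : ℕ} (x : Fin n → Eucl d) (y : Eucl d) :
    y ∈ (FinConfig.ofTuple x).pts ↔ ∃ i, x i = y := by simp [FinConfig.ofTuple]

theorem ofTuple_mem_voidSet {n : ℕ} (x : Fin n → Eucl d) (U : Set (Eucl d)) :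
    FinConfig.ofTuple x ∈ voidSet U ↔ ∀ i, x i ∉ U := by
  simp only [voidSet, mem_ofPred_eq, mem_pts_ofTuple]
  exact ⟨fun h i => h _ ⟨i, rfl⟩, by rintro h _ ⟨i, rfl⟩; exact h i⟩

theorem FinConfig.exists_eq_ofTuple (B : FinConfig d) :
    ∃ x : Fin B.pts.card → Eucl d, Function.Injective x ∧ B = FinConfig.ofTuple x := by
  refine ⟨fun i => (B.pts.equivFin.symm i : Eucl d),
    Subtype.val_injective.comp B.pts.equivFin.symm.injective, ?_⟩
  cases B with | mk s => ?_
  simp only [FinConfig.ofTuple, FinConfig.mk.injEq]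
  ext y
  simp only [Finset.mem_image, Finset.mem_univ, true_and]
  constructor
  · intro hy; exact ⟨s.equivFin ⟨y, hy⟩, by simp⟩
  · rintro ⟨i, rfl⟩; exact (s.equivFin.symm i).2

theorem measurable_ofTuple (n : ℕ) :
    Measurable (FinConfig.ofTuple : (Fin n → Eucl d) → FinConfig d) := by
  classical
  refine measurable_generateFrom ?_
  rintro A ⟨C, m, hC, rfl⟩
  -- The number of distinct values in `C` is the number of first occurrences.
  have key : ∀ x : Fin n → Eucl d, (((FinConfig.ofTuple x).pts : Set (Eucl d)) ∩ C).ncard =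
      ∑ i, if x i ∈ C ∧ ∀ j < i, x j ≠ x i then 1 else 0 := by
    intro x
    rw [Finset.sum_boole, Nat.cast_id, ← Set.ncard_coe_finset]
    symm
    refine Set.ncard_congr (fun i _ => x i) (fun i hi => ?_) (fun i j hi hj hij => ?_) ?_
    · simp only [Finset.coe_filter, mem_ofPred_eq, Finset.mem_univ, true_and] at hi
      exact ⟨(mem_pts_ofTuple x _).2 ⟨i, rfl⟩, hi.1⟩
    · simp only [Finset.coe_filter, mem_ofPred_eq, Finset.mem_univ, true_and] at hi hj
      rcases lt_trichotomy i j with h | h | h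
      · exact absurd hij (hj.2 i h)
      · exact h
      · exact absurd hij.symm (hi.2 j h)
    · rintro y ⟨hy, hyC⟩
      have hne : (Finset.univ.filter fun i => x i = y).Nonempty := by
        obtain ⟨i, hi⟩ := (mem_pts_ofTuple x y).1 hy
        exact ⟨i, by simpa using hi⟩
      have hm := Finset.min'_mem _ hne
      simp only [Finset.mem_filter, Finset.mem_univ, true_and] at hm
      refine ⟨(Finset.univ.filter fun i => x i = y).min' hne, ?_, hm⟩
      simp only [Finset.coe_filter, mem_ofPred_eq, Finset.mem_univ, true_and]
      refine ⟨by rw [hm]; exact hyC, fun j hj hj' => ?_⟩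
      have := Finset.min'_le (Finset.univ.filter fun i => x i = y) j (by simp [hj', hm])
      exact absurd hj (not_lt.2 this)
  have hmeas : Measurable fun x : Fin n → Eucl d =>
      ∑ i, if x i ∈ C ∧ ∀ j < i, x j ≠ x i then 1 else 0 := by
    refine Finset.measurable_sum _ fun i _ => Measurable.ite ?_ measurable_const measurable_const
    refine MeasurableSet.inter (measurable_pi_apply i hC.measurableSet) ?_
    have : {x : Fin n → Eucl d | ∀ j < i, x j ≠ x i} = ⋂ j, ⋂ _ : j < i, {x | x j = x i}ᶜ := by
      ext x; simp
    change MeasurableSet {x : Fin n → Eucl d | ∀ j < i, x j ≠ x i}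
    rw [this]
    exact MeasurableSet.iInter fun j => MeasurableSet.iInter fun _ =>
      (measurableSet_eq_fun (measurable_pi_apply j) (measurable_pi_apply i)).compl
  have : (FinConfig.ofTuple : (Fin n → Eucl d) → FinConfig d) ⁻¹'
      {B | ((B.pts : Set (Eucl d)) ∩ C).ncard = m} =
      (fun x : Fin n → Eucl d => ∑ i, if x i ∈ C ∧ ∀ j < i, x j ≠ x i then 1 else 0) ⁻¹' {m} := by
    ext x
    simp only [mem_preimage, mem_ofPred_eq, mem_singleton_iff, key]
  rw [this]
  exact hmeas (measurableSet_singleton m)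

/-- Enumerations without repetition of finite configurations, a standard Borel space. -/
def TupleSpace (d : ℕ) : Type :=
  {p : ℕ × (ℕ → Eucl d) // Function.Injective fun i : Fin p.1 => p.2 i}

instance : MeasurableSpace (TupleSpace d) := Subtype.instMeasurableSpace

theorem measurableSet_injective (n : ℕ) :
    MeasurableSet {x : Fin n → Eucl d | Function.Injective x} := by
  have : {x : Fin n → Eucl d | Function.Injective x} =
      ⋂ i, ⋂ j, ⋂ _ : i ≠ j, {x | x i = x j}ᶜ := by
    ext x
    simp only [mem_ofPred_eq, mem_iInter, mem_compl_iff]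
    exact ⟨fun h i j hij => fun e => hij (h e), fun h i j e => by_contra fun hij => h i j hij e⟩
  rw [this]
  exact MeasurableSet.iInter fun i => MeasurableSet.iInter fun j => MeasurableSet.iInter fun _ =>
    (measurableSet_eq_fun (measurable_pi_apply i) (measurable_pi_apply j)).compl

instance : StandardBorelSpace (TupleSpace d) := by
  refine MeasurableSet.standardBorel (s := {p : ℕ × (ℕ → Eucl d) |
    Function.Injective fun i : Fin p.1 => p.2 i}) ?_
  have : {p : ℕ × (ℕ → Eucl d) | Function.Injective fun i : Fin p.1 => p.2 i} =
      ⋃ n, {n} ×ˢ {x | Function.Injective fun i : Fin n => x i} := by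
    ext ⟨n, x⟩; simp
  rw [this]
  refine MeasurableSet.iUnion fun n => (measurableSet_singleton n).prod ?_
  exact (measurable_pi_lambda _ fun i => measurable_pi_apply _ :
    Measurable fun (x : ℕ → Eucl d) (i : Fin n) => x i) (measurableSet_injective n)

/-- The configuration enumerated by a tuple. -/
noncomputable def TupleSpace.toConfig (p : TupleSpace d) : FinConfig d :=
  FinConfig.ofTuple fun i : Fin p.1.1 => p.1.2 i

theorem measurable_of_tupleSpace {Y : Type*} [MeasurableSpace Y] {g : TupleSpace d → Y}
    {f : ∀ n, {x : Fin n → Eucl d // Function.Injective x} → Y} (hf : ∀ n, Measurable (f n))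
    (hg : ∀ p : TupleSpace d, g p = f p.1.1 ⟨fun i => p.1.2 i, p.2⟩) : Measurable g := by
  intro s hs
  refine ⟨⋃ n, {n} ×ˢ ((fun (x : ℕ → Eucl d) (i : Fin n) => x i) ⁻¹'
    (Subtype.val '' (f n ⁻¹' s))), MeasurableSet.iUnion fun n => (measurableSet_singleton n).prod ?_,
    ?_⟩
  · refine (measurable_pi_lambda _ fun i => measurable_pi_apply _ :
      Measurable fun (x : ℕ → Eucl d) (i : Fin n) => x i) ?_
    exact (MeasurableEmbedding.subtype_coe (measurableSet_injective n)).measurableSet_image.2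
      (hf n hs)
  · ext ⟨⟨n, x⟩, hx⟩
    have := hg ⟨⟨n, x⟩, hx⟩
    refine Iff.trans ?_ (show f n ⟨fun i => x i, hx⟩ ∈ s ↔ g ⟨⟨n, x⟩, hx⟩ ∈ s by rw [this])
    simp only [mem_iUnion, mem_prod, mem_singleton_iff, mem_preimage, mem_image, Subtype.exists,
      exists_and_right, exists_eq_right]
    constructor
    · rintro ⟨m, rfl, h1, h2⟩; exact h2
    · intro h; exact ⟨n, rfl, hx, h⟩

theorem measurable_toConfig : Measurable (TupleSpace.toConfig : TupleSpace d → FinConfig d) :=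
  measurable_of_tupleSpace (fun n => (measurable_ofTuple n).comp measurable_subtype_coe)
    fun _ => rfl

theorem surjective_toConfig :
    Function.Surjective (TupleSpace.toConfig : TupleSpace d → FinConfig d) := by
  intro B
  obtain ⟨x, hx, hB⟩ := B.exists_eq_ofTuple
  let y : ℕ → Eucl d := fun k => if h : k < B.pts.card then x ⟨k, h⟩ else 0
  have hy : (fun i : Fin B.pts.card => y i) = x := by
    funext i; simp [y]
  exact ⟨⟨⟨B.pts.card, y⟩, by simpa only [hy] using hx⟩,
    (congrArg FinConfig.ofTuple hy).trans hB.symm⟩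

theorem countablySeparated_of_voidSet (m : MeasurableSpace (FinConfig d))
    (T : ℕ → ℕ → Set (Eucl d))
    (h1 : ∀ n k : ℕ, Metric.ball (TopologicalSpace.denseSeq (Eucl d) n) (1 / (k + 1)) ⊆ T n k)
    (h2 : ∀ n k : ℕ, T n k ⊆ Metric.closedBall (TopologicalSpace.denseSeq (Eucl d) n) (1 / (k + 1)))
    (hT : ∀ n k, MeasurableSet[m] (voidSet (T n k))) :
    MeasurableSpace.CountablySeparated (FinConfig d) := by
  have key : ∀ (B B' : FinConfig d), (∀ n k, B' ∈ voidSet (T n k) → B ∈ voidSet (T n k)) →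
      B.pts ⊆ B'.pts := by
    intro B B' h x hx
    by_contra hx'
    have hcl : IsClosed (B'.pts : Set (Eucl d)) := B'.pts.finite_toSet.isClosed
    obtain ⟨ε, hε, hball⟩ := Metric.mem_nhds_iff.1 (hcl.isOpen_compl.mem_nhds hx')
    obtain ⟨k, hk⟩ := exists_nat_one_div_lt (half_pos hε)
    obtain ⟨n, hn⟩ := (TopologicalSpace.denseRange_denseSeq (Eucl d)).exists_dist_lt x
      (Nat.one_div_pos_of_nat (n := k) (α := ℝ))
    refine h n k (fun y hy hyT => ?_) x hx (h1 n k (by simpa [Metric.mem_ball] using hn))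
    have h3 := h2 n k hyT
    refine hball (?_ : y ∈ Metric.ball x ε) hy
    rw [Metric.mem_closedBall] at h3
    rw [Metric.mem_ball]
    have := dist_triangle y (TopologicalSpace.denseSeq (Eucl d) n) x
    rw [dist_comm (TopologicalSpace.denseSeq (Eucl d) n) x] at this
    linarith
  refine ⟨⟨range fun p : ℕ × ℕ => voidSet (T p.1 p.2), countable_range _, ?_, ?_⟩⟩
  · rintro _ ⟨p, rfl⟩; exact hT _ _
  · intro B _ B' _ h
    have h' : ∀ n k, B ∈ voidSet (T n k) ↔ B' ∈ voidSet (T n k) := fun n k => h _ ⟨(n, k), rfl⟩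
    have := Finset.Subset.antisymm (key B B' fun n k => (h' n k).2) (key B' B fun n k => (h' n k).1)
    cases B; cases B'; simpa using this

instance : MeasurableSpace.CountablySeparated (FinConfig d) := by
  refine countablySeparated_of_voidSet inferInstance
    (fun n k => Metric.closedBall (TopologicalSpace.denseSeq (Eucl d) n) (1 / (k + 1)))
    (fun n k => Metric.ball_subset_closedBall) (fun n k => Subset.rfl) fun n k => ?_
  refine MeasurableSpace.measurableSet_generateFrom
    ⟨Metric.closedBall (TopologicalSpace.denseSeq (Eucl d) n) (1 / (k + 1)), 0,
      isCompact_closedBall _ _, ?_⟩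
  ext B
  rw [mem_ofPred_eq, Set.ncard_eq_zero (B.pts.finite_toSet.inter_of_left _)]
  exact Iff.symm (Set.eq_empty_iff_forall_notMem.trans
    ⟨fun h x hx hxU => h x ⟨hx, hxU⟩, fun h x hx => h x hx.1 hx.2⟩)

/-- By the theorem of Lusin and Souslin, measurability on `FinConfig d` may be checked on tuples
without repetition. -/
theorem measurable_of_ofTuple {Y : Type*} [MeasurableSpace Y] {G : FinConfig d → Y}
    (h : ∀ n, Measurable fun x : {x : Fin n → Eucl d // Function.Injective x} =>
      G (FinConfig.ofTuple x.1)) : Measurable G := by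
  rw [← measurable_toConfig.measurable_comp_iff_of_surjective surjective_toConfig]
  exact measurable_of_tupleSpace h fun _ => rfl

theorem measurableSet_voidSet {U : Set (Eucl d)} (hU : MeasurableSet U) :
    MeasurableSet (voidSet U) := by
  rw [← measurable_toConfig.measurableSet_preimage_iff_of_surjective surjective_toConfig]
  have h : Measurable fun p : TupleSpace d => p.toConfig ∈ voidSet U := by
    refine measurable_of_tupleSpace
      (f := fun n (x : {x : Fin n → Eucl d // Function.Injective x}) => ∀ i, x.1 i ∉ U)
      (fun n => ?_) fun p => ?_
    · refine Measurable.forall fun i => Measurable.not ?_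
      exact measurable_mem.2 hU |>.comp ((measurable_pi_apply i).comp measurable_subtype_coe)
    · exact propext (ofTuple_mem_voidSet _ U)
  exact measurableSet_setOfPred.2 h

/-- The events of emptiness of open sets form a generating π-system. -/
theorem generateFrom_voidSet_open : (inferInstance : MeasurableSpace (FinConfig d)) =
    MeasurableSpace.generateFrom {A | ∃ U : Set (Eucl d), IsOpen U ∧ A = voidSet U} := by
  refine le_antisymm ?_ (MeasurableSpace.generateFrom_le ?_)
  · -- The smaller σ-field is countably separated too, so that it is also a quotient σ-field.
    have hle : MeasurableSpace.generateFrom {A | ∃ U : Set (Eucl d), IsOpen U ∧ A = voidSet U} ≤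
        (inferInstance : MeasurableSpace (FinConfig d)) := by
      refine MeasurableSpace.generateFrom_le ?_
      rintro _ ⟨U, hU, rfl⟩
      exact measurableSet_voidSet hU.measurableSet
    intro s hs
    have hsep := countablySeparated_of_voidSet
      (MeasurableSpace.generateFrom {A | ∃ U : Set (Eucl d), IsOpen U ∧ A = voidSet U})
      (fun n k => Metric.ball (TopologicalSpace.denseSeq (Eucl d) n) (1 / (k + 1)))
      (fun n k => Subset.rfl) (fun n k => Metric.ball_subset_closedBall) fun n k =>
      MeasurableSpace.measurableSet_generateFrom ⟨_, Metric.isOpen_ball, rfl⟩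
    exact (@Measurable.measurableSet_preimage_iff_of_surjective (TupleSpace d) (FinConfig d) _ _
      (MeasurableSpace.generateFrom {A | ∃ U : Set (Eucl d), IsOpen U ∧ A = voidSet U}) hsep
      TupleSpace.toConfig (measurable_toConfig.mono le_rfl hle) surjective_toConfig s).1
      (measurable_toConfig hs)
  · rintro _ ⟨U, hU, rfl⟩
    exact measurableSet_voidSet hU.measurableSet

theorem isPiSystem_voidSet_open :
    IsPiSystem {A : Set (FinConfig d) | ∃ U : Set (Eucl d), IsOpen U ∧ A = voidSet U} := by
  rintro _ ⟨U, hU, rfl⟩ _ ⟨V, hV, rfl⟩ -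
  exact ⟨U ∪ V, hU.union hV, (voidSet_union U V).symm⟩

end

/-! ### Eigenfunction expansions do not depend on the eigenbasis -/

section

variable {d : ℕ} {μ : Measure (Eucl d)} {K : Eucl d → Eucl d → ℂ} {D : Set (Eucl d)}

theorem inner_toLp {α : Type*} [MeasurableSpace α] {ν : Measure α} {f g : α → ℂ}
    (hf : MemLp f 2 ν) (hg : MemLp g 2 ν) :
    ⟪hf.toLp f, hg.toLp g⟫_ℂ = ∫ x, g x * conj (f x) ∂ν := by
  rw [L2.inner_def]
  refine integral_congr_ae ?_
  filter_upwards [hf.coeFn_toLp, hg.coeFn_toLp] with x h1 h2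
  rw [h1, h2, RCLike.inner_apply]

theorem IsEigenbasis.exists_hilbertBasis {ι : Type} {lam : ι → ℝ} {φ : ι → Eucl d → ℂ}
    (h : IsEigenbasis μ K D lam φ) :
    ∃ b : HilbertBasis ι ℂ (Lp ℂ 2 (μ.restrict D)), ∀ i, b i = (h.memLp i).toLp (φ i) := by
  classical
  have ho : Orthonormal ℂ fun i => (h.memLp i).toLp (φ i) := by
    rw [orthonormal_iff_ite]
    intro i j
    rw [inner_toLp]
    split_ifs with hij
    · subst hij; exact h.norm_eq_one i
    · exact h.orthogonal j i (Ne.symm hij)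
  have hs : (Submodule.span ℂ (range fun i => (h.memLp i).toLp (φ i)))ᗮ = ⊥ := by
    rw [Submodule.eq_bot_iff]
    intro f hf
    have h1 : ∀ i, ∫ x in D, f x * conj (φ i x) ∂μ = 0 := by
      intro i
      have := (Submodule.mem_orthogonal _ _).1 hf _ (Submodule.subset_span ⟨i, rfl⟩)
      rw [← this, L2.inner_def]
      refine integral_congr_ae ?_
      filter_upwards [(h.memLp i).coeFn_toLp] with x hx
      rw [RCLike.inner_apply, hx]
    exact (Lp.eq_zero_iff_ae_eq_zero).2 (h.complete f (Lp.memLp f) h1)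
  exact ⟨HilbertBasis.mkOfOrthogonalEqBot ho hs, fun i => by
    rw [HilbertBasis.coe_mkOfOrthogonalEqBot]⟩

/-- Vectors with prescribed square-summable coefficients. -/
theorem HilbertBasis.exists_inner_eq {ι E : Type*} [NormedAddCommGroup E] [InnerProductSpace ℂ E]
    (b : HilbertBasis ι ℂ E) (c : ι → ℂ) (hc : Summable fun i => ‖c i‖ ^ 2) :
    ∃ v : E, ∀ i, ⟪b i, v⟫_ℂ = c i := by
  have hm : Memℓp c 2 := memℓp_gen (by simpa using hc)
  refine ⟨b.repr.symm ⟨c, hm⟩, fun i => ?_⟩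
  rw [← b.repr_apply_apply, LinearIsometryEquiv.apply_symm_apply]

/-- Two expansions of the same kernel, in eigenbases of the same operator, agree off a null set,
in particular on the diagonal. If `h x = ∑ √λᵢ conj (φᵢ x) φᵢ`, so that `K x y = ⟪h x, h y⟫`, then
the coefficients of `h x` in the second basis have the same form, and Parseval's identity gives
the second expansion. -/
theorem HasKernelExpansion.change_basis [IsFiniteMeasure (μ.restrict D)]
    (hDm : MeasurableSet D) (hKm : Measurable (Function.uncurry K))
    (hK2 : ∫⁻ x in D, ∫⁻ y in D, ‖K x y‖ₑ ^ 2 ∂μ ∂μ < ∞) {κ : ℝ}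
    {ι ι' : Type} [Countable ι] [Countable ι'] {lam : ι → ℝ} {lam' : ι' → ℝ}
    {φ : ι → Eucl d → ℂ} {φ' : ι' → Eucl d → ℂ}
    (h : IsEigenbasis μ K D lam φ) (h' : IsEigenbasis μ K D lam' φ')
    (hlam : ∀ i, 0 ≤ lam i ∧ lam i ≤ κ) (hsum : Summable fun i => |lam i|)
    (hexp : HasKernelExpansion μ K D lam φ) :
    (∀ j, 0 ≤ lam' j ∧ lam' j ≤ κ) ∧ Summable lam' ∧ HasKernelExpansion μ K D lam' φ' := by
  obtain ⟨N, hN0, hN⟩ := hexp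
  set ν := μ.restrict D with hν
  obtain ⟨b, hb⟩ : ∃ b : HilbertBasis ι ℂ (Lp ℂ 2 ν), ∀ i, b i = (h.memLp i).toLp (φ i) :=
    h.exists_hilbertBasis
  obtain ⟨b', hb'⟩ : ∃ b : HilbertBasis ι' ℂ (Lp ℂ 2 ν), ∀ i, b i = (h'.memLp i).toLp (φ' i) :=
    h'.exists_hilbertBasis
  have haeD : ∀ᵐ x ∂ν, x ∈ D \ N := by
    have h1 : ∀ᵐ x ∂ν, x ∈ D := ae_restrict_mem hDm
    have h2 : ∀ᵐ x ∂ν, x ∉ N := ae_restrict_of_ae (measure_eq_zero_iff_ae_notMem.1 hN0)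
    filter_upwards [h1, h2] with x hx1 hx2 using ⟨hx1, hx2⟩
  have hherm : ∀ x ∈ D \ N, ∀ y ∈ D \ N, conj (K y x) = K x y := by
    intro x hx y hy
    have h1 := (hN y hy x hx).star
    refine h1.unique ?_
    convert hN x hx y hy using 2 with i
    simp only [star_mul', RCLike.star_def, Complex.conj_conj, Complex.conj_ofReal]
    ring
  -- The operator is symmetric, so that eigenfunctions with distinct eigenvalues are orthogonal.
  have hmis : ∀ i j, (lam i : ℂ) * ⟪b i, b' j⟫_ℂ = lam' j * ⟪b i, b' j⟫_ℂ := by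
    intro i j
    have hφφ : MemLp (fun p : Eucl d × Eucl d => φ' j p.2 * conj (φ i p.1)) 2 (ν.prod ν) := by
      rw [memLp_two_iff_integrable_sq_norm]
      · have h1 := ((memLp_two_iff_integrable_sq_norm (h.memLp i).1).1 (h.memLp i)).mul_prod
          ((memLp_two_iff_integrable_sq_norm (h'.memLp j).1).1 (h'.memLp j))
        refine h1.congr (Eventually.of_forall fun p => ?_)
        simp only [norm_mul, RCLike.norm_conj, mul_pow]
        ring
      · exact (((h'.measurable j).comp measurable_snd).mul
          (Complex.continuous_conj.measurable.comp
            ((h.measurable i).comp measurable_fst))).aestronglyMeasurable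
    have hKL : MemLp (fun p : Eucl d × Eucl d => K p.1 p.2) 2 (ν.prod ν) := by
      refine ⟨hKm.aestronglyMeasurable, ?_⟩
      rw [eLpNorm_lt_top_iff_lintegral_rpow_enorm_lt_top two_ne_zero ENNReal.ofNat_ne_top]
      simp only [ENNReal.toReal_ofNat, ENNReal.rpow_ofNat]
      rw [lintegral_prod (fun p : Eucl d × Eucl d => ‖K p.1 p.2‖ₑ ^ 2)
        ((hKm.enorm.pow_const 2).aemeasurable)]
      exact hK2
    have hint : Integrable (Function.uncurry fun x y => K x y * (φ' j y * conj (φ i x)))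
        (ν.prod ν) := hKL.integrable_mul hφφ
    have hsw := integral_integral_swap hint
    have e1 : ∫ x, ∫ y, K x y * (φ' j y * conj (φ i x)) ∂ν ∂ν = lam' j * ⟪b i, b' j⟫_ℂ := by
      rw [hb, hb', inner_toLp, ← integral_const_mul]
      refine integral_congr_ae ?_
      filter_upwards [h'.eigen j] with x hx
      rw [← mul_assoc, ← hx, ← integral_mul_const]
      simp only [mul_assoc, hν]
    have e2 : ∫ y, ∫ x, K x y * (φ' j y * conj (φ i x)) ∂ν ∂ν = lam i * ⟪b i, b' j⟫_ℂ := by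
      rw [hb, hb', inner_toLp, ← integral_const_mul]
      refine integral_congr_ae ?_
      filter_upwards [h.eigen i, haeD] with y hy hyD
      have e3 : ∫ x, K x y * (φ' j y * conj (φ i x)) ∂ν =
          φ' j y * ∫ x, conj (K y x * φ i x) ∂ν := by
        rw [← integral_const_mul]
        refine integral_congr_ae ?_
        filter_upwards [haeD] with x hx
        rw [map_mul, hherm x hx y hyD]; ring
      rw [e3, integral_conj, hy, map_mul, Complex.conj_ofReal]; ring
    rw [← e1, ← e2, hsw]
  have hcoef : ∀ i j, ⟪b i, b' j⟫_ℂ ≠ 0 → lam i = lam' j := fun i j hij => by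
    exact_mod_cast mul_right_cancel₀ hij (hmis i j)
  have hlam' : ∀ j, 0 ≤ lam' j ∧ lam' j ≤ κ := by
    intro j
    have hne : ∃ i, ⟪b i, b' j⟫_ℂ ≠ 0 := by
      by_contra hcon
      push Not at hcon
      have h0 : b' j = 0 := by
        refine b.repr.injective ?_
        rw [map_zero]
        ext i
        rw [b.repr_apply_apply, hcon]; rfl
      have := b'.orthonormal.1 j
      rw [h0, norm_zero] at this
      exact zero_ne_one this
    obtain ⟨i, hi⟩ := hne
    rw [← hcoef i j hi]
    exact hlam i
  -- the vectors `h x`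
  have hdiag : ∀ x ∈ D \ N, Summable fun i => ‖((√(lam i) : ℝ) : ℂ) * conj (φ i x)‖ ^ 2 := by
    intro x hx
    have h1 := Complex.reCLM.summable (hN x hx x hx).summable
    refine h1.congr fun i => ?_
    rw [norm_mul, mul_pow, RCLike.norm_conj, Complex.norm_real, Real.norm_eq_abs, sq_abs,
      Real.sq_sqrt (hlam i).1, mul_assoc, Complex.mul_conj, Complex.normSq_eq_norm_sq,
      ← Complex.ofReal_mul]
    exact Complex.ofReal_re _
  have hv : ∀ x, ∃ v : Lp ℂ 2 ν, x ∈ D \ N →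
      ∀ i, ⟪b i, v⟫_ℂ = ((√(lam i) : ℝ) : ℂ) * conj (φ i x) := by
    intro x
    by_cases hx : x ∈ D \ N
    · obtain ⟨v, hv⟩ := b.exists_inner_eq _ (hdiag x hx)
      exact ⟨v, fun _ => hv⟩
    · exact ⟨0, fun h => absurd h hx⟩
  choose v hv using hv
  have hv2 : ∀ x ∈ D \ N, ∀ i, ⟪v x, b i⟫_ℂ = ((√(lam i) : ℝ) : ℂ) * φ i x := by
    intro x hx i
    rw [← inner_conj_symm, hv x hx i, map_mul, Complex.conj_conj, Complex.conj_ofReal]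
  have hss : ∀ {t : ℝ}, 0 ≤ t → ((√t : ℝ) : ℂ) * ((√t : ℝ) : ℂ) = t := fun ht => by
    rw [← Complex.ofReal_mul, Real.mul_self_sqrt ht]
  have hKv : ∀ x ∈ D \ N, ∀ y ∈ D \ N, K x y = ⟪v x, v y⟫_ℂ := by
    intro x hx y hy
    refine (hN x hx y hy).unique ?_
    refine (b.hasSum_inner_mul_inner (v x) (v y)).congr_fun fun i => ?_
    rw [hv2 x hx, hv y hy, ← hss (hlam i).1]; ring
  -- the coefficients of `h x` in the second basis
  have hrow : ∀ᵐ x ∂ν, MemLp (fun y => conj (K x y)) 2 ν := by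
    have h1 : ∀ᵐ x ∂ν, ∫⁻ y, ‖K x y‖ₑ ^ 2 ∂ν < ∞ := by
      refine ae_lt_top ?_ hK2.ne
      exact (hKm.enorm.pow_const 2).lintegral_prod_right'
    filter_upwards [h1] with x hx
    refine ⟨(Complex.continuous_conj.measurable.comp
      (hKm.comp measurable_prodMk_left)).aestronglyMeasurable, ?_⟩
    rw [eLpNorm_lt_top_iff_lintegral_rpow_enorm_lt_top two_ne_zero ENNReal.ofNat_ne_top]
    simp only [ENNReal.toReal_ofNat, ENNReal.rpow_ofNat]
    have e : ∀ y, ‖conj (K x y)‖ₑ = ‖K x y‖ₑ := fun y => by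
      rw [← ofReal_norm, RCLike.norm_conj, ofReal_norm]
    simpa only [e] using hx
  have hpars : ∀ᵐ x ∂ν, ∀ j, HasSum (fun i => (lam i : ℂ) * φ i x * ⟪b i, b' j⟫_ℂ)
      (lam' j * φ' j x) := by
    have h1 : ∀ᵐ x ∂ν, ∀ i, ∫ y, K x y * φ i y ∂ν = lam i * φ i x := ae_all_iff.2 h.eigen
    have h2 : ∀ᵐ x ∂ν, ∀ j, ∫ y, K x y * φ' j y ∂ν = lam' j * φ' j x := ae_all_iff.2 h'.eigen
    filter_upwards [hrow, h1, h2] with x hx hx1 hx2 j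
    have h3 := b.hasSum_inner_mul_inner (hx.toLp _) (b' j)
    rw [hb' j, inner_toLp] at h3
    simp only [Complex.conj_conj, hb, inner_toLp] at h3
    simp only [mul_comm (φ _ _) (K x _), mul_comm (φ' j _) (K x _)] at h3
    rw [hx2] at h3
    refine h3.congr_fun fun i => ?_
    rw [hb, hb', inner_toLp, hx1]
  have hcoef' : ∀ᵐ x ∂ν, x ∈ D \ N ∧ ∀ j, ⟪v x, b' j⟫_ℂ = ((√(lam' j) : ℝ) : ℂ) * φ' j x := by
    filter_upwards [hpars, haeD] with x hx hxD
    refine ⟨hxD, fun j => ?_⟩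
    have h1 := b.hasSum_inner_mul_inner (v x) (b' j)
    have h2 : ∀ i, ⟪v x, b i⟫_ℂ * ⟪b i, b' j⟫_ℂ =
        ((√(lam' j) : ℝ) : ℂ)⁻¹ * ((lam i : ℂ) * φ i x * ⟪b i, b' j⟫_ℂ) := by
      intro i
      rw [hv2 x hxD]
      by_cases h0 : ⟪b i, b' j⟫_ℂ = 0
      · rw [h0]; ring
      · rw [← hcoef i j h0]
        by_cases hz : lam i = 0
        · simp [hz]
        · have hz' : ((√(lam i) : ℝ) : ℂ) ≠ 0 := by
            rw [Complex.ofReal_ne_zero, Real.sqrt_ne_zero (hlam i).1]; exact hz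
          rw [← hss (hlam i).1]
          field_simp
    have h3 := ((hx j).mul_left ((√(lam' j) : ℝ) : ℂ)⁻¹).congr_fun h2
    rw [h1.unique h3]
    by_cases hz : lam' j = 0
    · simp [hz]
    · have hz' : ((√(lam' j) : ℝ) : ℂ) ≠ 0 := by
        rw [Complex.ofReal_ne_zero, Real.sqrt_ne_zero (hlam' j).1]; exact hz
      rw [← hss (hlam' j).1]
      field_simp
  have hfin : ∀ x, (x ∈ D \ N ∧ ∀ j, ⟪v x, b' j⟫_ℂ = ((√(lam' j) : ℝ) : ℂ) * φ' j x) →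
      ∀ y, (y ∈ D \ N ∧ ∀ j, ⟪v y, b' j⟫_ℂ = ((√(lam' j) : ℝ) : ℂ) * φ' j y) →
      HasSum (fun j => (lam' j : ℂ) * φ' j x * conj (φ' j y)) (K x y) := by
    rintro x ⟨hx, hx'⟩ y ⟨hy, hy'⟩
    rw [hKv x hx y hy]
    refine (b'.hasSum_inner_mul_inner (v x) (v y)).congr_fun fun j => ?_
    rw [← inner_conj_symm (b' j), hx', hy', map_mul, Complex.conj_ofReal, ← hss (hlam' j).1]
    ring
  refine ⟨hlam', ?_, ?_⟩
  · -- both sums equal `∫ K x x`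
    have hone : ∀ {ι₁ : Type} {lam₁ : ι₁ → ℝ} {φ₁ : ι₁ → Eucl d → ℂ}
        (_ : IsEigenbasis μ K D lam₁ φ₁) (i : ι₁), ∫⁻ x, ‖φ₁ i x‖ₑ ^ 2 ∂ν = 1 := by
      intro ι₁ lam₁ φ₁ h₁ i
      have e1 : ∫ x, ‖φ₁ i x‖ ^ 2 ∂ν = 1 := by
        have := h₁.norm_eq_one i
        simp only [Complex.mul_conj, Complex.normSq_eq_norm_sq] at this
        exact_mod_cast integral_complex_ofReal.symm.trans this
      have e2 := ofReal_integral_eq_lintegral_ofReal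
        ((memLp_two_iff_integrable_sq_norm (h₁.memLp i).1).1 (h₁.memLp i))
        (Eventually.of_forall fun _ => sq_nonneg _)
      rw [e1, ENNReal.ofReal_one] at e2
      rw [e2]
      refine lintegral_congr fun x => ?_
      rw [ENNReal.ofReal_pow (norm_nonneg _), ofReal_norm]
    have htot : ∀ {ι₁ : Type} {lam₁ : ι₁ → ℝ} {φ₁ : ι₁ → Eucl d → ℂ} [Countable ι₁]
        (_ : IsEigenbasis μ K D lam₁ φ₁) (_ : ∀ i, 0 ≤ lam₁ i)
        (_ : ∀ᵐ x ∂ν, HasSum (fun i => (lam₁ i : ℂ) * φ₁ i x * conj (φ₁ i x)) (K x x)),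
        ∑' i, ENNReal.ofReal (lam₁ i) = ∫⁻ x, ENNReal.ofReal (K x x).re ∂ν := by
      intro ι₁ lam₁ φ₁ _ h₁ hl hs
      have e1 : ∀ i, ENNReal.ofReal (lam₁ i) =
          ∫⁻ x, ENNReal.ofReal (lam₁ i) * ‖φ₁ i x‖ₑ ^ 2 ∂ν := fun i => by
        rw [lintegral_const_mul _ ((h₁.measurable i).enorm.pow_const 2), hone h₁, mul_one]
      rw [tsum_congr e1, ← lintegral_tsum fun i =>
        (((h₁.measurable i).enorm.pow_const 2).const_mul _).aemeasurable]
      refine lintegral_congr_ae ?_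
      filter_upwards [hs] with x hx
      have hx2 := Complex.reCLM.hasSum hx
      have e3 : ∀ i, Complex.reCLM ((lam₁ i : ℂ) * φ₁ i x * conj (φ₁ i x)) =
          lam₁ i * ‖φ₁ i x‖ ^ 2 := by
        intro i
        rw [mul_assoc, Complex.mul_conj, Complex.normSq_eq_norm_sq, ← Complex.ofReal_mul]
        exact Complex.ofReal_re _
      simp only [e3] at hx2
      have e4 : (K x x).re = ∑' i, lam₁ i * ‖φ₁ i x‖ ^ 2 := hx2.tsum_eq.symm
      rw [e4, ENNReal.ofReal_tsum_of_nonneg (fun i => mul_nonneg (hl i) (sq_nonneg _)) hx2.summable]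
      refine tsum_congr fun i => ?_
      rw [ENNReal.ofReal_mul (hl i), ENNReal.ofReal_pow (norm_nonneg _), ofReal_norm]
    have e1 := htot h (fun i => (hlam i).1) (by
      filter_upwards [haeD] with x hx using hN x hx x hx)
    have e2 := htot h' (fun i => (hlam' i).1) (by
      filter_upwards [hcoef'] with x hx using hfin x hx x hx)
    have hlt : ∑' i, ENNReal.ofReal (lam i) ≠ ∞ :=
      (hsum.congr fun i => abs_of_nonneg (hlam i).1).tsum_ofReal_ne_top
    rw [e1, ← e2] at hlt
    have := ENNReal.summable_toReal hlt
    exact this.congr fun j => ENNReal.toReal_ofReal (hlam' j).1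
  · refine ⟨{x | x ∈ D ∧ ¬ (x ∈ D \ N ∧ ∀ j, ⟪v x, b' j⟫_ℂ = ((√(lam' j) : ℝ) : ℂ) * φ' j x)}, ?_, ?_⟩
    · have := (ae_restrict_iff' hDm).1 hcoef'
      rw [ae_iff] at this
      simpa only [Classical.not_imp] using this
    · rintro x ⟨hx, hx'⟩ y ⟨hy, hy'⟩
      exact hfin x (by by_contra hcon; exact hx' ⟨hx, hcon⟩) y
        (by by_contra hcon; exact hy' ⟨hy, hcon⟩)

end

/-! ### Hadamard's inequality and Fredholm determinants of finite rank -/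

section

open ComplexOrder in
/-- Hadamard's inequality. -/
theorem det_gram_le {E n : Type*} [NormedAddCommGroup E] [InnerProductSpace ℂ E] [Fintype n]
    [DecidableEq n] (v : n → E) :
    0 ≤ (Matrix.gram ℂ v).det.re ∧ (Matrix.gram ℂ v).det.re ≤ ∏ i, ‖v i‖ ^ 2 := by
  refine ⟨(Complex.le_def.1 (Matrix.posSemidef_gram ℂ v).det_nonneg).1, ?_⟩
  by_cases h0 : ∃ i, v i = 0
  · obtain ⟨i, hi⟩ := h0
    rw [Matrix.det_eq_zero_of_row_eq_zero i fun j => by rw [Matrix.gram_apply, hi, inner_zero_left]]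
    exact Finset.prod_nonneg fun i _ => sq_nonneg _
  · push Not at h0
    -- Normalise the vectors, so that the eigenvalues of the Gram matrix have sum `n`.
    let u : n → E := fun i => ((‖v i‖⁻¹ : ℝ) : ℂ) • v i
    have hv : ∀ i, v i = ((‖v i‖ : ℝ) : ℂ) • u i := fun i => by
      have : ((‖v i‖ : ℝ) : ℂ) ≠ 0 := by exact_mod_cast norm_ne_zero_iff.2 (h0 i)
      simp only [u, smul_smul, Complex.ofReal_inv]
      rw [mul_inv_cancel₀ this, one_smul]
    have hu : ∀ i, ⟪u i, u i⟫_ℂ = 1 := fun i => by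
      have h1 : ‖v i‖ ≠ 0 := norm_ne_zero_iff.2 (h0 i)
      rw [inner_self_eq_norm_sq_to_K, norm_smul, Complex.norm_real, Real.norm_eq_abs,
        abs_of_nonneg (inv_nonneg.2 (norm_nonneg _)), inv_mul_cancel₀ h1]
      norm_num
    have hg : Matrix.gram ℂ v = Matrix.diagonal (fun i => ((‖v i‖ : ℝ) : ℂ)) * Matrix.gram ℂ u *
        Matrix.diagonal (fun i => ((‖v i‖ : ℝ) : ℂ)) := by
      ext i j
      rw [Matrix.mul_diagonal, Matrix.diagonal_mul, Matrix.gram_apply, Matrix.gram_apply]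
      conv_lhs => rw [hv i, hv j]
      rw [inner_smul_left, inner_smul_right, Complex.conj_ofReal]
      ring
    have hps := Matrix.posSemidef_gram ℂ u
    have hdet : (Matrix.gram ℂ u).det = ((∏ i, hps.isHermitian.eigenvalues i : ℝ) : ℂ) := by
      rw [hps.isHermitian.det_eq_prod_eigenvalues]; push_cast; rfl
    have htr : ∑ i, hps.isHermitian.eigenvalues i = Fintype.card n := by
      have h1 := hps.isHermitian.trace_eq_sum_eigenvalues
      have h2 : (Matrix.gram ℂ u).trace = (Fintype.card n : ℂ) := by
        simp only [Matrix.trace, Matrix.diag_apply, Matrix.gram_apply, hu, Finset.sum_const,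
          Finset.card_univ, nsmul_eq_mul, mul_one]
      rw [h2] at h1
      have h3 := congrArg Complex.re h1
      rw [Complex.natCast_re, Complex.re_sum] at h3
      exact h3.symm
    have hle : ∏ i, hps.isHermitian.eigenvalues i ≤ 1 := by
      calc ∏ i, hps.isHermitian.eigenvalues i
          ≤ ∏ i, Real.exp (hps.isHermitian.eigenvalues i - 1) :=
            Finset.prod_le_prod (fun i _ => hps.eigenvalues_nonneg i) fun i _ => by
              linarith [Real.add_one_le_exp (hps.isHermitian.eigenvalues i - 1)]
        _ = 1 := by
            rw [← Real.exp_sum, Finset.sum_sub_distrib, htr]; simp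
    rw [hg, Matrix.det_mul, Matrix.det_mul, Matrix.det_diagonal, hdet, ← Complex.ofReal_prod,
      ← Complex.ofReal_mul, ← Complex.ofReal_mul, Complex.ofReal_re, Finset.prod_pow]
    have h3 : 0 ≤ ∏ i, ‖v i‖ := Finset.prod_nonneg fun i _ => norm_nonneg _
    nlinarith [mul_nonneg h3 h3]

/-- Each subset with `n` elements is the range of `n!` injective tuples. -/
theorem sum_tuple_eq_factorial_mul {ι R : Type*} [Fintype ι] [DecidableEq ι] [Semiring R] (n : ℕ)
    (g : (Fin n → ι) → R) (G : Finset ι → R)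
    (h0 : ∀ s, ¬ Function.Injective s → g s = 0)
    (h1 : ∀ s, Function.Injective s → g s = G (Finset.univ.image s)) :
    ∑ s, g s = (n.factorial : R) * ∑ S ∈ Finset.univ.powersetCard n, G S := by
  classical
  have e1 : ∑ s, g s = ∑ s ∈ Finset.univ.filter (fun s : Fin n → ι => Function.Injective s), g s := by
    refine (Finset.sum_subset (Finset.filter_subset _ _) fun s _ hs => h0 s ?_).symm
    simpa using hs
  rw [e1, ← Finset.sum_fiberwise_of_maps_to (t := Finset.univ.powersetCard n)
    (g := fun s => Finset.univ.image s), Finset.mul_sum]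
  · refine Finset.sum_congr rfl fun S hS => ?_
    have hScard := (Finset.mem_powersetCard.1 hS).2
    have e2 : ∀ s ∈ (Finset.univ.filter (fun s : Fin n → ι => Function.Injective s)).filter
        (fun s => Finset.univ.image s = S), g s = G S := by
      intro s hs
      simp only [Finset.mem_filter, Finset.mem_univ, true_and] at hs
      rw [h1 s hs.1, hs.2]
    rw [Finset.sum_congr rfl e2, Finset.sum_const, nsmul_eq_mul]
    congr 2
    have e3 : Fintype.card (Fin n ≃ S) = n.factorial := by
      rw [Fintype.card_equiv (Fintype.equivFinOfCardEq (by simp [hScard])).symm, Fintype.card_fin]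
    rw [← e3, ← Finset.card_univ]
    symm
    refine Finset.card_bij (fun (e : Fin n ≃ S) _ => fun i => (e i : ι)) ?_ ?_ ?_
    · intro e _
      simp only [Finset.mem_filter, Finset.mem_univ, true_and]
      refine ⟨Subtype.val_injective.comp e.injective, ?_⟩
      ext y
      simp only [Finset.mem_image, Finset.mem_univ, true_and]
      constructor
      · rintro ⟨i, rfl⟩; exact (e i).2
      · intro hy; exact ⟨e.symm ⟨y, hy⟩, by simp⟩
    · intro e _ e' _ h
      ext i
      exact congrFun h i
    · intro s hs
      simp only [Finset.mem_filter, Finset.mem_univ, true_and] at hs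
      have hmem : ∀ i, s i ∈ S := fun i => hs.2 ▸ Finset.mem_image_of_mem _ (Finset.mem_univ i)
      refine ⟨Equiv.ofBijective (fun i => (⟨s i, hmem i⟩ : S)) ⟨fun i j hij => hs.1 ?_, ?_⟩,
        Finset.mem_univ _, rfl⟩
      · exact congrArg Subtype.val hij
      · rintro ⟨y, hy⟩
        rw [← hs.2] at hy
        obtain ⟨i, -, hi⟩ := Finset.mem_image.1 hy
        exact ⟨i, Subtype.ext hi⟩
  · intro s hs
    simp only [Finset.mem_filter, Finset.mem_univ, true_and] at hs
    rw [Finset.mem_powersetCard]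
    exact ⟨Finset.subset_univ _, by rw [Finset.card_image_of_injective _ hs]; simp⟩

/-- The Fredholm expansion of `det (1 + z M)` for a matrix, in terms of its principal minors. -/
theorem hasSum_det_submatrix {ι : Type*} [Fintype ι] [DecidableEq ι] (M : Matrix ι ι ℂ) (z : ℂ) :
    HasSum (fun n : ℕ => z ^ n / n.factorial * ∑ s : Fin n → ι, (M.submatrix s s).det)
      (1 + z • M).det := by
  set P : Polynomial ℂ := (1 + (Polynomial.X : Polynomial ℂ) • M.map Polynomial.C).det with hP
  have hcoeff : ∀ n, P.coeff n = ∑ S ∈ Finset.univ.powersetCard n,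
      (M.submatrix (Subtype.val : S → ι) (Subtype.val : S → ι)).det := fun n =>
    Matrix.coeff_det_one_add_X_smul_eq_sum_minors M n
  have hterm : ∀ n : ℕ, z ^ n / n.factorial * ∑ s : Fin n → ι, (M.submatrix s s).det =
      P.coeff n * z ^ n := by
    intro n
    rw [hcoeff, sum_tuple_eq_factorial_mul n _
      (fun S => (M.submatrix (Subtype.val : S → ι) (Subtype.val : S → ι)).det)]
    · have : (n.factorial : ℂ) ≠ 0 := by exact_mod_cast n.factorial_ne_zero
      field_simp
    · intro s hs
      simp only [Function.Injective, not_forall] at hs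
      obtain ⟨i, j, hij, hne⟩ := hs
      exact Matrix.det_zero_of_row_eq hne (by ext k; simp [hij])
    · intro s hs
      let e : Fin n ≃ (Finset.univ.image s : Finset ι) := Equiv.ofBijective
        (fun i => ⟨s i, Finset.mem_image_of_mem _ (Finset.mem_univ i)⟩)
        ⟨fun i j hij => hs (congrArg Subtype.val hij), by
          rintro ⟨y, hy⟩
          obtain ⟨i, -, hi⟩ := Finset.mem_image.1 hy
          exact ⟨i, Subtype.ext hi⟩⟩
      rw [← Matrix.det_submatrix_equiv_self e]
      rfl
  have hdeg : P.natDegree < Fintype.card ι + 1 := by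
    rw [Nat.lt_succ_iff, Polynomial.natDegree_le_iff_coeff_eq_zero]
    intro n hn
    rw [hcoeff, Finset.powersetCard_eq_empty.2 (by rwa [Finset.card_univ]), Finset.sum_empty]
  have heval : P.eval z = (1 + z • M).det := by
    rw [hP, ← Polynomial.coe_evalRingHom, RingHom.map_det]
    congr 1
    ext i j
    simp [Matrix.one_apply, apply_ite]
    ring
  rw [← heval, Polynomial.eval_eq_sum_range' hdeg]
  simp only [hterm]
  refine hasSum_sum_of_ne_finset_zero fun n hn => ?_
  rw [Finset.mem_range, not_lt] at hn
  rw [Polynomial.coeff_eq_zero_of_natDegree_lt (lt_of_lt_of_le hdeg hn), zero_mul]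

/-- Andréief's identity, for the determinant of a kernel of finite rank. -/
theorem integral_det_kernel {X ι : Type*} [MeasurableSpace X] [Fintype ι] [DecidableEq ι]
    (η : Measure X) [SigmaFinite η] (a b : ι → X → ℂ)
    (hab : ∀ i j, Integrable (fun x => a i x * b j x) η) (n : ℕ) :
    ∫ x, (Matrix.of fun p q : Fin n => ∑ i, a i (x p) * b i (x q)).det ∂Measure.pi (fun _ => η) =
      ∑ s : Fin n → ι, ((Matrix.of fun i j => ∫ x, a i x * b j x ∂η).submatrix s s).det := by
  have hexp : ∀ x : Fin n → X, (Matrix.of fun p q : Fin n => ∑ i, a i (x p) * b i (x q)).det =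
      ∑ s : Fin n → ι, ∑ σ : Equiv.Perm (Fin n), ((Equiv.Perm.sign σ : ℤ) : ℂ) *
        ∏ q, (a (s (σ q)) (x q) * b (s q) (x q)) := by
    intro x
    rw [Matrix.det_apply', Finset.sum_comm]
    rw [← Equiv.sum_comp (Equiv.inv (Equiv.Perm (Fin n)))]
    refine Finset.sum_congr rfl fun σ _ => ?_
    simp only [Equiv.inv_apply, Equiv.Perm.sign_inv, Matrix.of_apply]
    rw [← Finset.mul_sum, Finset.prod_univ_sum, Fintype.piFinset_univ]
    congr 1
    refine Finset.sum_congr rfl fun s _ => ?_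
    rw [Finset.prod_mul_distrib, Finset.prod_mul_distrib]
    congr 1
    rw [← Equiv.prod_comp σ]
    simp
  have hint : ∀ (s : Fin n → ι) (σ : Equiv.Perm (Fin n)), Integrable
      (fun x : Fin n → X => ∏ q, (a (s (σ q)) (x q) * b (s q) (x q)))
      (Measure.pi fun _ => η) := fun s σ =>
    Integrable.fintype_prod (f := fun q y => a (s (σ q)) y * b (s q) y) fun q => hab _ _
  simp only [hexp]
  rw [integral_finsetSum _ fun s _ => integrable_finsetSum _ fun σ _ => (hint s σ).const_mul _]
  refine Finset.sum_congr rfl fun s _ => ?_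
  rw [integral_finsetSum _ fun σ _ => (hint s σ).const_mul _, Matrix.det_apply']
  refine Finset.sum_congr rfl fun σ _ => ?_
  rw [integral_const_mul]
  congr 1
  exact integral_fintype_prod_eq_prod (fun q y => a (s (σ q)) y * b (s q) y)

/-- The kernel `∑_{i ∈ F} cᵢ φᵢ(x) conj (φᵢ(y))`. -/
noncomputable def finKernel {X ι : Type*} (F : Finset ι) (c : ι → ℝ) (φ : ι → X → ℂ) (x y : X) : ℂ :=
  ∑ i ∈ F, (c i : ℂ) * φ i x * conj (φ i y)

theorem hasSum_integral_det_finKernel {X ι : Type*} [MeasurableSpace X] [DecidableEq ι]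
    (η : Measure X) [SigmaFinite η] (F : Finset ι) (c : ι → ℝ) (φ : ι → X → ℂ)
    (hφ : ∀ i, MemLp (φ i) 2 η) (z : ℂ) :
    HasSum (fun n : ℕ => z ^ n / n.factorial * ∫ x, (Matrix.of fun p q : Fin n =>
        finKernel F c φ (x p) (x q)).det ∂Measure.pi (fun _ => η))
      (1 + z • Matrix.of fun i j : F => (c i : ℂ) * ∫ x, φ i x * conj (φ j x) ∂η).det := by
  have hint : ∀ i j : ι, Integrable (fun x => φ i x * conj (φ j x)) η := fun i j =>
    (hφ i).integrable_mul (hφ j).star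
  convert hasSum_det_submatrix (Matrix.of fun i j : F => (c i : ℂ) *
    ∫ x, φ i x * conj (φ j x) ∂η) z using 3 with n
  have h1 := integral_det_kernel η (fun (i : F) x => (c i : ℂ) * φ i x)
    (fun (i : F) x => conj (φ i x)) (fun i j => by
      simpa only [mul_assoc] using (hint i j).const_mul (c i : ℂ)) n
  simp only [mul_assoc, integral_const_mul] at h1
  rw [← h1]
  simp only [finKernel, mul_assoc]
  congr 1
  ext x
  congr 2
  ext p q
  exact (Finset.sum_coe_sort F fun i => (c i : ℂ) * (φ i (x p) * conj (φ i (x q)))).symm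

/-- For an orthonormal family, and finite rank, this is the identity
`det (1 - K 1_B) = det (1 - K) det (1 + J 1_{Bᶜ})` with `J = (1 - K)⁻¹ K`. -/
theorem det_one_sub_eq {X ι : Type*} [MeasurableSpace X] [DecidableEq ι]
    (ν : Measure X) (F : Finset ι) (lam : ι → ℝ) (φ : ι → X → ℂ)
    (hφ : ∀ i, MemLp (φ i) 2 ν) (hone : ∀ i, ∫ x, φ i x * conj (φ i x) ∂ν = 1)
    (horth : ∀ i j, i ≠ j → ∫ x, φ i x * conj (φ j x) ∂ν = 0) (hlam : ∀ i, lam i < 1)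
    {B : Set X} (hB : MeasurableSet B) :
    (1 + (-1 : ℂ) • Matrix.of fun i j : F =>
        (lam i : ℂ) * ∫ x in B, φ i x * conj (φ j x) ∂ν).det =
      (∏ i ∈ F, (1 - lam i : ℂ)) * (1 + (1 : ℂ) • Matrix.of fun i j : F =>
        ((lam i / (1 - lam i) : ℝ) : ℂ) * ∫ x in Bᶜ, φ i x * conj (φ j x) ∂ν).det := by
  have e1 : (∏ i ∈ F, (1 - lam i : ℂ)) = (Matrix.diagonal fun i : F => (1 - lam i : ℂ)).det := by
    rw [Matrix.det_diagonal]
    exact (Finset.prod_coe_sort F fun i => (1 - lam i : ℂ)).symm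
  rw [e1, ← Matrix.det_mul]
  congr 1
  ext i j
  rw [Matrix.diagonal_mul]
  have hG : ∫ x in B, φ i x * conj (φ j x) ∂ν + ∫ x in Bᶜ, φ i x * conj (φ j x) ∂ν =
      (1 : Matrix F F ℂ) i j := by
    have hint : Integrable (fun x => φ i x * conj (φ j x)) ν := (hφ i).integrable_mul (hφ j).star
    rw [integral_add_compl hB hint, Matrix.one_apply]
    split_ifs with h
    · rw [h]; exact hone j
    · exact horth i j fun h' => h (Subtype.ext h')
  have hne : (1 - lam i : ℂ) ≠ 0 := by
    have := hlam i
    exact_mod_cast (by linarith : (1 : ℝ) - lam i ≠ 0)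
  simp only [Matrix.add_apply, Matrix.smul_apply, Matrix.of_apply, smul_eq_mul]
  rw [← hG]
  push_cast
  field_simp
  ring

end

/-! ### Fredholm expansions of trace class kernels -/

section

variable {d : ℕ}

/-- On the conull set `T` of the measure `η`, the kernel `k` is the sum of the non-negative trace
class expansion `∑ cᵢ φᵢ(x) conj (φᵢ(y))`. -/
structure IsTraceClassOn {ι : Type} (η : Measure (Eucl d)) (k : Eucl d → Eucl d → ℂ) (c : ι → ℝ)
    (φ : ι → Eucl d → ℂ) (T : Set (Eucl d)) : Prop where
  measurable : Measurable (Function.uncurry k)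
  nonneg : ∀ i, 0 ≤ c i
  summable : Summable c
  measurable_fun : ∀ i, Measurable (φ i)
  lintegral_le : ∀ i, ∫⁻ x, ‖φ i x‖ₑ ^ 2 ∂η ≤ 1
  ae_mem : ∀ᵐ x ∂η, x ∈ T
  hasSum : ∀ x ∈ T, ∀ y ∈ T, HasSum (fun i => (c i : ℂ) * φ i x * conj (φ i y)) (k x y)

variable {ι : Type} {η : Measure (Eucl d)} {k : Eucl d → Eucl d → ℂ} {c : ι → ℝ}
  {φ : ι → Eucl d → ℂ} {T : Set (Eucl d)}

theorem measurable_detTuple (hk : Measurable (Function.uncurry k)) (n : ℕ) :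
    Measurable (detTuple k n) := by
  refine Complex.measurable_re.comp ?_
  simp only [Matrix.det_apply']
  refine Finset.measurable_sum _ fun σ _ => (Finset.measurable_prod _ fun i _ => ?_).const_mul _
  have h := (measurable_pi_apply (X := fun _ : Fin n => Eucl d) (σ i)).prodMk
    (measurable_pi_apply (X := fun _ : Fin n => Eucl d) i)
  exact hk.comp h

theorem measurable_finKernel (F : Finset ι) (c : ι → ℝ) (hφ : ∀ i, Measurable (φ i)) :
    Measurable (Function.uncurry (finKernel F c φ)) :=
  Finset.measurable_sum _ fun i _ => (((hφ i).comp measurable_fst).const_mul _).mul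
    (Complex.continuous_conj.measurable.comp ((hφ i).comp measurable_snd))

theorem detTuple_finKernel_mem (F : Finset ι) (hc : ∀ i, 0 ≤ c i) (φ : ι → Eucl d → ℂ) {n : ℕ}
    (x : Fin n → Eucl d) :
    0 ≤ detTuple (finKernel F c φ) n x ∧
      detTuple (finKernel F c φ) n x ≤ ∏ p, ∑ i ∈ F, c i * ‖φ i (x p)‖ ^ 2 := by
  let w : Eucl d → EuclideanSpace ℂ F := fun y =>
    WithLp.toLp 2 fun i : F => ((√(c i) : ℝ) : ℂ) * conj (φ i y)
  have hss : ∀ i, ((√(c i) : ℝ) : ℂ) * ((√(c i) : ℝ) : ℂ) = c i := fun i => by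
    rw [← Complex.ofReal_mul, Real.mul_self_sqrt (hc i)]
  have hgram : (Matrix.of fun p q => finKernel F c φ (x p) (x q)) =
      Matrix.gram ℂ fun p => w (x p) := by
    ext p q
    rw [Matrix.gram_apply, PiLp.inner_apply, Matrix.of_apply, finKernel,
      ← Finset.sum_coe_sort F fun i => (c i : ℂ) * φ i (x p) * conj (φ i (x q))]
    refine Finset.sum_congr rfl fun i _ => ?_
    rw [RCLike.inner_apply]
    simp only [w, map_mul, Complex.conj_conj, Complex.conj_ofReal]
    rw [← hss]; ring
  have hnorm : ∀ y, ‖w y‖ ^ 2 = ∑ i ∈ F, c i * ‖φ i y‖ ^ 2 := by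
    intro y
    rw [EuclideanSpace.norm_sq_eq, ← Finset.sum_coe_sort F fun i => c i * ‖φ i y‖ ^ 2]
    refine Finset.sum_congr rfl fun i _ => ?_
    simp only [w]
    rw [norm_mul, mul_pow, RCLike.norm_conj, Complex.norm_real, Real.norm_eq_abs, sq_abs,
      Real.sq_sqrt (hc i)]
  simp only [detTuple, hgram, ← hnorm]
  exact det_gram_le _

namespace IsTraceClassOn

theorem hasSum_diag (h : IsTraceClassOn η k c φ T) {x : Eucl d} (hx : x ∈ T) :
    HasSum (fun i => c i * ‖φ i x‖ ^ 2) (k x x).re := by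
  have h1 := Complex.reCLM.hasSum (h.hasSum x hx x hx)
  refine h1.congr_fun fun i => ?_
  rw [mul_assoc, Complex.mul_conj, Complex.normSq_eq_norm_sq, ← Complex.ofReal_mul]
  exact (Complex.ofReal_re _).symm

theorem sum_le_diag (h : IsTraceClassOn η k c φ T) {x : Eucl d} (hx : x ∈ T) (F : Finset ι) :
    ∑ i ∈ F, c i * ‖φ i x‖ ^ 2 ≤ (k x x).re :=
  sum_le_hasSum F (fun i _ => mul_nonneg (h.nonneg i) (sq_nonneg _)) (h.hasSum_diag hx)

theorem diag_nonneg (h : IsTraceClassOn η k c φ T) {x : Eucl d} (hx : x ∈ T) : 0 ≤ (k x x).re :=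
  (h.hasSum_diag hx).nonneg fun i => mul_nonneg (h.nonneg i) (sq_nonneg _)

theorem tendsto_detTuple (h : IsTraceClassOn η k c φ T) {n : ℕ} {x : Fin n → Eucl d}
    (hx : ∀ p, x p ∈ T) :
    Tendsto (fun F => detTuple (finKernel F c φ) n x) atTop (𝓝 (detTuple k n x)) := by
  refine (Complex.continuous_re.tendsto _).comp ?_
  refine ((continuous_id.matrix_det : Continuous fun A : Matrix (Fin n) (Fin n) ℂ =>
    A.det).tendsto _).comp ?_
  refine tendsto_pi_nhds.2 fun p => tendsto_pi_nhds.2 fun q => ?_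
  exact h.hasSum (x p) (hx p) (x q) (hx q)

/-- Non-negativity and Hadamard's inequality for the determinants of the kernel. -/
theorem detTuple_mem (h : IsTraceClassOn η k c φ T) {n : ℕ} {x : Fin n → Eucl d}
    (hx : ∀ p, x p ∈ T) :
    0 ≤ detTuple k n x ∧ detTuple k n x ≤ ∏ p, (k (x p) (x p)).re := by
  refine ⟨ge_of_tendsto (h.tendsto_detTuple hx) (Eventually.of_forall fun F =>
    (detTuple_finKernel_mem F h.nonneg φ x).1), le_of_tendsto (h.tendsto_detTuple hx)
    (Eventually.of_forall fun F => (detTuple_finKernel_mem F h.nonneg φ x).2.trans ?_)⟩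
  exact Finset.prod_le_prod (fun p _ => Finset.sum_nonneg fun i _ =>
    mul_nonneg (h.nonneg i) (sq_nonneg _)) fun p _ => h.sum_le_diag (hx p) F

theorem ae_tuple [IsFiniteMeasure η] (h : IsTraceClassOn η k c φ T) (n : ℕ) :
    ∀ᵐ x ∂Measure.pi (fun _ : Fin n => η), ∀ p, x p ∈ T :=
  ae_all_iff.2 fun p => (Measure.quasiMeasurePreserving_eval (μ := fun _ : Fin n => η) p).ae h.ae_mem

theorem integrable_diag [Countable ι] (h : IsTraceClassOn η k c φ T) :
    Integrable (fun x => (k x x).re) η := by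
  have hm : Measurable fun x => (k x x).re :=
    Complex.measurable_re.comp (h.measurable.comp (measurable_id.prodMk measurable_id))
  refine ⟨hm.aestronglyMeasurable, ?_⟩
  rw [hasFiniteIntegral_iff_ofReal (by filter_upwards [h.ae_mem] with x hx using h.diag_nonneg hx)]
  have e1 : ∫⁻ x, ENNReal.ofReal (k x x).re ∂η =
      ∫⁻ x, ∑' i, ENNReal.ofReal (c i) * ‖φ i x‖ₑ ^ 2 ∂η := by
    refine lintegral_congr_ae ?_
    filter_upwards [h.ae_mem] with x hx
    rw [← (h.hasSum_diag hx).tsum_eq, ENNReal.ofReal_tsum_of_nonneg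
      (fun i => mul_nonneg (h.nonneg i) (sq_nonneg _)) (h.hasSum_diag hx).summable]
    refine tsum_congr fun i => ?_
    rw [ENNReal.ofReal_mul (h.nonneg i), ENNReal.ofReal_pow (norm_nonneg _), ofReal_norm]
  rw [e1, lintegral_tsum fun i => (((h.measurable_fun i).enorm.pow_const 2).const_mul _).aemeasurable]
  refine lt_of_le_of_lt (ENNReal.tsum_le_tsum (g := fun i => ENNReal.ofReal (c i)) fun i => ?_)
    (lt_top_iff_ne_top.2 h.summable.tsum_ofReal_ne_top)
  rw [lintegral_const_mul _ ((h.measurable_fun i).enorm.pow_const 2)]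
  exact mul_le_of_le_one_right (zero_le) (h.lintegral_le i)

theorem integrable_prod_diag [Countable ι] [IsFiniteMeasure η] (h : IsTraceClassOn η k c φ T)
    (n : ℕ) : Integrable (fun x : Fin n → Eucl d => ∏ p, (k (x p) (x p)).re)
      (Measure.pi fun _ => η) :=
  Integrable.fintype_prod (f := fun _ y => (k y y).re) fun _ => h.integrable_diag

theorem integrable_detTuple [Countable ι] [IsFiniteMeasure η] (h : IsTraceClassOn η k c φ T)
    (n : ℕ) : Integrable (detTuple k n) (Measure.pi fun _ => η) := by
  refine (h.integrable_prod_diag n).mono' (measurable_detTuple h.measurable n).aestronglyMeasurable ?_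
  filter_upwards [h.ae_tuple n] with x hx
  rw [Real.norm_eq_abs, abs_of_nonneg (h.detTuple_mem hx).1]
  exact (h.detTuple_mem hx).2

theorem integral_prod_diag [IsFiniteMeasure η] (n : ℕ) :
    ∫ x : Fin n → Eucl d, ∏ p, (k (x p) (x p)).re ∂Measure.pi (fun _ => η) =
      (∫ x, (k x x).re ∂η) ^ n := by
  rw [integral_fintype_prod_eq_prod (fun _ y => (k y y).re)]; simp

theorem integral_detTuple_nonneg [IsFiniteMeasure η] (h : IsTraceClassOn η k c φ T)
    (n : ℕ) : 0 ≤ ∫ x, detTuple k n x ∂Measure.pi (fun _ => η) :=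
  integral_nonneg_of_ae (by filter_upwards [h.ae_tuple n] with x hx using (h.detTuple_mem hx).1)

theorem integral_detTuple_le [Countable ι] [IsFiniteMeasure η] (h : IsTraceClassOn η k c φ T)
    (n : ℕ) : ∫ x, detTuple k n x ∂Measure.pi (fun _ => η) ≤ (∫ x, (k x x).re ∂η) ^ n := by
  rw [← integral_prod_diag]
  refine integral_mono_ae (h.integrable_detTuple n) (h.integrable_prod_diag n) ?_
  filter_upwards [h.ae_tuple n] with x hx using (h.detTuple_mem hx).2

theorem summable_fredholm [Countable ι] [IsFiniteMeasure η] (h : IsTraceClassOn η k c φ T)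
    {z : ℝ} (hz : |z| ≤ 1) : Summable fun n : ℕ =>
      z ^ n / n.factorial * ∫ x, detTuple k n x ∂Measure.pi (fun _ => η) := by
  refine Summable.of_norm_bounded (Real.summable_pow_div_factorial (∫ x, (k x x).re ∂η)) fun n => ?_
  rw [Real.norm_eq_abs, abs_mul, abs_div, abs_pow, Nat.abs_cast,
    abs_of_nonneg (h.integral_detTuple_nonneg n), div_mul_eq_mul_div]
  refine div_le_div_of_nonneg_right ?_ (Nat.cast_nonneg _)
  refine (mul_le_of_le_one_left (h.integral_detTuple_nonneg n) ?_).trans (h.integral_detTuple_le n)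
  exact pow_le_one₀ (abs_nonneg z) hz

/-- The Fredholm expansion is the limit of those of the truncated kernels. -/
theorem tendsto_fredholm [Countable ι] [IsFiniteMeasure η] (h : IsTraceClassOn η k c φ T)
    {z : ℝ} (hz : |z| ≤ 1) :
    Tendsto (fun F => ∑' n : ℕ, z ^ n / n.factorial *
        ∫ x, detTuple (finKernel F c φ) n x ∂Measure.pi (fun _ => η)) atTop
      (𝓝 (∑' n : ℕ, z ^ n / n.factorial * ∫ x, detTuple k n x ∂Measure.pi (fun _ => η))) := by
  have hbd : ∀ (F : Finset ι) (n : ℕ), ∀ᵐ x ∂Measure.pi (fun _ : Fin n => η),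
      ‖detTuple (finKernel F c φ) n x‖ ≤ ∏ p, (k (x p) (x p)).re := by
    intro F n
    filter_upwards [h.ae_tuple n] with x hx
    have h1 := detTuple_finKernel_mem F h.nonneg φ x
    rw [Real.norm_eq_abs, abs_of_nonneg h1.1]
    exact h1.2.trans (Finset.prod_le_prod (fun p _ => Finset.sum_nonneg fun i _ =>
      mul_nonneg (h.nonneg i) (sq_nonneg _)) fun p _ => h.sum_le_diag (hx p) F)
  refine tendsto_tsum_of_dominated_convergence
    (Real.summable_pow_div_factorial (∫ x, (k x x).re ∂η)) (fun n => ?_)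
    (Eventually.of_forall fun F n => ?_)
  · refine Tendsto.const_mul _ (tendsto_integral_filter_of_dominated_convergence
      (fun x => ∏ p, (k (x p) (x p)).re) (Eventually.of_forall fun F =>
      (measurable_detTuple (measurable_finKernel F c h.measurable_fun) n).aestronglyMeasurable)
      (Eventually.of_forall fun F => hbd F n) (h.integrable_prod_diag n) ?_)
    filter_upwards [h.ae_tuple n] with x hx using h.tendsto_detTuple hx
  · rw [norm_mul, norm_div, norm_pow, Real.norm_eq_abs, Real.norm_eq_abs, Nat.abs_cast,
      div_mul_eq_mul_div]
    refine div_le_div_of_nonneg_right ?_ (Nat.cast_nonneg _)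
    have h2 : ‖∫ x, detTuple (finKernel F c φ) n x ∂Measure.pi (fun _ => η)‖ ≤
        (∫ x, (k x x).re ∂η) ^ n := by
      rw [← integral_prod_diag]
      exact norm_integral_le_of_norm_le (h.integrable_prod_diag n) (hbd F n)
    exact (mul_le_of_le_one_left (norm_nonneg _) (pow_le_one₀ (abs_nonneg z) hz)).trans h2

theorem restrict (h : IsTraceClassOn η k c φ T) (B : Set (Eucl d)) :
    IsTraceClassOn (η.restrict B) k c φ T :=
  ⟨h.measurable, h.nonneg, h.summable, h.measurable_fun, fun i =>
    (setLIntegral_le_lintegral _ _).trans (h.lintegral_le i), ae_restrict_of_ae h.ae_mem, h.hasSum⟩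

theorem memLp (h : IsTraceClassOn η k c φ T) (i : ι) : MemLp (φ i) 2 η := by
  refine ⟨(h.measurable_fun i).aestronglyMeasurable, ?_⟩
  rw [eLpNorm_lt_top_iff_lintegral_rpow_enorm_lt_top two_ne_zero ENNReal.ofNat_ne_top]
  simp only [ENNReal.toReal_ofNat, ENNReal.rpow_ofNat]
  exact (h.lintegral_le i).trans_lt ENNReal.one_lt_top

theorem tsum_finKernel [DecidableEq ι] [IsFiniteMeasure η] (h : IsTraceClassOn η k c φ T)
    (F : Finset ι) (z : ℝ) :
    ∑' n : ℕ, z ^ n / n.factorial *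
        ∫ x, detTuple (finKernel F c φ) n x ∂Measure.pi (fun _ => η) =
      (1 + (z : ℂ) • Matrix.of fun i j : F =>
        (c i : ℂ) * ∫ x, φ i x * conj (φ j x) ∂η).det.re := by
  have h1 := Complex.reCLM.hasSum (hasSum_integral_det_finKernel η F c φ h.memLp (z : ℂ))
  refine (h1.congr_fun fun n => ?_).tsum_eq
  have hint : Integrable (fun x : Fin n → Eucl d =>
      (Matrix.of fun p q : Fin n => finKernel F c φ (x p) (x q)).det) (Measure.pi fun _ => η) := by
    simp only [Matrix.det_apply', finKernel, Matrix.of_apply, Finset.prod_univ_sum, Finset.mul_sum]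
    refine integrable_finsetSum _ fun σ _ => integrable_finsetSum _ fun s _ => ?_
    refine Integrable.const_mul ?_ _
    have e : ∀ x : Fin n → Eucl d, ∏ i, ((c (s i) : ℂ) * φ (s i) (x (σ i)) * conj (φ (s i) (x i))) =
        ∏ i, ((c (s i) : ℂ) * φ (s (σ⁻¹ i)) (x i) * conj (φ (s i) (x i))) := by
      intro x
      simp only [Finset.prod_mul_distrib]
      congr 2
      rw [← Equiv.prod_comp σ (fun i => φ (s (σ⁻¹ i)) (x i))]
      simp
    simp only [e]
    simp only [mul_assoc]
    exact Integrable.fintype_prod (f := fun i y => (c (s i) : ℂ) * (φ (s (σ⁻¹ i)) y * conj (φ (s i) y)))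
      fun i => ((h.memLp _).integrable_mul (h.memLp _).star).const_mul _
  have h2 : (∫ x : Fin n → Eucl d, (Matrix.of fun p q : Fin n =>
      finKernel F c φ (x p) (x q)).det ∂Measure.pi (fun _ => η)).re =
      ∫ x, detTuple (finKernel F c φ) n x ∂Measure.pi (fun _ => η) :=
    (integral_re hint).symm
  have h3 : ((z : ℂ) ^ n / (n.factorial : ℂ)) = ((z ^ n / n.factorial : ℝ) : ℂ) := by push_cast; rfl
  change _ = ((z : ℂ) ^ n / (n.factorial : ℂ) * _).re
  rw [h3, Complex.re_ofReal_mul, h2]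

end IsTraceClassOn

/-- The identity `det (1 - K 1_B) = det (1 - K) det (1 + J 1_{Bᶜ})` for trace class kernels. The
factor `det (1 - K)` is expressed as `(det (1 + J))⁻¹`. -/
theorem fredholm_complement [Countable ι] {ν : Measure (Eucl d)} [IsFiniteMeasure ν]
    {K J : Eucl d → Eucl d → ℂ} {lam : ι → ℝ} {T T' : Set (Eucl d)}
    (hK : IsTraceClassOn ν K lam φ T)
    (hJ : IsTraceClassOn ν J (fun i => lam i / (1 - lam i)) φ T')
    (hone : ∀ i, ∫ x, φ i x * conj (φ i x) ∂ν = 1)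
    (horth : ∀ i j, i ≠ j → ∫ x, φ i x * conj (φ j x) ∂ν = 0) (hlam : ∀ i, lam i < 1)
    {B : Set (Eucl d)} (hB : MeasurableSet B) :
    0 < ∑' n : ℕ, (1 : ℝ) ^ n / n.factorial * ∫ x, detTuple J n x ∂Measure.pi (fun _ => ν) ∧
    ∑' n : ℕ, (-1 : ℝ) ^ n / n.factorial *
        ∫ x, detTuple K n x ∂Measure.pi (fun _ => ν.restrict B) =
      (∑' n : ℕ, (1 : ℝ) ^ n / n.factorial * ∫ x, detTuple J n x ∂Measure.pi (fun _ => ν))⁻¹ *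
      ∑' n : ℕ, (1 : ℝ) ^ n / n.factorial *
        ∫ x, detTuple J n x ∂Measure.pi (fun _ => ν.restrict Bᶜ) := by
  classical
  have hpos : 0 < ∑' n : ℕ, (1 : ℝ) ^ n / n.factorial *
      ∫ x, detTuple J n x ∂Measure.pi (fun _ => ν) := by
    have hs := hJ.summable_fredholm (z := 1) (by simp)
    refine hs.tsum_pos (fun n => mul_nonneg (by positivity) (hJ.integral_detTuple_nonneg n)) 0 ?_
    simp [detTuple, Measure.real]
  refine ⟨hpos, ?_⟩
  have hfin : ∀ (F : Finset ι) {B : Set (Eucl d)} (_ : MeasurableSet B),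
      ∑' n : ℕ, (-1 : ℝ) ^ n / n.factorial *
        ∫ x, detTuple (finKernel F lam φ) n x ∂Measure.pi (fun _ => ν.restrict B) =
      (∏ i ∈ F, (1 - lam i)) * ∑' n : ℕ, (1 : ℝ) ^ n / n.factorial *
        ∫ x, detTuple (finKernel F (fun i => lam i / (1 - lam i)) φ) n x
          ∂Measure.pi (fun _ => ν.restrict Bᶜ) := by
    intro F B hB
    rw [(hK.restrict B).tsum_finKernel, (hJ.restrict Bᶜ).tsum_finKernel]
    have h1 := det_one_sub_eq ν F lam φ hK.memLp hone horth hlam hB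
    have h2 : (∏ i ∈ F, (1 - lam i : ℂ)) = ((∏ i ∈ F, (1 - lam i) : ℝ) : ℂ) := by push_cast; rfl
    rw [h2] at h1
    have h3 := congrArg Complex.re h1
    rw [Complex.re_ofReal_mul] at h3
    simpa only [Complex.ofReal_neg, Complex.ofReal_one] using h3
  have hprod : ∀ F : Finset ι, ∏ i ∈ F, (1 - lam i) =
      (∑' n : ℕ, (1 : ℝ) ^ n / n.factorial *
        ∫ x, detTuple (finKernel F (fun i => lam i / (1 - lam i)) φ) n x
          ∂Measure.pi (fun _ => ν))⁻¹ := by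
    intro F
    have h1 := hfin F MeasurableSet.empty
    have h2 : ∑' n : ℕ, (-1 : ℝ) ^ n / n.factorial *
        ∫ x, detTuple (finKernel F lam φ) n x ∂Measure.pi (fun _ => ν.restrict ∅) = 1 := by
      rw [(hK.restrict ∅).tsum_finKernel]
      have : (Matrix.of fun i j : F => (lam i : ℂ) *
          ∫ x, φ i x * conj (φ j x) ∂ν.restrict ∅) = 0 := by
        ext i j; simp
      rw [this]; simp
    rw [h2, compl_empty, Measure.restrict_univ] at h1
    exact eq_inv_of_mul_eq_one_left h1.symm
  have hl := (hK.restrict B).tendsto_fredholm (z := -1) (by simp)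
  have hr := ((hJ.tendsto_fredholm (z := 1) (by simp)).inv₀ hpos.ne').mul
    ((hJ.restrict Bᶜ).tendsto_fredholm (z := 1) (by simp))
  refine tendsto_nhds_unique hl (hr.congr fun F => ?_)
  rw [hfin F hB, hprod]

end

/-! ### Probability of emptiness from correlation functions -/

section

variable {d : ℕ}

open Classical in
/-- The number of points of a configuration in `B`. -/
noncomputable def ptsIn (B : Set (Eucl d)) (ω : FinConfig d) : ℕ :=
  (ω.pts.filter (· ∈ B)).card

theorem measurable_ptsIn {B : Set (Eucl d)} (hB : MeasurableSet B) : Measurable (ptsIn B) := by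
  classical
  refine measurable_of_ofTuple fun n => ?_
  have h : ∀ x : {x : Fin n → Eucl d // Function.Injective x},
      ptsIn B (FinConfig.ofTuple x.1) = ∑ i, if x.1 i ∈ B then 1 else 0 := by
    intro x
    rw [Finset.sum_boole, Nat.cast_id, ptsIn, FinConfig.ofTuple, Finset.filter_image,
      Finset.card_image_of_injective _ x.2]
  simp only [h]
  refine Finset.measurable_sum _ fun i _ => Measurable.ite ?_ measurable_const measurable_const
  exact ((measurable_pi_apply i).comp measurable_subtype_coe) hB

theorem ptsIn_eq_zero_iff (B : Set (Eucl d)) (ω : FinConfig d) :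
    ptsIn B ω = 0 ↔ ω ∈ voidSet B := by
  classical
  simp [ptsIn, voidSet, Finset.filter_eq_empty_iff]

theorem sum_ptsIn {C : Type*} [Fintype C] (γ : Eucl d → C) (B : Set (Eucl d)) (ω : FinConfig d) :
    ∑ c, ptsIn (B ∩ γ ⁻¹' {c}) ω = ptsIn B ω := by
  classical
  rw [ptsIn, Finset.card_eq_sum_card_fiberwise (f := γ) (t := Finset.univ) fun _ _ => by simp]
  refine Finset.sum_congr rfl fun c _ => ?_
  rw [ptsIn, Finset.filter_filter]
  simp only [mem_inter_iff, mem_preimage, mem_singleton_iff]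

theorem detTuple_eq_zero (k : Eucl d → Eucl d → ℂ) {n : ℕ} {x : Fin n → Eucl d}
    (hx : ¬ Function.Injective x) : detTuple k n x = 0 := by
  simp only [Function.Injective, not_forall] at hx
  obtain ⟨i, j, hij, hne⟩ := hx
  rw [detTuple, Matrix.det_zero_of_row_eq hne, Complex.zero_re]
  funext l; simp [hij]

/-- The elementary symmetric functions as sums over tuples. -/
theorem prod_one_add_smul_eq_sum {C : Type*} [Fintype C] (a : C → ℝ) (s : ℝ) {m : ℕ}
    (hm : Fintype.card C < m) :
    ∏ c, (1 + s * a c) = ∑ n ∈ Finset.range m, s ^ n / n.factorial *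
      ∑ e : Fin n → C, {e : Fin n → C | Function.Injective e}.indicator (fun e => ∏ i, a (e i)) e := by
  classical
  rw [Finset.prod_one_add, Finset.sum_powerset]
  have hz : ∀ n ∈ Finset.range m, n ∉ Finset.range (Finset.univ.card (α := C) + 1) →
      s ^ n / n.factorial * ∑ e : Fin n → C,
        {e : Fin n → C | Function.Injective e}.indicator (fun e => ∏ i, a (e i)) e = 0 := by
    intro n _ hn
    rw [Finset.sum_eq_zero, mul_zero]
    intro e _
    refine indicator_of_notMem (fun he : Function.Injective e => hn ?_) _
    have := Fintype.card_le_of_injective e he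
    rw [Fintype.card_fin] at this
    exact Finset.mem_range.2 (Nat.lt_succ_of_le this)
  rw [← Finset.sum_subset (Finset.range_mono (Nat.succ_le_of_lt hm)) hz]
  refine Finset.sum_congr rfl fun n _ => ?_
  rw [sum_tuple_eq_factorial_mul n _ (fun S => ∏ c ∈ S, a c)
    (fun e he => indicator_of_notMem he _) fun e he => by
      rw [indicator_of_mem (show e ∈ {e : Fin n → C | Function.Injective e} from he),
        Finset.prod_image fun _ _ _ _ h => he h]]
  have : (n.factorial : ℝ) ≠ 0 := by exact_mod_cast n.factorial_ne_zero
  rw [← mul_assoc, div_mul_cancel₀ _ this, Finset.mul_sum]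
  refine Finset.sum_congr rfl fun S hS => ?_
  rw [Finset.prod_mul_distrib, Finset.prod_const, (Finset.mem_powersetCard.1 hS).2]

/-- The law `P'` has the correlation functions `det (k(xᵢ, xⱼ))` with respect to `η`. -/
def HasCorrelation (P' : Measure (FinConfig d)) (η : Measure (Eucl d)) (k : Eucl d → Eucl d → ℂ) :
    Prop :=
  ∀ (n : ℕ) (B : Fin n → Set (Eucl d)), (∀ i, MeasurableSet (B i)) →
    Pairwise (fun i j => Disjoint (B i) (B j)) →
    ∫⁻ ω, ∏ i, (ptsIn (B i) ω : ℝ≥0∞) ∂P' =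
      ∫⁻ x in Set.pi univ B, ENNReal.ofReal (detTuple k n x) ∂Measure.pi (fun _ : Fin n => η)

variable {ι : Type} [Countable ι] {η : Measure (Eucl d)} [IsFiniteMeasure η]
  {k : Eucl d → Eucl d → ℂ} {c : ι → ℝ} {φ : ι → Eucl d → ℂ} {T : Set (Eucl d)}
  {P' : Measure (FinConfig d)}

/-- The factorial moments of the counts in the cells `γ ⁻¹' {e i}`. The cells are disjoint because `e`
is injective. -/
theorem HasCorrelation.integral_prod (hcorr : HasCorrelation P' η k)
    (h : IsTraceClassOn η k c φ T) {C : Type*} [Fintype C] [MeasurableSpace C]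
    [MeasurableSingletonClass C] {γ : Eucl d → C} (hγ : Measurable γ) {B : Set (Eucl d)}
    (hB : MeasurableSet B) {n : ℕ} {e : Fin n → C} (he : Function.Injective e) :
    Integrable (fun ω => ∏ i, (ptsIn (B ∩ γ ⁻¹' {e i}) ω : ℝ)) P' ∧
    ∫ ω, ∏ i, (ptsIn (B ∩ γ ⁻¹' {e i}) ω : ℝ) ∂P' =
      ∫ x, {x : Fin n → Eucl d | γ ∘ x = e}.indicator (detTuple k n) x
        ∂Measure.pi (fun _ => η.restrict B) := by
  have hBm : ∀ i, MeasurableSet (B ∩ γ ⁻¹' {e i}) := fun i =>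
    hB.inter (hγ (measurableSet_singleton _))
  have hE : {x : Fin n → Eucl d | γ ∘ x = e} = Set.pi univ fun i => γ ⁻¹' {e i} := by
    ext x; simp [funext_iff]
  have hEm : MeasurableSet {x : Fin n → Eucl d | γ ∘ x = e} := by
    rw [hE]; exact MeasurableSet.univ_pi fun i => hγ (measurableSet_singleton _)
  have hm : Measurable fun ω => ∏ i, (ptsIn (B ∩ γ ⁻¹' {e i}) ω : ℝ) :=
    Finset.measurable_prod _ fun i _ =>
      (measurable_from_top (f := fun m : ℕ => (m : ℝ))).comp (measurable_ptsIn (hBm i))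
  have h0 : ∀ ω, 0 ≤ ∏ i, (ptsIn (B ∩ γ ⁻¹' {e i}) ω : ℝ) := fun ω =>
    Finset.prod_nonneg fun i _ => Nat.cast_nonneg _
  have hk := (h.restrict B).integrable_detTuple n
  have hk0 : 0 ≤ᵐ[(Measure.pi fun _ : Fin n => η.restrict B).restrict
      {x : Fin n → Eucl d | γ ∘ x = e}] detTuple k n :=
    ae_restrict_of_ae (by
      filter_upwards [(h.restrict B).ae_tuple n] with x hx using (h.detTuple_mem hx).1)
  have key : ∫⁻ ω, ENNReal.ofReal (∏ i, (ptsIn (B ∩ γ ⁻¹' {e i}) ω : ℝ)) ∂P' =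
      ENNReal.ofReal (∫ x, {x : Fin n → Eucl d | γ ∘ x = e}.indicator (detTuple k n) x
        ∂Measure.pi (fun _ => η.restrict B)) := by
    rw [integral_indicator hEm, ofReal_integral_eq_lintegral_ofReal hk.restrict hk0]
    have h1 := hcorr n (fun i => B ∩ γ ⁻¹' {e i}) hBm fun i j hij =>
      Disjoint.mono inter_subset_right inter_subset_right
        (Disjoint.preimage γ (by simpa using fun hh => hij (he hh)))
    have h2 : ∀ ω, ENNReal.ofReal (∏ i, (ptsIn (B ∩ γ ⁻¹' {e i}) ω : ℝ)) =
        ∏ i, (ptsIn (B ∩ γ ⁻¹' {e i}) ω : ℝ≥0∞) := by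
      intro ω
      rw [ENNReal.ofReal_prod_of_nonneg fun i _ => Nat.cast_nonneg _]
      simp
    simp only [h2, h1]
    rw [← Measure.restrict_pi_pi, Measure.restrict_restrict hEm, hE, ← Set.pi_inter_distrib]
    simp only [inter_comm]
  refine ⟨⟨hm.aestronglyMeasurable, ?_⟩, ?_⟩
  · rw [hasFiniteIntegral_iff_ofReal (Eventually.of_forall h0), key]
    exact ENNReal.ofReal_lt_top
  · rw [integral_eq_lintegral_of_nonneg_ae (Eventually.of_forall h0) hm.aestronglyMeasurable, key,
      ENNReal.toReal_ofReal]
    rw [integral_indicator hEm]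
    exact integral_nonneg_of_ae hk0

/-- Inclusion-exclusion at the scale of a finite measurable partition. -/
theorem HasCorrelation.integral_prod_one_add (hcorr : HasCorrelation P' η k)
    (h : IsTraceClassOn η k c φ T) {C : Type*} [Fintype C] [MeasurableSpace C]
    [MeasurableSingletonClass C] {γ : Eucl d → C} (hγ : Measurable γ) {B : Set (Eucl d)}
    (hB : MeasurableSet B) (s : ℝ) :
    Integrable (fun ω => ∏ c, (1 + s * (ptsIn (B ∩ γ ⁻¹' {c}) ω : ℝ))) P' ∧
    ∫ ω, ∏ c, (1 + s * (ptsIn (B ∩ γ ⁻¹' {c}) ω : ℝ)) ∂P' =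
      ∑' n : ℕ, s ^ n / n.factorial *
        ∫ x, {x : Fin n → Eucl d | Function.Injective (γ ∘ x)}.indicator (detTuple k n) x
          ∂Measure.pi (fun _ => η.restrict B) := by
  classical
  have hind : ∀ n (e : Fin n → C),
      Integrable (fun ω => {e : Fin n → C | Function.Injective e}.indicator
        (fun e => ∏ i, (ptsIn (B ∩ γ ⁻¹' {e i}) ω : ℝ)) e) P' ∧
      ∫ ω, {e : Fin n → C | Function.Injective e}.indicator
        (fun e => ∏ i, (ptsIn (B ∩ γ ⁻¹' {e i}) ω : ℝ)) e ∂P' =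
        ∫ x, {x : Fin n → Eucl d | γ ∘ x = e ∧ Function.Injective e}.indicator (detTuple k n) x
          ∂Measure.pi (fun _ => η.restrict B) := by
    intro n e
    by_cases he : Function.Injective e
    · have := hcorr.integral_prod h hγ hB he
      have hset : {x : Fin n → Eucl d | γ ∘ x = e ∧ Function.Injective e} = {x | γ ∘ x = e} := by
        ext x; simp [he]
      simpa only [hset, indicator_of_mem (show e ∈ {e : Fin n → C | Function.Injective e} from he)]
        using this
    · simp [Set.indicator, he]
  have hex : ∀ ω, ∏ c, (1 + s * (ptsIn (B ∩ γ ⁻¹' {c}) ω : ℝ)) = _ := fun ω =>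
    prod_one_add_smul_eq_sum (fun c => (ptsIn (B ∩ γ ⁻¹' {c}) ω : ℝ)) s
      (Nat.lt_succ_self (Fintype.card C))
  simp only [hex]
  have hi : ∀ n, Integrable (fun ω => s ^ n / n.factorial * ∑ e : Fin n → C,
      {e : Fin n → C | Function.Injective e}.indicator
        (fun e => ∏ i, (ptsIn (B ∩ γ ⁻¹' {e i}) ω : ℝ)) e) P' := fun n =>
    (integrable_finsetSum _ fun e _ => (hind n e).1).const_mul _
  refine ⟨integrable_finsetSum _ fun n _ => hi n, ?_⟩
  rw [integral_finsetSum _ fun n _ => hi n, tsum_eq_sum (s := Finset.range (Fintype.card C + 1))]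
  · refine Finset.sum_congr rfl fun n _ => ?_
    rw [integral_const_mul, integral_finsetSum _ fun e _ => (hind n e).1]
    congr 1
    simp only [(hind n _).2]
    rw [← integral_finsetSum]
    · refine integral_congr_ae (Eventually.of_forall fun x => ?_)
      change ∑ e : Fin n → C, _ = _
      rw [Finset.sum_eq_single (γ ∘ x)]
      · simp [Set.indicator]
      · intro e _ he
        exact indicator_of_notMem (fun hh => he hh.1.symm) _
      · simp
    · intro e _
      refine ((h.restrict B).integrable_detTuple n).indicator ?_
      by_cases he : Function.Injective e
      · have : {x : Fin n → Eucl d | γ ∘ x = e ∧ Function.Injective e} =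
            Set.pi univ fun i => γ ⁻¹' {e i} := by
          ext x; simp [funext_iff, he]
        rw [this]
        exact MeasurableSet.univ_pi fun i => hγ (measurableSet_singleton _)
      · simp [he]
  · intro n hn
    have : {x : Fin n → Eucl d | Function.Injective (γ ∘ x)} = ∅ := by
      refine eq_empty_of_forall_notMem fun x hx => hn ?_
      have := Fintype.card_le_of_injective _ hx
      rw [Fintype.card_fin] at this
      exact Finset.mem_range.2 (Nat.lt_succ_of_le this)
    simp [this]

/-- The partitions of space by the first `n` coordinates of an embedding into Cantor space. -/
noncomputable def cellMap (d n : ℕ) (x : Eucl d) : Fin n → Bool :=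
  fun i => MeasurableSpace.mapNatBool (Eucl d) x i

theorem measurable_cellMap (d n : ℕ) : Measurable (cellMap d n) :=
  measurable_pi_lambda _ fun i =>
    (measurable_pi_apply (i : ℕ)).comp (MeasurableSpace.measurable_mapNatBool (Eucl d))

theorem eventually_injOn_cellMap {s : Set (Eucl d)} (hs : s.Finite) :
    ∀ᶠ n in atTop, InjOn (cellMap d n) s := by
  have h : ∀ x ∈ s, ∀ y ∈ s, ∀ᶠ n in atTop, cellMap d n x = cellMap d n y → x = y := by
    intro x _ y _
    by_cases hxy : x = y
    · exact Eventually.of_forall fun _ _ => hxy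
    · have : ∃ i, MeasurableSpace.mapNatBool (Eucl d) x i ≠ MeasurableSpace.mapNatBool (Eucl d) y i := by
        by_contra hcon
        push Not at hcon
        exact hxy (MeasurableSpace.injective_mapNatBool (Eucl d) (funext hcon))
      obtain ⟨i, hi⟩ := this
      filter_upwards [eventually_gt_atTop i] with n hn he
      exact absurd (congrFun he ⟨i, hn⟩) hi
  have h2 := (hs.eventually_all).2 fun x hx => (hs.eventually_all).2 (h x hx)
  filter_upwards [h2] with n hn x hx y hy using hn x hx y hy

/-- The number of points in each cell is eventually at most one. -/
theorem eventually_prod_eq_pow (B : Set (Eucl d)) (ω : FinConfig d) (s : ℝ) :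
    ∀ᶠ n in atTop, ∏ c, (1 + s * (ptsIn (B ∩ cellMap d n ⁻¹' {c}) ω : ℝ)) =
      (1 + s) ^ ptsIn B ω := by
  classical
  filter_upwards [eventually_injOn_cellMap ω.pts.finite_toSet] with n hn
  rw [← sum_ptsIn (cellMap d n) B ω, ← Finset.prod_pow_eq_pow_sum]
  refine Finset.prod_congr rfl fun c _ => ?_
  have h1 : ptsIn (B ∩ cellMap d n ⁻¹' {c}) ω ≤ 1 := by
    refine Finset.card_le_one.2 fun x hx y hy => ?_
    simp only [Finset.mem_filter, mem_inter_iff, mem_preimage, mem_singleton_iff] at hx hy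
    exact hn hx.1 hy.1 (hx.2.2.trans hy.2.2.symm)
  interval_cases ptsIn (B ∩ cellMap d n ⁻¹' {c}) ω <;> simp

theorem abs_prod_le {C : Type*} [Fintype C] (γ : Eucl d → C) (B : Set (Eucl d)) (ω : FinConfig d)
    {s : ℝ} (hs : |s| ≤ 1) :
    |∏ c, (1 + s * (ptsIn (B ∩ γ ⁻¹' {c}) ω : ℝ))| ≤ (1 + 1) ^ ptsIn B ω := by
  rw [← sum_ptsIn γ B ω, ← Finset.prod_pow_eq_pow_sum, Finset.abs_prod]
  refine Finset.prod_le_prod (fun _ _ => abs_nonneg _) fun c _ => ?_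
  have h1 : ((ptsIn (B ∩ γ ⁻¹' {c}) ω : ℕ) : ℝ) + 1 ≤ 2 ^ ptsIn (B ∩ γ ⁻¹' {c}) ω := by
    exact_mod_cast Nat.succ_le_of_lt (Nat.lt_two_pow_self)
  calc |1 + s * (ptsIn (B ∩ γ ⁻¹' {c}) ω : ℝ)|
      ≤ |1| + |s * (ptsIn (B ∩ γ ⁻¹' {c}) ω : ℝ)| := abs_add_le _ _
    _ ≤ 1 + (ptsIn (B ∩ γ ⁻¹' {c}) ω : ℝ) := by
        rw [abs_one, abs_mul, Nat.abs_cast]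
        gcongr
        exact mul_le_of_le_one_left (Nat.cast_nonneg _) hs
    _ ≤ _ := by rw [add_comm]; norm_num at h1 ⊢; exact h1

/-- In the limit of fine partitions the restriction to tuples in distinct cells disappears, since `det k`
vanishes on tuples with a repetition. -/
theorem tendsto_integral_prod (hcorr : HasCorrelation P' η k)
    (h : IsTraceClassOn η k c φ T) {B : Set (Eucl d)} (hB : MeasurableSet B) {s : ℝ}
    (hs : |s| ≤ 1) :
    Tendsto (fun n => ∫ ω, ∏ c, (1 + s * (ptsIn (B ∩ cellMap d n ⁻¹' {c}) ω : ℝ)) ∂P') atTop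
      (𝓝 (∑' n : ℕ, s ^ n / n.factorial * ∫ x, detTuple k n x
        ∂Measure.pi (fun _ => η.restrict B))) := by
  have hE : ∀ m n, MeasurableSet {x : Fin n → Eucl d | Function.Injective (cellMap d m ∘ x)} := by
    intro m n
    have h1 : Measurable fun x : Fin n → Eucl d => cellMap d m ∘ x :=
      measurable_pi_lambda _ fun i => (measurable_cellMap d m).comp (measurable_pi_apply i)
    exact h1 (Set.toFinite {e : Fin n → Fin m → Bool | Function.Injective e}).measurableSet
  simp only [(hcorr.integral_prod_one_add h (measurable_cellMap d _) hB s).2]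
  have hb : ∀ m n, ‖∫ x, {x : Fin n → Eucl d | Function.Injective (cellMap d m ∘ x)}.indicator
      (detTuple k n) x ∂Measure.pi (fun _ => η.restrict B)‖ ≤
      (∫ x, (k x x).re ∂η.restrict B) ^ n := by
    intro m n
    rw [← IsTraceClassOn.integral_prod_diag]
    refine norm_integral_le_of_norm_le ((h.restrict B).integrable_prod_diag n) ?_
    filter_upwards [(h.restrict B).ae_tuple n] with x hx
    refine (norm_indicator_le_norm_self _ _).trans ?_
    rw [Real.norm_eq_abs, abs_of_nonneg (h.detTuple_mem hx).1]
    exact (h.detTuple_mem hx).2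
  refine tendsto_tsum_of_dominated_convergence
    (Real.summable_pow_div_factorial (∫ x, (k x x).re ∂η.restrict B)) (fun n => ?_)
    (Eventually.of_forall fun m n => ?_)
  · refine Tendsto.const_mul _ (tendsto_integral_of_dominated_convergence
      (fun x => ‖detTuple k n x‖) (fun m => ?_)
      ((h.restrict B).integrable_detTuple n).norm (fun m => ?_) ?_)
    · exact ((measurable_detTuple h.measurable n).indicator (hE m n)).aestronglyMeasurable
    · exact Eventually.of_forall fun x => norm_indicator_le_norm_self _ _
    · refine Eventually.of_forall fun x => ?_
      by_cases hx : Function.Injective x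
      · refine tendsto_const_nhds.congr' ?_
        filter_upwards [eventually_injOn_cellMap (Set.finite_range x)] with m hm
        rw [indicator_of_mem]
        exact fun i j hij => hx (hm ⟨i, rfl⟩ ⟨j, rfl⟩ hij)
      · rw [detTuple_eq_zero k hx]
        refine tendsto_const_nhds.congr fun m => ?_
        rw [Set.indicator]
        split_ifs
        · exact (detTuple_eq_zero k hx).symm
        · rfl
  · rw [norm_mul, norm_div, norm_pow, Real.norm_eq_abs, Real.norm_eq_abs, Nat.abs_cast,
      div_mul_eq_mul_div]
    exact div_le_div_of_nonneg_right ((mul_le_of_le_one_left (norm_nonneg _)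
      (pow_le_one₀ (abs_nonneg s) hs)).trans (hb m n)) (Nat.cast_nonneg _)

/-- The number of points has an exponential moment, which dominates the products over the cells. -/
theorem integrable_two_pow [IsProbabilityMeasure P'] (hcorr : HasCorrelation P' η k)
    (h : IsTraceClassOn η k c φ T) {B : Set (Eucl d)} (hB : MeasurableSet B) :
    Integrable (fun ω => (1 + 1 : ℝ) ^ ptsIn B ω) P' := by
  have hm : Measurable fun ω => (1 + 1 : ℝ) ^ ptsIn B ω :=
    (measurable_from_top (f := fun m : ℕ => (1 + 1 : ℝ) ^ m)).comp (measurable_ptsIn hB)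
  have h1 := tendsto_integral_prod hcorr h hB (s := 1) (by simp)
  have hi := fun n => hcorr.integral_prod_one_add h (measurable_cellMap d n) hB 1
  have h0 : ∀ n ω, 0 ≤ ∏ c, (1 + 1 * (ptsIn (B ∩ cellMap d n ⁻¹' {c}) ω : ℝ)) := fun n ω =>
    Finset.prod_nonneg fun c _ => by positivity
  have h2 : ∀ n, ∫⁻ ω, ENNReal.ofReal (∏ c, (1 + 1 * (ptsIn (B ∩ cellMap d n ⁻¹' {c}) ω : ℝ))) ∂P' =
      ENNReal.ofReal (∫ ω, ∏ c, (1 + 1 * (ptsIn (B ∩ cellMap d n ⁻¹' {c}) ω : ℝ)) ∂P') :=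
    fun n => (ofReal_integral_eq_lintegral_ofReal (hi n).1 (Eventually.of_forall (h0 n))).symm
  refine ⟨hm.aestronglyMeasurable, ?_⟩
  rw [hasFiniteIntegral_iff_ofReal (Eventually.of_forall fun ω => by positivity)]
  -- By Fatou's lemma, along the products over finer and finer partitions.
  have h3 : ∫⁻ ω, ENNReal.ofReal ((1 + 1 : ℝ) ^ ptsIn B ω) ∂P' ≤ liminf (fun n => ∫⁻ ω,
      ENNReal.ofReal (∏ c, (1 + 1 * (ptsIn (B ∩ cellMap d n ⁻¹' {c}) ω : ℝ))) ∂P') atTop := by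
    refine le_trans (le_of_eq (lintegral_congr fun ω => ?_))
      (lintegral_liminf_le' fun n => (hi n).1.1.aemeasurable.ennreal_ofReal)
    refine (Tendsto.liminf_eq (tendsto_const_nhds.congr' ?_)).symm
    filter_upwards [eventually_prod_eq_pow B ω 1] with n hn
    rw [hn]
  refine h3.trans_lt ?_
  simp only [h2]
  exact lt_of_eq_of_lt ((ENNReal.continuous_ofReal.tendsto _).comp h1).liminf_eq
    ENNReal.ofReal_lt_top

/-- The probability of emptiness is the Fredholm determinant `det (1 - k 1_B)`, as the expectation of
`(1 - 1) ^ N(B)`. -/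
theorem HasCorrelation.measure_voidSet [IsProbabilityMeasure P'] (hcorr : HasCorrelation P' η k)
    (h : IsTraceClassOn η k c φ T) {B : Set (Eucl d)} (hB : MeasurableSet B) :
    P'.real (voidSet B) = ∑' n : ℕ, (-1 : ℝ) ^ n / n.factorial *
        ∫ x, detTuple k n x ∂Measure.pi (fun _ => η.restrict B) := by
  have h1 := tendsto_integral_prod hcorr h hB (s := -1) (by simp)
  refine tendsto_nhds_unique ?_ h1
  rw [← integral_indicator_one (measurableSet_voidSet hB)]
  refine tendsto_integral_of_dominated_convergence (fun ω => (1 + 1 : ℝ) ^ ptsIn B ω)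
    (fun n => (hcorr.integral_prod_one_add h (measurable_cellMap d n) hB (-1)).1.1)
    (integrable_two_pow hcorr h hB) (fun n => Eventually.of_forall fun ω =>
      abs_prod_le _ B ω (by simp)) (Eventually.of_forall fun ω => tendsto_const_nhds.congr' ?_)
  filter_upwards [eventually_prod_eq_pow B ω (-1)] with n hn
  rw [hn]
  by_cases hω : ω ∈ voidSet B
  · rw [indicator_of_mem hω, (ptsIn_eq_zero_iff B ω).2 hω]; simp
  · rw [indicator_of_notMem hω, add_neg_cancel, zero_pow fun hh => hω ((ptsIn_eq_zero_iff B ω).1 hh)]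

end

/-! ### The Janossy densities of the determinantal process -/

section

variable {d : ℕ}

theorem ptsIn_restrictTo {S D : Set (Eucl d)} (hD : IsCompact D) (hDS : D ⊆ S) (B : Set (Eucl d))
    (ω : LFConfig S) : (ptsIn B (restrictTo D ω) : ℝ≥0∞) = ((ω.1 ∩ (B ∩ D)).encard : ℝ≥0∞) := by
  classical
  have h : ω.1 ∩ (B ∩ D) = (((restrictTo D ω).pts.filter (· ∈ B) : Finset (Eucl d)) : Set _) := by
    ext x
    have hx : x ∈ (restrictTo D ω).pts ↔ x ∈ ω.1 ∧ x ∈ D := by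
      rw [← Finset.mem_coe, coe_restrictTo hD hDS]; rfl
    rw [Finset.coe_filter]
    simp only [mem_inter_iff, mem_ofPred_eq, hx]
    tauto
  rw [h, Set.encard_coe_eq_coe_finsetCard, ptsIn]
  simp

theorem isProbabilityMeasure_lawOn {S D : Set (Eucl d)} (hD : IsCompact D) (hDS : D ⊆ S)
    (P : Measure (LFConfig S)) [IsProbabilityMeasure P] : IsProbabilityMeasure (lawOn P D) :=
  Measure.isProbabilityMeasure_map (measurable_restrictTo hD hDS).aemeasurable

theorem DensityAssumption.sigmaFinite {S D : Set (Eucl d)} {μ : Measure (Eucl d)} {ρ : Eucl d → ℝ}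
    (h : DensityAssumption S μ ρ D) : SigmaFinite μ := by
  rw [h.density]
  infer_instance

theorem IsDeterminantal.hasCorrelation {S D : Set (Eucl d)} {μ : Measure (Eucl d)} [SigmaFinite μ]
    {K : Eucl d → Eucl d → ℂ} {P : Measure (LFConfig S)} [IsProbabilityMeasure P]
    (hdet : IsDeterminantal S μ K P) (hD : IsCompact D) (hDS : D ⊆ S) :
    HasCorrelation (lawOn P D) (μ.restrict D) K := by
  have := isProbabilityMeasure_lawOn hD hDS P
  intro n B hB hdisj
  rcases Nat.eq_zero_or_pos n with rfl | hn
  · simp [detTuple]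
  · have hm : Measurable fun ω => ∏ i, (ptsIn (B i) ω : ℝ≥0∞) :=
      Finset.measurable_prod _ fun i _ =>
        (measurable_from_top (f := fun m : ℕ => (m : ℝ≥0∞))).comp (measurable_ptsIn (hB i))
    rw [lawOn, lintegral_map hm (measurable_restrictTo hD hDS)]
    simp only [ptsIn_restrictTo hD hDS]
    rw [hdet n hn (fun i => B i ∩ D) (fun i => (hB i).inter hD.measurableSet)
      (fun i => inter_subset_right.trans hDS) fun i j hij =>
        (hdisj hij).mono inter_subset_left inter_subset_left,
      ← Measure.restrict_pi_pi, Measure.restrict_restrict (MeasurableSet.univ_pi hB),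
      ← Set.pi_inter_distrib]
    rfl

/-- The measure on finite configurations whose restriction to the configurations of `n` points
has the density `det J / n!` with respect to `ν^n`, up to normalization. -/
noncomputable def janossy (ν : Measure (Eucl d)) (J : Eucl d → Eucl d → ℂ) (a : ℝ) :
    Measure (FinConfig d) :=
  Measure.sum fun n : ℕ => ENNReal.ofReal (a / n.factorial) •
    ((Measure.pi fun _ : Fin n => ν).withDensity fun x => ENNReal.ofReal (detTuple J n x)).map
      FinConfig.ofTuple

/-- Under the measure with Janossy densities `a det J`, the probability that `U` is empty is
`a det (1 + J 1_{Uᶜ})`. -/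
theorem janossy_voidSet {ι : Type} [Countable ι] {ν : Measure (Eucl d)} [IsFiniteMeasure ν]
    {J : Eucl d → Eucl d → ℂ} {c : ι → ℝ} {φ : ι → Eucl d → ℂ} {T : Set (Eucl d)}
    (h : IsTraceClassOn ν J c φ T) {a : ℝ} (ha : 0 ≤ a) {U : Set (Eucl d)} (hU : MeasurableSet U) :
    janossy ν J a (voidSet U) = ENNReal.ofReal (a * ∑' n : ℕ, (1 : ℝ) ^ n / n.factorial *
      ∫ x, detTuple J n x ∂Measure.pi (fun _ => ν.restrict Uᶜ)) := by
  have hr := h.restrict Uᶜ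
  rw [janossy, Measure.sum_apply _ (measurableSet_voidSet hU), ← tsum_mul_left,
    ENNReal.ofReal_tsum_of_nonneg
      (fun n => mul_nonneg ha (mul_nonneg (by positivity) (hr.integral_detTuple_nonneg n)))
      ((hr.summable_fredholm (z := 1) (by simp)).mul_left a)]
  refine tsum_congr fun n => ?_
  have hpre : (FinConfig.ofTuple : (Fin n → Eucl d) → FinConfig d) ⁻¹' voidSet U =
      Set.pi univ fun _ => Uᶜ := by
    ext x; simp [ofTuple_mem_voidSet]
  rw [Measure.smul_apply, Measure.map_apply (measurable_ofTuple n) (measurableSet_voidSet hU),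
    withDensity_apply _ (measurable_ofTuple n (measurableSet_voidSet hU)), hpre,
    Measure.restrict_pi_pi, smul_eq_mul, ← ofReal_integral_eq_lintegral_ofReal
      (hr.integrable_detTuple n)
      (by filter_upwards [hr.ae_tuple n] with x hx using (h.detTuple_mem hx).1),
    ← ENNReal.ofReal_mul (by positivity), one_pow, ← mul_assoc, mul_one_div]

/-- The law of the restriction of the process to `D` has Janossy densities proportional to `det J`:
both sides give the same probability to the events of emptiness, by the identity
`det (1 - K 1_U) = det (1 - K) det (1 + J 1_{Uᶜ})`. -/
theorem exists_lawOn_eq_janossy {S D : Set (Eucl d)} (hD : IsCompact D) (hDS : D ⊆ S)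
    {μ : Measure (Eucl d)} {ρ : Eucl d → ℝ} {K J : Eucl d → Eucl d → ℂ}
    {P : Measure (LFConfig S)} [IsProbabilityMeasure P] (hdet : IsDeterminantal S μ K P)
    (hK : KernelAssumption S μ K) (hρ : DensityAssumption S μ ρ D)
    (hJ : IsInteractionKernel μ K D J) :
    (∃ a : ℝ, 0 < a ∧ lawOn P D = janossy (μ.restrict D) J a) ∧
      (∀ n, ∀ᵐ x ∂Measure.pi (fun _ : Fin n => μ.restrict D), 0 ≤ detTuple J n x) ∧
      (∀ n, Integrable (detTuple J n) (Measure.pi (fun _ : Fin n => μ.restrict D))) := by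
  have hσ := hρ.sigmaFinite
  have hprob := isProbabilityMeasure_lawOn hD hDS P
  have hfin : IsFiniteMeasure (μ.restrict D) :=
    isFiniteMeasure_restrict.2 (hρ.radon D hD hDS).ne
  obtain ⟨κ, hκ, hspec⟩ := hK.spectrum
  obtain ⟨ι, lam, φ, hι, hbasis, hlam, hsum, hexp⟩ := hspec D hD hDS
  obtain ⟨hJm, ι', lam', φ', hι', hbasis', hexpJ⟩ := hJ
  -- The kernels `K` and `J` are given in a priori different eigenbases; use the one of `J`.
  obtain ⟨hlam', hsum', hexpK⟩ := hexp.change_basis hD.measurableSet hK.measurable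
    (hK.locally_sq_integrable D hD hDS) hbasis hbasis' hlam hsum
  have hnorm : ∀ i, ∫⁻ x, ‖φ' i x‖ₑ ^ 2 ∂μ.restrict D ≤ 1 := by
    intro i
    have h1 := hbasis'.norm_eq_one i
    have h2 : ∀ x, φ' i x * conj (φ' i x) = ((‖φ' i x‖ ^ 2 : ℝ) : ℂ) := fun x => by
      rw [Complex.mul_conj, Complex.normSq_eq_norm_sq]
    simp only [h2] at h1
    rw [integral_complex_ofReal] at h1
    have h3 : ∫ x in D, ‖φ' i x‖ ^ 2 ∂μ = 1 := by exact_mod_cast h1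
    have h4 : ∫⁻ x, ‖φ' i x‖ₑ ^ 2 ∂μ.restrict D =
        ENNReal.ofReal (∫ x in D, ‖φ' i x‖ ^ 2 ∂μ) := by
      rw [ofReal_integral_eq_lintegral_ofReal ((hbasis'.memLp i).integrable_norm_pow two_ne_zero)
        (Eventually.of_forall fun x => sq_nonneg _)]
      refine lintegral_congr fun x => ?_
      rw [ENNReal.ofReal_pow (norm_nonneg _), ofReal_norm]
    rw [h4, h3, ENNReal.ofReal_one]
  have htrace : ∀ {k : Eucl d → Eucl d → ℂ} {c : ι' → ℝ}, Measurable (Function.uncurry k) →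
      (∀ i, 0 ≤ c i) → Summable c → HasKernelExpansion μ k D c φ' →
      ∃ T, IsTraceClassOn (μ.restrict D) k c φ' T := by
    rintro k c hk hc hs ⟨N, hN, hexp⟩
    refine ⟨D \ N, hk, hc, hs, hbasis'.measurable, hnorm, ?_, hexp⟩
    filter_upwards [ae_restrict_mem hD.measurableSet,
      ae_restrict_of_ae (compl_mem_ae_iff.2 hN : Nᶜ ∈ ae μ)] with x h1 h2 using ⟨h1, h2⟩
  have hlt : ∀ i, lam' i < 1 := fun i => (hlam' i).2.trans_lt hκ
  obtain ⟨T, hTK⟩ := htrace hK.measurable (fun i => (hlam' i).1) hsum' hexpK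
  obtain ⟨T', hTJ⟩ := htrace (c := fun i => lam' i / (1 - lam' i)) hJm
    (fun i => div_nonneg (hlam' i).1 (sub_nonneg.2 (hlt i).le))
    (by
      refine Summable.of_nonneg_of_le
        (fun i => div_nonneg (hlam' i).1 (sub_nonneg.2 (hlt i).le)) (fun i => ?_)
        (hsum'.div_const (1 - κ))
      exact div_le_div_of_nonneg_left (hlam' i).1 (sub_pos.2 hκ)
        (sub_le_sub_left (hlam' i).2 1)) hexpJ
  have hfred := fun {B : Set (Eucl d)} (hB : MeasurableSet B) =>
    fredholm_complement hTK hTJ hbasis'.norm_eq_one hbasis'.orthogonal hlt hB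
  have hcorr := hdet.hasCorrelation hD hDS
  refine ⟨⟨_, inv_pos.2 (hfred MeasurableSet.univ).1, ?_⟩, fun n => ?_, fun n =>
    hTJ.integrable_detTuple n⟩
  · have key : ∀ U : Set (Eucl d), MeasurableSet U → lawOn P D (voidSet U) =
        janossy (μ.restrict D) J (∑' n : ℕ, (1 : ℝ) ^ n / n.factorial *
          ∫ x, detTuple J n x ∂Measure.pi (fun _ => μ.restrict D))⁻¹ (voidSet U) := by
      intro U hU
      rw [janossy_voidSet hTJ (inv_pos.2 (hfred MeasurableSet.univ).1).le hU, ← (hfred hU).2,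
        ← hcorr.measure_voidSet hTK hU, ofReal_measureReal]
    refine ext_of_generate_finite _ generateFrom_voidSet_open isPiSystem_voidSet_open ?_ ?_
    · rintro _ ⟨U, hU, rfl⟩
      exact key U hU.measurableSet
    · have h1 := key ∅ MeasurableSet.empty
      have h2 : voidSet (∅ : Set (Eucl d)) = univ := by simp [voidSet]
      rwa [h2] at h1
  · filter_upwards [hTJ.ae_tuple n] with x hx using (hTJ.detTuple_mem hx).1

theorem lintegral_pi_prod {n : ℕ} (ν : Fin n → Measure (Eucl d)) [∀ i, SigmaFinite (ν i)]
    {f : Eucl d → ℝ≥0∞} (hf : Measurable f) :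
    ∫⁻ x, ∏ i, f (x i) ∂Measure.pi ν = ∏ i, ∫⁻ y, f y ∂ν i := by
  induction n with
  | zero => simp
  | succ n ih =>
    have h := (measurePreserving_piFinSuccAbove ν 0).lintegral_comp_emb
      (MeasurableEquiv.measurableEmbedding _) (fun p => f p.1 * ∏ i, f (p.2 i))
    have hm : Measurable fun x : Fin n → Eucl d => ∏ i, f (x i) :=
      Finset.measurable_prod _ fun i _ => hf.comp (measurable_pi_apply i)
    rw [lintegral_prod_mul (g := fun x : Fin n → Eucl d => ∏ i, f (x i)) hf.aemeasurable
      hm.aemeasurable, ih] at h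
    simp only [Fin.prod_univ_succ]
    exact h

/-- A product of measures with densities has the product density. -/
theorem pi_withDensity {n : ℕ} {ν : Measure (Eucl d)} [SigmaFinite ν] {ρ : Eucl d → ℝ≥0∞}
    (hρ : Measurable ρ) [SigmaFinite (ν.withDensity ρ)] :
    Measure.pi (fun _ : Fin n => ν.withDensity ρ) =
      (Measure.pi fun _ : Fin n => ν).withDensity fun x => ∏ i, ρ (x i) := by
  refine Measure.pi_eq fun s hs => ?_
  rw [withDensity_apply _ (MeasurableSet.univ_pi hs), Measure.restrict_pi_pi,
    lintegral_pi_prod _ hρ]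
  simp only [withDensity_apply _ (hs _)]

end

/-! ### Test functions on the closed set `D` -/

section

variable {d : ℕ}

theorem inner_gradient (f : Eucl d → ℝ) (x v : Eucl d) : ⟪gradient f x, v⟫_ℝ = fderiv ℝ f x v := by
  rw [gradient, InnerProductSpace.toDual_symm_apply]

theorem gradient_apply (f : Eucl d → ℝ) (x : Eucl d) (h : Fin d) :
    gradient f x h = fderiv ℝ f x (EuclideanSpace.single h 1) := by
  rw [← inner_gradient, EuclideanSpace.inner_single_right]
  simp

theorem inner_gradient_gradient (f g : Eucl d → ℝ) (x : Eucl d) :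
    ⟪gradient f x, gradient g x⟫_ℝ = ∑ h, fderiv ℝ f x (EuclideanSpace.single h 1) *
      fderiv ℝ g x (EuclideanSpace.single h 1) := by
  rw [PiLp.inner_apply]
  refine Finset.sum_congr rfl fun h _ => ?_
  rw [gradient_apply, gradient_apply, RCLike.inner_apply, mul_comm]
  rfl

theorem continuous_gradient {f : Eucl d → ℝ} (hf : ContDiff ℝ 1 f) : Continuous (gradient f) :=
  (InnerProductSpace.toDual ℝ (Eucl d)).symm.continuous.comp (hf.continuous_fderiv one_ne_zero)

theorem laplacian_eq_sum {f : Eucl d → ℝ} (hf : ContDiff ℝ 2 f) (x : Eucl d) :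
    Laplacian.laplacian f x = ∑ h : Fin d, fderiv ℝ
      (fun y => fderiv ℝ f y (EuclideanSpace.single h 1)) x (EuclideanSpace.single h 1) := by
  rw [InnerProductSpace.laplacian_eq_iteratedFDeriv_orthonormalBasis f
    (EuclideanSpace.basisFun (Fin d) ℝ)]
  refine Finset.sum_congr rfl fun h _ => ?_
  have hd : DifferentiableAt ℝ (fderiv ℝ f) x :=
    ((hf.fderiv_right (m := 1) (by norm_num)).differentiable one_ne_zero) x
  rw [iteratedFDeriv_two_apply, fderiv_clm_apply hd (differentiableAt_const _)]
  simp

theorem continuous_laplacian {f : Eucl d → ℝ} (hf : ContDiff ℝ 2 f) :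
    Continuous (Laplacian.laplacian f) := by
  have : Laplacian.laplacian f = fun x => ∑ h : Fin d, fderiv ℝ
      (fun y => fderiv ℝ f y (EuclideanSpace.single h 1)) x (EuclideanSpace.single h 1) :=
    funext (laplacian_eq_sum hf)
  rw [this]
  refine continuous_finsetSum _ fun h _ => ?_
  have h1 : ContDiff ℝ 1 fun y => fderiv ℝ f y (EuclideanSpace.single h (1 : ℝ)) :=
    (hf.fderiv_right (m := 1) (by norm_num)).clm_apply contDiff_const
  exact (h1.continuous_fderiv one_ne_zero).clm_apply continuous_const

/-- Uniform approximation in `C¹(D)` of a `C¹` function by smooth functions, by convolution. -/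
theorem exists_smooth_approx {D : Set (Eucl d)} (hD : IsCompact D) {g : Eucl d → ℝ}
    (hg : ContDiff ℝ 1 g) {ε : ℝ} (hε : 0 < ε) :
    ∃ g' : Eucl d → ℝ, ContDiff ℝ ((⊤ : ℕ∞) : WithTop ℕ∞) g' ∧
      ∀ x ∈ D, |g' x - g x| ≤ ε ∧ ‖gradient g' x - gradient g x‖ ≤ ε := by
  obtain ⟨R, hR0, hR⟩ := hD.isBounded.subset_closedBall_lt 0 0
  let χ : ContDiffBump (0 : Eucl d) := ⟨R + 1, R + 2, by linarith, by linarith⟩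
  let G : Eucl d → ℝ := fun x => χ x * g x
  have hG : ContDiff ℝ 1 G := χ.contDiff.mul hg
  have hGc : HasCompactSupport G := χ.hasCompactSupport.mul_right
  have hGg : ∀ x ∈ D, G =ᶠ[𝓝 x] g := by
    intro x hx
    have : Metric.ball (0 : Eucl d) (R + 1) ∈ 𝓝 x := Metric.isOpen_ball.mem_nhds (by
      have := hR hx
      rw [Metric.mem_closedBall] at this
      rw [Metric.mem_ball]; linarith)
    filter_upwards [this] with y hy
    simp only [G]
    rw [χ.one_of_mem_closedBall (Metric.ball_subset_closedBall hy), one_mul]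
  have hu := hGc.uniformContinuous_of_continuous hG.continuous
  have hu' := hGc.fderiv (𝕜 := ℝ) |>.uniformContinuous_of_continuous (hG.continuous_fderiv one_ne_zero)
  obtain ⟨δ, hδ, h1⟩ := Metric.uniformContinuous_iff.1 hu ε hε
  obtain ⟨δ', hδ', h2⟩ := Metric.uniformContinuous_iff.1 hu' ε hε
  have hm : 0 < min δ δ' := lt_min hδ hδ'
  let ψ : ContDiffBump (0 : Eucl d) := ⟨min δ δ' / 2, min δ δ', by linarith, by linarith⟩
  have hψ : LocallyIntegrable (ψ.normed volume) (volume : Measure (Eucl d)) :=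
    ψ.continuous_normed.locallyIntegrable
  refine ⟨MeasureTheory.convolution (ψ.normed volume) G (ContinuousLinearMap.lsmul ℝ ℝ) volume,
    ψ.hasCompactSupport_normed.contDiff_convolution_left _ ψ.contDiff_normed
      hG.continuous.locallyIntegrable, fun x hx => ?_⟩
  have hd := hGc.hasFDerivAt_convolution_right (ContinuousLinearMap.lsmul ℝ ℝ) hψ hG x
  have e1 := ψ.dist_normed_convolution_le (μ := volume) (x₀ := x) hG.continuous.aestronglyMeasurable
    (ε := ε) fun y hy => (h1 ((Metric.mem_ball.1 hy).trans_le (min_le_left _ _))).le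
  have e2 := ψ.dist_normed_convolution_le (μ := volume) (x₀ := x)
    (hG.continuous_fderiv one_ne_zero).aestronglyMeasurable
    (ε := ε) fun y hy => (h2 ((Metric.mem_ball.1 hy).trans_le (min_le_right _ _))).le
  refine ⟨?_, ?_⟩
  · rw [← (hGg x hx).eq_of_nhds, ← Real.dist_eq]; exact e1
  · have e3 : fderiv ℝ (MeasureTheory.convolution (ψ.normed volume) G
        (ContinuousLinearMap.lsmul ℝ ℝ) volume) x =
        MeasureTheory.convolution (ψ.normed volume) (fderiv ℝ G)
          (ContinuousLinearMap.lsmul ℝ ℝ) volume x := by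
      rw [hd.fderiv]
      refine integral_congr_ae (Eventually.of_forall fun y => ?_)
      ext v
      rfl
    rw [gradient, gradient, ← map_sub, LinearIsometryEquiv.norm_map, ← (hGg x hx).fderiv_eq, e3,
      ← dist_eq_norm]
    exact e2

theorem integrableOn_of_continuous {E : Type*} [TopologicalSpace E] [MeasurableSpace E]
    [OpensMeasurableSpace E] [T2Space E] {η : Measure E}
    [IsFiniteMeasureOnCompacts η] {D : Set E} (hD : IsCompact D) {f : E → ℝ} (hf : Continuous f) :
    IntegrableOn f D η := hf.continuousOn.integrableOn_compact hD

/-- The integration by parts formula extends to `C¹` functions. -/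
theorem IsTestFunction.integral_eq {D : Set (Eucl d)} (hD : IsCompact D) {φ g : Eucl d → ℝ}
    (hφ : IsTestFunction D φ) (hg : ContDiff ℝ 1 g) :
    ∫ x in D, g x * (-Laplacian.laplacian φ x) = ∫ x in D, ⟪gradient φ x, gradient g x⟫_ℝ := by
  have hφ2 : ContDiff ℝ 2 φ := hφ.1.of_le (by norm_cast)
  have hφ1 : ContDiff ℝ 1 φ := hφ.1.of_le (by norm_cast)
  have hc1 := continuous_laplacian hφ2
  have hc2 := continuous_gradient hφ1
  set C := (∫ x in D, |Laplacian.laplacian φ x|) + ∫ x in D, ‖gradient φ x‖ with hC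
  have hC0 : 0 ≤ C := add_nonneg (integral_nonneg fun _ => abs_nonneg _)
    (integral_nonneg fun _ => norm_nonneg _)
  have key : ∀ ε > 0, |(∫ x in D, g x * (-Laplacian.laplacian φ x)) -
      ∫ x in D, ⟪gradient φ x, gradient g x⟫_ℝ| ≤ ε * C := by
    intro ε hε
    obtain ⟨g', hg', happ⟩ := exists_smooth_approx hD hg hε
    have hg'1 : ContDiff ℝ 1 g' := hg'.of_le (by norm_cast)
    have i1 : ∀ {g : Eucl d → ℝ}, ContDiff ℝ 1 g →
        IntegrableOn (fun x => g x * (-Laplacian.laplacian φ x)) D := fun hg =>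
      integrableOn_of_continuous hD (hg.continuous.mul hc1.neg)
    have i2 : ∀ {g : Eucl d → ℝ}, ContDiff ℝ 1 g →
        IntegrableOn (fun x => ⟪gradient φ x, gradient g x⟫_ℝ) D := fun hg =>
      integrableOn_of_continuous hD (hc2.inner (continuous_gradient hg))
    have e1 : |(∫ x in D, g x * (-Laplacian.laplacian φ x)) -
        ∫ x in D, g' x * (-Laplacian.laplacian φ x)| ≤ ε * ∫ x in D, |Laplacian.laplacian φ x| := by
      rw [← integral_sub (i1 hg) (i1 hg'1), ← integral_const_mul, ← Real.norm_eq_abs]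
      refine norm_integral_le_of_norm_le
        (integrableOn_of_continuous hD (continuous_const.mul hc1.abs)) ?_
      filter_upwards [ae_restrict_mem hD.measurableSet] with x hx
      rw [← sub_mul, Real.norm_eq_abs, abs_mul, abs_neg, abs_sub_comm]
      exact mul_le_mul_of_nonneg_right (happ x hx).1 (abs_nonneg _)
    have e2 : |(∫ x in D, ⟪gradient φ x, gradient g' x⟫_ℝ) -
        ∫ x in D, ⟪gradient φ x, gradient g x⟫_ℝ| ≤ ε * ∫ x in D, ‖gradient φ x‖ := by
      rw [← integral_sub (i2 hg'1) (i2 hg), ← integral_const_mul, ← Real.norm_eq_abs]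
      refine norm_integral_le_of_norm_le
        (integrableOn_of_continuous hD (continuous_const.mul hc2.norm)) ?_
      filter_upwards [ae_restrict_mem hD.measurableSet] with x hx
      rw [← inner_sub_right, mul_comm]
      exact (norm_inner_le_norm _ _).trans (mul_le_mul_of_nonneg_left (happ x hx).2 (norm_nonneg _))
    rw [← hφ.2 g' hg'] at e2
    rw [hC, mul_add]
    exact (abs_sub_le _ _ _).trans (add_le_add e1 e2)
  refine sub_eq_zero.1 (abs_nonpos_iff.1 (le_of_forall_pos_le_add fun ε hε => ?_))
  rw [zero_add]
  refine (key (ε / (C + 1)) (by positivity)).trans ?_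
  rw [div_mul_eq_mul_div, div_le_iff₀ (by positivity)]
  nlinarith

theorem laplacian_of_gradient_eq_sum {M : ℕ} {u : Eucl d → ℝ} {w φ : Fin M → Eucl d → ℝ}
    (hu : ContDiff ℝ 2 u) (hw : ∀ m, ContDiff ℝ 1 (w m)) (hφ : ∀ m, ContDiff ℝ 2 (φ m))
    (h : ∀ x, fderiv ℝ u x = ∑ m, w m x • fderiv ℝ (φ m) x) (x : Eucl d) :
    Laplacian.laplacian u x = ∑ m, (w m x * Laplacian.laplacian (φ m) x +
      ⟪gradient (w m) x, gradient (φ m) x⟫_ℝ) := by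
  rw [laplacian_eq_sum hu]
  simp only [laplacian_eq_sum (hφ _), inner_gradient_gradient, Finset.mul_sum,
    ← Finset.sum_add_distrib]
  rw [Finset.sum_comm]
  refine Finset.sum_congr rfl fun i _ => ?_
  have hd : ∀ m, DifferentiableAt ℝ (fun y => fderiv ℝ (φ m) y (EuclideanSpace.single i (1 : ℝ))) x :=
    fun m => ((((hφ m).fderiv_right (m := 1) (by norm_num)).clm_apply
      contDiff_const).differentiable one_ne_zero) x
  have hd' : ∀ m, DifferentiableAt ℝ (w m) x := fun m => ((hw m).differentiable one_ne_zero) x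
  have e : (fun y => fderiv ℝ u y (EuclideanSpace.single i (1 : ℝ))) =
      fun y => ∑ m, w m y * fderiv ℝ (φ m) y (EuclideanSpace.single i (1 : ℝ)) := by
    funext y; rw [h y]; simp
  rw [e, fderiv_fun_sum fun m _ => (hd' m).fun_mul (hd m)]
  simp only [sum_apply]
  refine Finset.sum_congr rfl fun m _ => ?_
  rw [fderiv_fun_mul (hd' m) (hd m)]
  simp only [add_apply, smul_apply, smul_eq_mul]
  ring

/-- The integration by parts formula is stable under the composition with smooth functions. -/
theorem IsTestFunction.integral_comp_eq {D : Set (Eucl d)} (hD : IsCompact D) {M : ℕ}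
    {φ : Fin M → Eucl d → ℝ} (hφ : ∀ m, IsTestFunction D (φ m)) {f : (Fin M → ℝ) → ℝ}
    (hf : ContDiff ℝ ((⊤ : ℕ∞) : WithTop ℕ∞) f) {g : Eucl d → ℝ} (hg : ContDiff ℝ 1 g) :
    ∫ x in D, g x * (-Laplacian.laplacian (fun y => f fun m => φ m y) x) =
      ∫ x in D, ⟪gradient (fun y => f fun m => φ m y) x, gradient g x⟫_ℝ := by
  set u : Eucl d → ℝ := fun y => f fun m => φ m y with hu
  have hΦ : ContDiff ℝ ((⊤ : ℕ∞) : WithTop ℕ∞) fun (y : Eucl d) (m : Fin M) => φ m y :=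
    contDiff_pi.2 fun m => (hφ m).1
  let w : Fin M → Eucl d → ℝ := fun m y => fderiv ℝ f (fun l => φ l y) (Pi.single m 1)
  have hus : ContDiff ℝ ((⊤ : ℕ∞) : WithTop ℕ∞) u := hf.comp hΦ
  have hu2 : ContDiff ℝ 2 u := hus.of_le (by norm_cast)
  have hw : ∀ m, ContDiff ℝ 1 (w m) := fun m =>
    ((hf.fderiv_right (m := 1) (by norm_cast)).clm_apply contDiff_const).comp
      (hΦ.of_le (by norm_cast))
  have hφ2 : ∀ m, ContDiff ℝ 2 (φ m) := fun m => (hφ m).1.of_le (by norm_cast)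
  have hφ1 : ∀ m, ContDiff ℝ 1 (φ m) := fun m => (hφ m).1.of_le (by norm_cast)
  have hfd : ∀ x, fderiv ℝ u x = ∑ m, w m x • fderiv ℝ (φ m) x := by
    intro x
    have h1 : HasFDerivAt (fun (y : Eucl d) (m : Fin M) => φ m y)
        (ContinuousLinearMap.pi fun m => fderiv ℝ (φ m) x) x :=
      hasFDerivAt_pi.2 fun m => ((hφ1 m).differentiable one_ne_zero x).hasFDerivAt
    have h2 : HasFDerivAt f (fderiv ℝ f fun l => φ l x) (fun l => φ l x) :=
      ((hf.of_le (by norm_cast : (1 : WithTop ℕ∞) ≤ _)).differentiable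
        one_ne_zero _).hasFDerivAt
    have h3 : HasFDerivAt u _ x := h2.comp x h1
    rw [h3.fderiv]
    ext v
    simp only [ContinuousLinearMap.comp_apply, sum_apply,
      smul_apply, smul_eq_mul, w]
    conv_lhs => rw [← ContinuousLinearMap.coe_coe, LinearMap.pi_apply_eq_sum_univ]
    refine Finset.sum_congr rfl fun m _ => ?_
    rw [smul_eq_mul, mul_comm]
    have e : (fun l => if m = l then (1 : ℝ) else 0) = Pi.single m 1 := by
      funext l; simp [Pi.single_apply, eq_comm]
    rw [e]
    rfl
  have hgrad : ∀ x, gradient u x = ∑ m, w m x • gradient (φ m) x := by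
    intro x
    simp only [gradient, hfd x, map_sum, map_smul]
  have hlap := laplacian_of_gradient_eq_sum hu2 hw hφ2 hfd
  have i1 : ∀ m, IntegrableOn (fun x => (g x * w m x) * (-Laplacian.laplacian (φ m) x)) D := fun m =>
    integrableOn_of_continuous hD
      ((hg.continuous.mul (hw m).continuous).mul (continuous_laplacian (hφ2 m)).neg)
  have i2 : ∀ m, IntegrableOn (fun x => g x * ⟪gradient (w m) x, gradient (φ m) x⟫_ℝ) D := fun m =>
    integrableOn_of_continuous hD (hg.continuous.mul
      ((continuous_gradient (hw m)).inner (continuous_gradient (hφ1 m))))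
  have i3 : ∀ m, IntegrableOn (fun x => ⟪gradient (φ m) x, gradient (fun y => g y * w m y) x⟫_ℝ) D :=
    fun m => integrableOn_of_continuous hD
      ((continuous_gradient (hφ1 m)).inner (continuous_gradient (hg.mul (hw m))))
  have i12 : ∀ m, IntegrableOn (fun x => (g x * w m x) * (-Laplacian.laplacian (φ m) x) -
      g x * ⟪gradient (w m) x, gradient (φ m) x⟫_ℝ) D := fun m => (i1 m).sub (i2 m)
  have i32 : ∀ m, IntegrableOn (fun x => ⟪gradient (φ m) x, gradient (fun y => g y * w m y) x⟫_ℝ -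
      g x * ⟪gradient (w m) x, gradient (φ m) x⟫_ℝ) D := fun m => (i3 m).sub (i2 m)
  calc ∫ x in D, g x * (-Laplacian.laplacian u x)
      = ∫ x in D, ∑ m, ((g x * w m x) * (-Laplacian.laplacian (φ m) x) -
          g x * ⟪gradient (w m) x, gradient (φ m) x⟫_ℝ) := by
        refine integral_congr_ae (Eventually.of_forall fun x => ?_)
        simp only [hlap x]
        rw [← Finset.sum_neg_distrib, Finset.mul_sum]
        refine Finset.sum_congr rfl fun m _ => ?_
        ring
    _ = ∑ m, ((∫ x in D, ⟪gradient (φ m) x, gradient (fun y => g y * w m y) x⟫_ℝ) -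
          ∫ x in D, g x * ⟪gradient (w m) x, gradient (φ m) x⟫_ℝ) := by
        rw [integral_finsetSum _ fun m _ => i12 m]
        refine Finset.sum_congr rfl fun m _ => ?_
        rw [integral_sub (i1 m) (i2 m), (hφ m).integral_eq hD (hg.mul (hw m))]
    _ = ∫ x in D, ∑ m, (⟪gradient (φ m) x, gradient (fun y => g y * w m y) x⟫_ℝ -
          g x * ⟪gradient (w m) x, gradient (φ m) x⟫_ℝ) := by
        rw [integral_finsetSum _ fun m _ => i32 m]
        exact Finset.sum_congr rfl fun m _ => (integral_sub (i3 m) (i2 m)).symm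
    _ = _ := by
        refine integral_congr_ae (Eventually.of_forall fun x => ?_)
        simp only
        rw [hgrad, sum_inner]
        refine Finset.sum_congr rfl fun m _ => ?_
        rw [real_inner_comm, inner_gradient, real_inner_smul_left, real_inner_comm (gradient g x),
          inner_gradient g, inner_gradient (w m),
          fderiv_fun_mul (hg.differentiable one_ne_zero x) ((hw m).differentiable one_ne_zero x)]
        simp only [add_apply, smul_apply, smul_eq_mul]
        ring

theorem isTestFunction_const (D : Set (Eucl d)) (c : ℝ) : IsTestFunction D fun _ => c := by
  refine ⟨contDiff_const, fun g _ => ?_⟩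
  have h1 : ∀ x, Laplacian.laplacian (fun _ : Eucl d => c) x = 0 := fun x => by
    rw [laplacian_eq_sum contDiff_const]; simp
  have h2 : ∀ x, gradient (fun _ : Eucl d => c) x = 0 := fun x => by simp [gradient]
  simp [h1, h2]

/-- Adding a constant to the arguments of a test function does not change its derivatives. -/
theorem IsTestFunction.const_add {D : Set (Eucl d)} {φ : Eucl d → ℝ} (hφ : IsTestFunction D φ)
    (c : ℝ) : IsTestFunction D fun x => c + φ x := by
  have hφ2 : ContDiff ℝ 2 φ := hφ.1.of_le (by norm_cast)
  refine ⟨contDiff_const.add hφ.1, fun g hg => ?_⟩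
  have h0 : ∀ x, fderiv ℝ (fun x => c + φ x) x = fderiv ℝ φ x := fun x => fderiv_const_add c
  have h1 : ∀ x, Laplacian.laplacian (fun x => c + φ x) x = Laplacian.laplacian φ x := fun x => by
    rw [laplacian_eq_sum (contDiff_const.add hφ2), laplacian_eq_sum hφ2]
    simp only [h0]
  simpa only [h1, gradient, h0] using hφ.2 g hg

/-- Smooth functions supported in `D` are test functions. -/
theorem isTestFunction_of_support_subset {D : Set (Eucl d)} (hD : IsCompact D) {φ : Eucl d → ℝ}
    (hφ : ContDiff ℝ ((⊤ : ℕ∞) : WithTop ℕ∞) φ) (hs : Function.support φ ⊆ D) :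
    IsTestFunction D φ := by
  have hφ2 : ContDiff ℝ 2 φ := hφ.of_le (by norm_cast)
  have hφ1 : ContDiff ℝ 1 φ := hφ.of_le (by norm_cast)
  refine ⟨hφ, fun g hg => ?_⟩
  have hg1 : ContDiff ℝ 1 g := hg.of_le (by norm_cast)
  have ht : tsupport φ ⊆ D := closure_minimal hs hD.isClosed
  have hc : HasCompactSupport φ := HasCompactSupport.of_support_subset_isCompact hD hs
  let ψ : Fin d → Eucl d → ℝ := fun h y => fderiv ℝ φ y (EuclideanSpace.single h 1)
  have hψ : ∀ h, ContDiff ℝ 1 (ψ h) := fun h =>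
    (hφ2.fderiv_right (m := 1) (by norm_num)).clm_apply contDiff_const
  have hψc : ∀ h, HasCompactSupport (ψ h) := fun h => hc.fderiv_apply (𝕜 := ℝ) _
  have e1 : ∫ x in D, g x * (-Laplacian.laplacian φ x) =
      ∫ x, g x * (-Laplacian.laplacian φ x) := by
    refine setIntegral_eq_integral_of_forall_compl_eq_zero fun x hx => ?_
    have h0 : φ =ᶠ[𝓝 x] fun _ => 0 := by
      filter_upwards [hD.isClosed.isOpen_compl.mem_nhds hx] with y hy
      exact Function.notMem_support.1 fun h => hy (hs h)
    have h1 := (InnerProductSpace.laplacian_congr_nhds h0).eq_of_nhds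
    rw [h1, laplacian_eq_sum contDiff_const]
    simp
  have e2 : ∫ x in D, ⟪gradient φ x, gradient g x⟫_ℝ = ∫ x, ⟪gradient φ x, gradient g x⟫_ℝ := by
    refine setIntegral_eq_integral_of_forall_compl_eq_zero fun x hx => ?_
    have h0 : φ =ᶠ[𝓝 x] fun _ => 0 := by
      filter_upwards [hD.isClosed.isOpen_compl.mem_nhds hx] with y hy
      exact Function.notMem_support.1 fun h => hy (hs h)
    simp [gradient, h0.fderiv_eq]
  have j1 : ∀ h : Fin d, Integrable fun x => g x *
      fderiv ℝ (ψ h) x (EuclideanSpace.single h 1) := fun h =>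
    (hg1.continuous.mul (((hψ h).continuous_fderiv one_ne_zero).clm_apply
      continuous_const)).integrable_of_hasCompactSupport ((hψc h).fderiv_apply (𝕜 := ℝ) _).mul_left
  have j2 : ∀ h : Fin d, Integrable fun x =>
      fderiv ℝ g x (EuclideanSpace.single h 1) * ψ h x := fun h =>
    (((hg1.continuous_fderiv one_ne_zero).clm_apply continuous_const).mul
      (hψ h).continuous).integrable_of_hasCompactSupport (hψc h).mul_left
  rw [e1, e2]
  simp only [laplacian_eq_sum hφ2, inner_gradient_gradient, mul_neg, Finset.mul_sum]
  rw [integral_neg, integral_finsetSum _ fun h _ => j1 h, integral_finsetSum, ← Finset.sum_neg_distrib]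
  · refine Finset.sum_congr rfl fun h _ => ?_
    rw [integral_mul_fderiv_eq_neg_fderiv_mul_of_integrable (j2 h) (j1 h)
      ((hg1.continuous.mul (hψ h).continuous).integrable_of_hasCompactSupport (hψc h).mul_left)
      (fun x _ => hg1.differentiable one_ne_zero x)
      (fun x _ => (hψ h).differentiable one_ne_zero x), neg_neg]
    simp only [ψ, mul_comm]
  · intro h _
    simpa only [mul_comm] using j2 h

end

/-! ### Partial gradients and Laplacians of functions of several points -/

section

variable {d n : ℕ}

/-- The gradient of a function of `n` points with respect to the `i`-th point. -/
noncomputable def tupleGrad (F : (Fin n → Eucl d) → ℝ) (i : Fin n) (x : Fin n → Eucl d) : Eucl d :=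
  gradient (fun y => F (Function.update x i y)) (x i)

/-- The Laplacian of a function of `n` points with respect to the `i`-th point. -/
noncomputable def tupleLap (F : (Fin n → Eucl d) → ℝ) (i : Fin n) (x : Fin n → Eucl d) : ℝ :=
  Laplacian.laplacian (fun y => F (Function.update x i y)) (x i)

theorem fderiv_comp_update {F : (Fin n → Eucl d) → ℝ} (x : Fin n → Eucl d) (i : Fin n) (y : Eucl d)
    (hF : DifferentiableAt ℝ F (Function.update x i y)) (v : Eucl d) :
    fderiv ℝ (fun y => F (Function.update x i y)) y v =
      fderiv ℝ F (Function.update x i y) (Pi.single i v) := by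
  have h := hF.hasFDerivAt.comp y (hasFDerivAt_update (𝕜 := ℝ) x (i := i) y)
  rw [show (fun y => F (Function.update x i y)) = F ∘ Function.update x i from rfl, h.fderiv]
  simp only [ContinuousLinearMap.comp_apply]
  congr 1
  funext j
  by_cases hj : j = i
  · subst hj; simp
  · simp [hj]

theorem inner_tupleGrad {F : (Fin n → Eucl d) → ℝ} {x : Fin n → Eucl d} (i : Fin n)
    (hF : DifferentiableAt ℝ F x) (v : Eucl d) :
    ⟪tupleGrad F i x, v⟫_ℝ = fderiv ℝ F x (Pi.single i v) := by
  rw [tupleGrad, inner_gradient, fderiv_comp_update] <;> rw [Function.update_eq_self]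
  exact hF

theorem tupleGrad_apply {F : (Fin n → Eucl d) → ℝ} {x : Fin n → Eucl d} (i : Fin n)
    (hF : DifferentiableAt ℝ F x) (h : Fin d) : tupleGrad F i x h = pderivTuple F i h x := by
  rw [pderivTuple, ← inner_tupleGrad i hF, EuclideanSpace.inner_single_right]
  simp

theorem contDiff_pderivTuple {r s : WithTop ℕ∞} {F : (Fin n → Eucl d) → ℝ} (hF : ContDiff ℝ s F)
    (hrs : r + 1 ≤ s) (i : Fin n) (h : Fin d) : ContDiff ℝ r (pderivTuple F i h) :=
  (hF.fderiv_right hrs).clm_apply contDiff_const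

theorem continuous_tupleGrad {F : (Fin n → Eucl d) → ℝ} (hF : ContDiff ℝ 1 F) (i : Fin n) :
    Continuous (tupleGrad F i) := by
  have h : tupleGrad F i = fun x => WithLp.toLp 2 fun h => pderivTuple F i h x := by
    funext x
    ext h
    exact tupleGrad_apply i (hF.differentiable one_ne_zero x) h
  rw [h]
  refine (PiLp.continuous_toLp 2 _).comp (continuous_pi fun h => ?_)
  exact (contDiff_pderivTuple (r := 0) hF (by norm_num) i h).continuous

theorem tupleLap_eq_sum {F : (Fin n → Eucl d) → ℝ} (hF : ContDiff ℝ 2 F) (i : Fin n)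
    (x : Fin n → Eucl d) :
    tupleLap F i x = ∑ h, pderivTuple (pderivTuple F i h) i h x := by
  rw [tupleLap, laplacian_eq_sum (f := fun y => F (Function.update x i y))
    (hF.comp (contDiff_update 2 x i))]
  refine Finset.sum_congr rfl fun h _ => ?_
  have hF1 : ContDiff ℝ 1 F := hF.of_le (by norm_num)
  have e : (fun y => fderiv ℝ (fun y => F (Function.update x i y)) y
      (EuclideanSpace.single h (1 : ℝ))) = fun y => pderivTuple F i h (Function.update x i y) := by
    funext y
    rw [fderiv_comp_update x i y (hF1.differentiable one_ne_zero _), pderivTuple]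
  rw [e, fderiv_comp_update x i (x i) ((contDiff_pderivTuple (r := 1) hF (by norm_num) i
    h).differentiable one_ne_zero _), Function.update_eq_self]
  rfl

theorem continuous_tupleLap {F : (Fin n → Eucl d) → ℝ} (hF : ContDiff ℝ 2 F) (i : Fin n) :
    Continuous (tupleLap F i) := by
  rw [funext (tupleLap_eq_sum hF i)]
  refine continuous_finsetSum _ fun h _ => ?_
  exact (contDiff_pderivTuple (r := 0) (contDiff_pderivTuple (r := 1) hF (by norm_num) i h)
    (by norm_num) i h).continuous

theorem eventually_update {F G : (Fin n → Eucl d) → ℝ} {x : Fin n → Eucl d} (h : F =ᶠ[𝓝 x] G)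
    (i : Fin n) : (fun y => F (Function.update x i y)) =ᶠ[𝓝 (x i)]
      fun y => G (Function.update x i y) := by
  have hc : Tendsto (Function.update x i) (𝓝 (x i)) (𝓝 x) := by
    have := ((contDiff_update (𝕜 := ℝ) 0 x i).continuous).tendsto (x i)
    rwa [Function.update_eq_self] at this
  exact hc.eventually h

theorem tupleGrad_congr {F G : (Fin n → Eucl d) → ℝ} {x : Fin n → Eucl d} (h : F =ᶠ[𝓝 x] G)
    (i : Fin n) : tupleGrad F i x = tupleGrad G i x := by
  rw [tupleGrad, tupleGrad, gradient, gradient, (eventually_update h i).fderiv_eq]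

theorem tupleGrad_mul {F G : (Fin n → Eucl d) → ℝ} {x : Fin n → Eucl d} (i : Fin n)
    (hF : DifferentiableAt ℝ F x) (hG : DifferentiableAt ℝ G x) :
    tupleGrad (fun x => F x * G x) i x = F x • tupleGrad G i x + G x • tupleGrad F i x := by
  refine ext_inner_right ℝ fun v => ?_
  rw [inner_tupleGrad i (hF.fun_mul hG), inner_add_left, real_inner_smul_left, real_inner_smul_left,
    inner_tupleGrad i hF, inner_tupleGrad i hG, fderiv_fun_mul hF hG]
  simp

variable {D : Set (Eucl d)}

theorem pi_restrict_eq (D : Set (Eucl d)) : (Measure.pi fun _ : Fin n => volume.restrict D) =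
    (volume : Measure (Fin n → Eucl d)).restrict (Set.pi univ fun _ => D) := by
  rw [← Measure.restrict_pi_pi]; rfl

theorem integrable_tuple_of_continuous (hD : IsCompact D) {f : (Fin n → Eucl d) → ℝ}
    (hf : Continuous f) : Integrable f (Measure.pi fun _ : Fin n => volume.restrict D) := by
  rw [pi_restrict_eq]
  exact integrableOn_of_continuous (isCompact_univ_pi fun _ => hD) hf

/-- Integration by parts in one of `n` points. -/
theorem integral_tuple_by_parts (hD : IsCompact D) {F q : (Fin n → Eucl d) → ℝ}
    (hF : ContDiff ℝ 2 F) (hq : ContDiff ℝ 1 q) (i : Fin n)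
    (h : ∀ (x : Fin n → Eucl d) (g : Eucl d → ℝ), ContDiff ℝ 1 g →
      ∫ y in D, g y * (-Laplacian.laplacian (fun y => F (Function.update x i y)) y) =
        ∫ y in D, ⟪gradient (fun y => F (Function.update x i y)) y, gradient g y⟫_ℝ) :
    ∫ x, q x * (-tupleLap F i x) ∂(Measure.pi fun _ : Fin n => volume.restrict D) =
      ∫ x, ⟪tupleGrad F i x, tupleGrad q i x⟫_ℝ ∂(Measure.pi fun _ : Fin n => volume.restrict D) := by
  obtain _ | m := n
  · exact i.elim0
  have hfin : IsFiniteMeasure (volume.restrict D : Measure (Eucl d)) :=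
    isFiniteMeasure_restrict.2 hD.measure_lt_top.ne
  have hF1 : ContDiff ℝ 1 F := hF.of_le (by norm_num)
  have c1 : Continuous fun x => q x * (-tupleLap F i x) :=
    hq.continuous.mul (continuous_tupleLap hF i).neg
  have c2 : Continuous fun x => ⟪tupleGrad F i x, tupleGrad q i x⟫_ℝ :=
    (continuous_tupleGrad hF1 i).inner (continuous_tupleGrad hq i)
  have hmp := (measurePreserving_piFinSuccAbove (fun _ : Fin (m + 1) => volume.restrict D) i).symm
  have hfub : ∀ {Φ : (Fin (m + 1) → Eucl d) → ℝ}, Continuous Φ →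
      ∫ x, Φ x ∂(Measure.pi fun _ : Fin (m + 1) => volume.restrict D) =
        ∫ x', ∫ y in D, Φ (i.insertNth (α := fun _ => Eucl d) y x')
          ∂volume ∂(Measure.pi fun _ : Fin m => volume.restrict D) := by
    intro Φ hΦ
    have hi := integrable_tuple_of_continuous hD hΦ
    rw [← hmp.integral_comp' Φ]
    have hi' := (hmp.integrable_comp_emb (MeasurableEquiv.measurableEmbedding _)).2 hi
    exact integral_prod_symm _ hi'
  rw [hfub c1, hfub c2]
  refine integral_congr_ae (Eventually.of_forall fun x' => ?_)
  let X : Eucl d → Fin (m + 1) → Eucl d := fun y => i.insertNth (α := fun _ => Eucl d) y x'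
  have hX : ∀ y, X y i = y := fun y => Fin.insertNth_apply_same ..
  have hu : ∀ y z : Eucl d, Function.update (X y) i z = Function.update (X 0) i z := fun y z => by
    simp [X]
  have hu' : ∀ y : Eucl d, X y = Function.update (X 0) i y := fun y => by simp [X]
  have hs : ∀ (G : (Fin (m + 1) → Eucl d) → ℝ) (y : Eucl d),
      (fun z => G (Function.update (X y) i z)) = fun z => G (Function.update (X 0) i z) :=
    fun G y => funext fun z => by rw [hu y z]
  have h1 := h (X 0) (fun y => q (Function.update (X 0) i y)) (hq.comp (contDiff_update 1 _ i))
  have e1 : ∀ y, tupleLap F i (X y) =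
      Laplacian.laplacian (fun z => F (Function.update (X 0) i z)) y := fun y => by
    rw [tupleLap, hs, hX]
  have e2 : ∀ (G : (Fin (m + 1) → Eucl d) → ℝ) (y : Eucl d), tupleGrad G i (X y) =
      gradient (fun z => G (Function.update (X 0) i z)) y := fun G y => by
    rw [tupleGrad, hs, hX]
  have e3 : ∀ y, q (X y) = q (Function.update (X 0) i y) := fun y => congrArg q (hu' y)
  change ∫ y in D, q (X y) * (-tupleLap F i (X y)) =
    ∫ y in D, ⟪tupleGrad F i (X y), tupleGrad q i (X y)⟫_ℝ
  simp only [e1, e2, e3]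
  exact h1

end

/-! ### Functionals on configurations as functions of several points -/

section

variable {d n : ℕ}

theorem FinConfig.move_ofTuple {x : Fin n → Eucl d} (hx : Function.Injective x) (i : Fin n)
    (y : Eucl d) : (FinConfig.ofTuple x).move (x i) y = FinConfig.ofTuple (Function.update x i y) := by
  simp only [FinConfig.move, FinConfig.ofTuple, FinConfig.mk.injEq]
  ext z
  simp only [Finset.mem_insert, Finset.mem_erase, Finset.mem_image, Finset.mem_univ, true_and]
  constructor
  · rintro (rfl | ⟨hz, j, rfl⟩)
    · exact ⟨i, by simp⟩
    · exact ⟨j, by rw [Function.update_of_ne fun h => hz (by rw [h])]⟩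
  · rintro ⟨j, rfl⟩
    by_cases hj : j = i
    · subst hj; left; simp
    · right
      rw [Function.update_of_ne hj]
      exact ⟨fun h => hj (hx h), j, rfl⟩

theorem eventually_injective_update {x : Fin n → Eucl d} (hx : Function.Injective x) (i : Fin n) :
    ∀ᶠ y in 𝓝 (x i), Function.Injective (Function.update x i y) := by
  have h : ∀ᶠ y in 𝓝 (x i), ∀ j, j ≠ i → y ≠ x j := by
    refine eventually_all.2 fun j => ?_
    by_cases hj : j = i
    · simp [hj]
    · filter_upwards [isOpen_compl_singleton.mem_nhds
        (show x i ∈ ({x j} : Set (Eucl d))ᶜ from fun h => hj (hx h).symm)] with y hy _ using hy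
  filter_upwards [h] with y hy a b hab
  by_cases ha : a = i <;> by_cases hb : b = i
  · rw [ha, hb]
  · subst ha
    rw [Function.update_self, Function.update_of_ne hb] at hab
    exact absurd hab (hy b hb)
  · subst hb
    rw [Function.update_self, Function.update_of_ne ha] at hab
    exact absurd hab.symm (hy a ha)
  · rw [Function.update_of_ne ha, Function.update_of_ne hb] at hab
    exact hx hab

variable {F : FinConfig d → ℝ} {f : (Fin n → Eucl d) → ℝ}

theorem eventually_move (h : ∀ x, Function.Injective x → F (FinConfig.ofTuple x) = f x)
    {x : Fin n → Eucl d} (hx : Function.Injective x) (i : Fin n) :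
    (fun y => F ((FinConfig.ofTuple x).move (x i) y)) =ᶠ[𝓝 (x i)]
      fun y => f (Function.update x i y) := by
  filter_upwards [eventually_injective_update hx i] with y hy
  rw [FinConfig.move_ofTuple hx, h _ hy]

theorem configGrad_ofTuple (h : ∀ x, Function.Injective x → F (FinConfig.ofTuple x) = f x)
    {x : Fin n → Eucl d} (hx : Function.Injective x) (i : Fin n) :
    configGrad F (FinConfig.ofTuple x) (x i) = tupleGrad f i x := by
  rw [configGrad, tupleGrad, gradient, gradient, (eventually_move h hx i).fderiv_eq]

theorem configLaplacian_ofTuple (h : ∀ x, Function.Injective x → F (FinConfig.ofTuple x) = f x)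
    {x : Fin n → Eucl d} (hx : Function.Injective x) (i : Fin n) :
    configLaplacian F (FinConfig.ofTuple x) (x i) = tupleLap f i x :=
  (InnerProductSpace.laplacian_congr_nhds (eventually_move h hx i)).eq_of_nhds

theorem sum_pts_ofTuple {x : Fin n → Eucl d} (hx : Function.Injective x) (φ : Eucl d → ℝ) :
    ∑ y ∈ (FinConfig.ofTuple x).pts, φ y = ∑ i, φ (x i) := by
  rw [FinConfig.ofTuple, Finset.sum_image fun _ _ _ _ h => hx h]

theorem card_pts_ofTuple {x : Fin n → Eucl d} (hx : Function.Injective x) :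
    (FinConfig.ofTuple x).pts.card = n := by
  rw [FinConfig.ofTuple, Finset.card_image_of_injective _ hx, Finset.card_univ, Fintype.card_fin]

theorem detConfig_ofTuple (J : Eucl d → Eucl d → ℂ) {x : Fin n → Eucl d}
    (hx : Function.Injective x) : detConfig J (FinConfig.ofTuple x) = detTuple J n x := by
  classical
  let e : Fin n ≃ (FinConfig.ofTuple x).pts := Equiv.ofBijective
    (fun i => ⟨x i, (mem_pts_ofTuple x _).2 ⟨i, rfl⟩⟩)
    ⟨fun i j hij => hx (Subtype.ext_iff.1 hij), fun y => by
      obtain ⟨i, hi⟩ := (mem_pts_ofTuple x y).1 y.2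
      exact ⟨i, Subtype.ext hi⟩⟩
  rw [detConfig, detTuple, ← Matrix.det_submatrix_equiv_self e]
  rfl

/-- A cylinder functional as a function of `n` points. -/
noncomputable def cylTuple {M : ℕ} (f : (Fin M → ℝ) → ℝ) (φ : Fin M → Eucl d → ℝ) (N n : ℕ)
    (x : Fin n → Eucl d) : ℝ :=
  if n ≤ N then f (fun m => ∑ i, φ m (x i)) else 0

variable {M N : ℕ} {D : Set (Eucl d)} {φ : Fin M → Eucl d → ℝ}

theorem cylinder_ofTuple (f : (Fin M → ℝ) → ℝ) (φ : Fin M → Eucl d → ℝ) (N : ℕ)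
    (x : Fin n → Eucl d) (hx : Function.Injective x) :
    _root_.cylinder f φ N (FinConfig.ofTuple x) = cylTuple f φ N n x := by
  simp only [_root_.cylinder, cylTuple, card_pts_ofTuple hx, sum_pts_ofTuple hx]

theorem contDiff_cylTuple {f : (Fin M → ℝ) → ℝ} (hf : ContDiff ℝ ((⊤ : ℕ∞) : WithTop ℕ∞) f)
    (hφ : ∀ m, ContDiff ℝ ((⊤ : ℕ∞) : WithTop ℕ∞) (φ m)) (N n : ℕ) :
    ContDiff ℝ ((⊤ : ℕ∞) : WithTop ℕ∞) (cylTuple f φ N n) := by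
  unfold cylTuple
  split_ifs
  · exact hf.comp (contDiff_pi.2 fun m => ContDiff.sum fun i _ => (hφ m).comp (contDiff_apply _ _ i))
  · exact contDiff_const

/-- As a function of each of its points, a cylinder functional satisfies the integration by parts
formula on `D`. -/
theorem cylTuple_by_parts (hD : IsCompact D) {f : (Fin M → ℝ) → ℝ}
    (hf : ContDiff ℝ ((⊤ : ℕ∞) : WithTop ℕ∞) f) (hφ : ∀ m, IsTestFunction D (φ m)) (N : ℕ)
    (i : Fin n) (x : Fin n → Eucl d) (g : Eucl d → ℝ) (hg : ContDiff ℝ 1 g) :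
    ∫ y in D, g y * (-Laplacian.laplacian (fun y => cylTuple f φ N n (Function.update x i y)) y) =
      ∫ y in D, ⟪gradient (fun y => cylTuple f φ N n (Function.update x i y)) y,
        gradient g y⟫_ℝ := by
  by_cases hn : n ≤ N
  · have e : (fun y => cylTuple f φ N n (Function.update x i y)) =
        fun y => f fun m => (∑ j ∈ Finset.univ.erase i, φ m (x j)) + φ m y := by
      funext y
      rw [cylTuple, if_pos hn]
      congr 1
      funext m
      rw [← Finset.sum_erase_add _ _ (Finset.mem_univ i), Function.update_self]
      congr 1
      exact Finset.sum_congr rfl fun j hj => by rw [Function.update_of_ne (Finset.ne_of_mem_erase hj)]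
    rw [e]
    exact IsTestFunction.integral_comp_eq hD (fun m => (hφ m).const_add _) hf hg
  · have e : (fun y => cylTuple f φ N n (Function.update x i y)) = fun _ => 0 := by
      funext y; rw [cylTuple, if_neg hn]
    rw [e, (isTestFunction_const D 0).integral_eq hD hg]

end

/-! ### Integration against the law of the process -/

section

variable {d : ℕ}

/-- The law `Q` has the Janossy densities `a det J` with respect to `μ` on `D`. Here `g n` is a
`C¹` extension of the determinants `det J` of `n` points of `D`, and `r` one of the density of `μ`
on `D`. -/
structure IsRegularJanossy (D : Set (Eucl d)) (μ : Measure (Eucl d)) (ρ : Eucl d → ℝ)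
    (J : Eucl d → Eucl d → ℂ) (a : ℝ) (g : ∀ n, (Fin n → Eucl d) → ℝ) (r : Eucl d → ℝ)
    (Q : Measure (FinConfig d)) : Prop where
  compact : IsCompact D
  null_frontier : volume (frontier D) = 0
  pos : 0 < a
  measurable : ∀ n, Measurable (detTuple J n)
  contDiff_det : ∀ n, ContDiff ℝ 1 (g n)
  det_eq : ∀ n, ∀ x : Fin n → Eucl d, (∀ i, x i ∈ D) → detTuple J n x = g n x
  det_nonneg : ∀ n, ∀ x : Fin n → Eucl d, (∀ i, x i ∈ interior D) → 0 ≤ g n x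
  integrable_det : ∀ n, Integrable (detTuple J n) (Measure.pi fun _ : Fin n => μ.restrict D)
  contDiff_density : ContDiff ℝ 1 r
  density_eq : EqOn ρ r D
  density_pos : ∀ x ∈ D, 0 < r x
  sigmaFinite : SigmaFinite μ
  finite : IsFiniteMeasure (μ.restrict D)
  restrict_eq : μ.restrict D = (volume.restrict D).withDensity fun x => ENNReal.ofReal (r x)
  law : Q = janossy (μ.restrict D) J a
  integrability : IntegrabilityCondition μ J D

/-- The tuples of points of the interior of `D` at which `det J` is positive. -/
def goodTuples (D : Set (Eucl d)) (J : Eucl d → Eucl d → ℂ) (n : ℕ) : Set (Fin n → Eucl d) :=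
  {x | (∀ i, x i ∈ interior D) ∧ 0 < detTuple J n x}

/-- The configurations of points of the interior of `D` at which `det J` is positive. -/
def goodConfigs (D : Set (Eucl d)) (J : Eucl d → Eucl d → ℂ) : Set (FinConfig d) :=
  {B | (∀ y ∈ B.pts, y ∈ interior D) ∧ 0 < detConfig J B}

/-- The measure `det J dμ^n` on `D^n`. -/
noncomputable def tupleMeasure (D : Set (Eucl d)) (μ : Measure (Eucl d)) (J : Eucl d → Eucl d → ℂ)
    (n : ℕ) : Measure (Fin n → Eucl d) :=
  (Measure.pi fun _ : Fin n => μ.restrict D).withDensity fun x => ENNReal.ofReal (detTuple J n x)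

variable {D : Set (Eucl d)} {μ : Measure (Eucl d)} {ρ : Eucl d → ℝ}
  {J : Eucl d → Eucl d → ℂ} {a : ℝ} {g : ∀ n, (Fin n → Eucl d) → ℝ} {r : Eucl d → ℝ}
  {Q : Measure (FinConfig d)} {n : ℕ}

theorem injective_of_mem_goodTuples {x : Fin n → Eucl d} (hx : x ∈ goodTuples D J n) :
    Function.Injective x :=
  by_contra fun h => hx.2.ne' (detTuple_eq_zero J h)

theorem ofTuple_mem_goodConfigs {x : Fin n → Eucl d} (hx : Function.Injective x) :
    FinConfig.ofTuple x ∈ goodConfigs D J ↔ x ∈ goodTuples D J n := by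
  simp only [goodConfigs, goodTuples, mem_ofPred_eq, detConfig_ofTuple J hx, mem_pts_ofTuple]
  simp

theorem IsRegularJanossy.measurableSet_goodTuples (h : IsRegularJanossy D μ ρ J a g r Q) (n : ℕ) :
    MeasurableSet (goodTuples D J n) := by
  have : goodTuples D J n = (⋂ i, (fun x : Fin n → Eucl d => x i) ⁻¹' interior D) ∩
      {x | 0 < detTuple J n x} := by
    ext x; simp [goodTuples]
  rw [this]
  exact (MeasurableSet.iInter fun i => measurable_pi_apply i isOpen_interior.measurableSet).inter
    (measurableSet_lt measurable_const (h.measurable n))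

theorem IsRegularJanossy.measurableSet_goodConfigs (h : IsRegularJanossy D μ ρ J a g r Q) :
    MeasurableSet (goodConfigs D J) := by
  have : Measurable fun B => B ∈ goodConfigs D J := by
    refine measurable_of_ofTuple fun n => ?_
    simp only [fun x : {x : Fin n → Eucl d // Function.Injective x} =>
      propext (ofTuple_mem_goodConfigs (D := D) (J := J) x.2)]
    exact (measurable_mem.2 (h.measurableSet_goodTuples n)).comp measurable_subtype_coe
  exact measurableSet_setOfPred.2 this

theorem IsRegularJanossy.ae_interior (h : IsRegularJanossy D μ ρ J a g r Q) (n : ℕ) :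
    ∀ᵐ x ∂Measure.pi (fun _ : Fin n => μ.restrict D), ∀ i, x i ∈ interior D := by
  have := h.finite
  have h1 : ∀ᵐ y ∂μ.restrict D, y ∈ interior D := by
    have h2 : ∀ᵐ y ∂(volume.restrict D : Measure (Eucl d)), y ∈ interior D := by
      have h3 : ∀ᵐ y ∂(volume.restrict D : Measure (Eucl d)), y ∈ (frontier D)ᶜ :=
        ae_restrict_of_ae (compl_mem_ae_iff.2 h.null_frontier)
      filter_upwards [ae_restrict_mem h.compact.measurableSet, h3] with y hy hy'
      by_contra hc
      exact hy' ⟨subset_closure hy, hc⟩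
    rw [h.restrict_eq]
    exact (withDensity_absolutelyContinuous _ _).ae_le h2
  exact ae_all_iff.2 fun i =>
    (Measure.quasiMeasurePreserving_eval (μ := fun _ : Fin n => μ.restrict D) i).ae h1

theorem IsRegularJanossy.ae_goodTuples (h : IsRegularJanossy D μ ρ J a g r Q) (n : ℕ) :
    ∀ᵐ x ∂tupleMeasure D μ J n, x ∈ goodTuples D J n := by
  rw [tupleMeasure, ae_withDensity_iff (h.measurable n).ennreal_ofReal]
  filter_upwards [h.ae_interior n] with x hx hpos
  exact ⟨hx, ENNReal.ofReal_pos.1 (pos_iff_ne_zero.2 hpos)⟩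

theorem IsRegularJanossy.isFiniteMeasure (h : IsRegularJanossy D μ ρ J a g r Q) (n : ℕ) :
    IsFiniteMeasure (tupleMeasure D μ J n) :=
  isFiniteMeasure_withDensity_ofReal (h.integrable_det n).2

theorem IsRegularJanossy.ae_goodConfigs_map (h : IsRegularJanossy D μ ρ J a g r Q) (n : ℕ) :
    ∀ᵐ B ∂(tupleMeasure D μ J n).map FinConfig.ofTuple, B ∈ goodConfigs D J := by
  refine (ae_map_iff (measurable_ofTuple n).aemeasurable h.measurableSet_goodConfigs).2 ?_
  filter_upwards [h.ae_goodTuples n] with x hx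
  exact (ofTuple_mem_goodConfigs (injective_of_mem_goodTuples hx)).2 hx

/-- Almost sure properties of the process may be checked on good tuples. -/
theorem IsRegularJanossy.ae_of_tuple (h : IsRegularJanossy D μ ρ J a g r Q)
    {p : FinConfig d → Prop} (hp : ∀ n, ∀ x ∈ goodTuples D J n, p (FinConfig.ofTuple x)) :
    ∀ᵐ B ∂Q, p B := by
  have h1 : ∀ᵐ B ∂Q, B ∈ goodConfigs D J := by
    rw [h.law, janossy, Measure.ae_sum_iff]
    exact fun n => Measure.ae_smul_measure (h.ae_goodConfigs_map n) _
  filter_upwards [h1] with B hB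
  obtain ⟨n, x, hx, rfl⟩ : ∃ (n : ℕ) (x : Fin n → Eucl d), Function.Injective x ∧
    B = FinConfig.ofTuple x := ⟨_, B.exists_eq_ofTuple⟩
  exact hp n x ((ofTuple_mem_goodConfigs hx).1 hB)

theorem IsRegularJanossy.measurable_indicator (h : IsRegularJanossy D μ ρ J a g r Q)
    {Φ : FinConfig d → ℝ} {φ : ∀ n, (Fin n → Eucl d) → ℝ} (hφ : ∀ n, Measurable (φ n))
    (he : ∀ n, ∀ x ∈ goodTuples D J n, Φ (FinConfig.ofTuple x) = φ n x) :
    Measurable ((goodConfigs D J).indicator Φ) := by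
  refine measurable_of_ofTuple fun n => ?_
  have e : ∀ x : {x : Fin n → Eucl d // Function.Injective x},
      (goodConfigs D J).indicator Φ (FinConfig.ofTuple x.1) =
        (goodTuples D J n).indicator (φ n) x.1 := by
    intro x
    by_cases hx : x.1 ∈ goodTuples D J n
    · rw [indicator_of_mem hx, indicator_of_mem ((ofTuple_mem_goodConfigs x.2).2 hx), he n _ hx]
    · rw [indicator_of_notMem hx, indicator_of_notMem fun hc => hx ((ofTuple_mem_goodConfigs x.2).1 hc)]
  simp only [e]
  exact ((hφ n).indicator (h.measurableSet_goodTuples n)).comp measurable_subtype_coe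

theorem IsRegularJanossy.aestronglyMeasurable (h : IsRegularJanossy D μ ρ J a g r Q)
    {Φ : FinConfig d → ℝ} {φ : ∀ n, (Fin n → Eucl d) → ℝ} (hφ : ∀ n, Measurable (φ n))
    (he : ∀ n, ∀ x ∈ goodTuples D J n, Φ (FinConfig.ofTuple x) = φ n x)
    {η : Measure (FinConfig d)} (hη : ∀ᵐ B ∂η, B ∈ goodConfigs D J) :
    AEStronglyMeasurable Φ η := by
  refine (h.measurable_indicator hφ he).aestronglyMeasurable.congr ?_
  filter_upwards [hη] with B hB using indicator_of_mem hB Φ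

theorem IsRegularJanossy.ae_goodConfigs (h : IsRegularJanossy D μ ρ J a g r Q) :
    ∀ᵐ B ∂Q, B ∈ goodConfigs D J :=
  h.ae_of_tuple fun _ _ hx => (ofTuple_mem_goodConfigs (injective_of_mem_goodTuples hx)).2 hx

/-- Expectations of functionals which are given on good tuples and vanish on configurations of more
than `N` points. -/
theorem IsRegularJanossy.integral_eq (h : IsRegularJanossy D μ ρ J a g r Q)
    {Φ : FinConfig d → ℝ} {φ : ∀ n, (Fin n → Eucl d) → ℝ} (hφ : ∀ n, Measurable (φ n))
    (he : ∀ n, ∀ x ∈ goodTuples D J n, Φ (FinConfig.ofTuple x) = φ n x) {N : ℕ}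
    (hN : ∀ n, N < n → ∀ x, φ n x = 0) (hi : ∀ n, Integrable (φ n) (tupleMeasure D μ J n)) :
    Integrable Φ Q ∧ ∫ B, Φ B ∂Q =
      ∑ n ∈ Finset.range (N + 1), a / n.factorial * ∫ x, φ n x ∂tupleMeasure D μ J n := by
  have hm : ∀ n, AEStronglyMeasurable Φ ((tupleMeasure D μ J n).map FinConfig.ofTuple) := fun n =>
    h.aestronglyMeasurable hφ he (h.ae_goodConfigs_map n)
  have hc : ∀ n, (fun x => Φ (FinConfig.ofTuple x)) =ᵐ[tupleMeasure D μ J n] φ n := fun n => by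
    filter_upwards [h.ae_goodTuples n] with x hx using he n x hx
  have hi' : ∀ n, Integrable Φ ((tupleMeasure D μ J n).map FinConfig.ofTuple) := fun n =>
    (integrable_map_measure (hm n) (measurable_ofTuple n).aemeasurable).2 ((hi n).congr (hc n).symm)
  have hnn : ∀ n : ℕ, 0 ≤ a / n.factorial := fun n => div_nonneg h.pos.le (Nat.cast_nonneg _)
  have hint : ∀ n, ∫ B, Φ B ∂(ENNReal.ofReal (a / n.factorial) •
      (tupleMeasure D μ J n).map FinConfig.ofTuple) =
      a / n.factorial * ∫ x, φ n x ∂tupleMeasure D μ J n := by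
    intro n
    rw [integral_smul_measure, integral_map (measurable_ofTuple n).aemeasurable (hm n),
      integral_congr_ae (hc n), ENNReal.toReal_ofReal (hnn n), smul_eq_mul]
  have hI : Integrable Φ Q := by
    rw [h.law]
    refine integrable_sum_measure (fun n => (hi' n).smul_measure ENNReal.ofReal_ne_top)
      (summable_of_ne_finset_zero (s := Finset.range (N + 1)) fun n hn => ?_)
    have hn' : N < n := by simpa using hn
    have : (fun x => ‖Φ (FinConfig.ofTuple x)‖) =ᵐ[tupleMeasure D μ J n] 0 := by
      filter_upwards [hc n] with x hx
      rw [hx, hN n hn', norm_zero]; rfl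
    change ∫ B, ‖Φ B‖ ∂(ENNReal.ofReal (a / n.factorial) •
      (tupleMeasure D μ J n).map FinConfig.ofTuple) = 0
    rw [integral_smul_measure, integral_map (measurable_ofTuple n).aemeasurable (hm n).norm,
      integral_congr_ae this]
    simp
  refine ⟨hI, ?_⟩
  have hI' := hI
  rw [h.law] at hI' ⊢
  rw [janossy, integral_sum_measure hI', tsum_eq_sum (s := Finset.range (N + 1))]
  · exact Finset.sum_congr rfl fun n _ => hint n
  · intro n hn
    have hn' : N < n := by simpa using hn
    refine (hint n).trans ?_
    simp [hN n hn']

/-- The density of `det J dμ^n` with respect to the Lebesgue measure. -/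
noncomputable def tupleDensity (g : ∀ n, (Fin n → Eucl d) → ℝ) (r : Eucl d → ℝ) (n : ℕ)
    (x : Fin n → Eucl d) : ℝ := g n x * ∏ i, r (x i)

theorem IsRegularJanossy.contDiff_tupleDensity (h : IsRegularJanossy D μ ρ J a g r Q) (n : ℕ) :
    ContDiff ℝ 1 (tupleDensity g r n) :=
  (h.contDiff_det n).mul (contDiff_prod fun i _ => h.contDiff_density.comp (contDiff_apply _ _ i))

theorem pi_eq_withDensity (hD : IsCompact D) (hr : Continuous r) (hpos : ∀ x ∈ D, 0 < r x)
    {ν : Measure (Eucl d)} [hfin : IsFiniteMeasure ν]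
    (hν : ν = (volume.restrict D).withDensity fun x => ENNReal.ofReal (r x)) (n : ℕ) :
    (Measure.pi fun _ : Fin n => ν) = (Measure.pi fun _ : Fin n => volume.restrict D).withDensity
      fun x => ENNReal.ofReal (∏ i, r (x i)) := by
  have : IsFiniteMeasure (volume.restrict D : Measure (Eucl d)) :=
    isFiniteMeasure_restrict.2 hD.measure_lt_top.ne
  subst hν
  rw [pi_withDensity hr.measurable.ennreal_ofReal]
  refine withDensity_congr_ae ?_
  rw [pi_restrict_eq]
  filter_upwards [ae_restrict_mem (MeasurableSet.univ_pi fun _ => hD.measurableSet)] with x hx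
  exact (ENNReal.ofReal_prod_of_nonneg fun i _ => (hpos _ (hx i trivial)).le).symm

theorem IsRegularJanossy.pi_eq (h : IsRegularJanossy D μ ρ J a g r Q) (n : ℕ) :
    (Measure.pi fun _ : Fin n => μ.restrict D) =
      (Measure.pi fun _ : Fin n => volume.restrict D).withDensity
        fun x => ENNReal.ofReal (∏ i, r (x i)) :=
  have := h.finite
  pi_eq_withDensity h.compact h.contDiff_density.continuous h.density_pos h.restrict_eq n

theorem IsRegularJanossy.integral_tupleMeasure (h : IsRegularJanossy D μ ρ J a g r Q) (n : ℕ)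
    (φ : (Fin n → Eucl d) → ℝ) : ∫ x, φ x ∂tupleMeasure D μ J n =
      ∫ x, φ x * tupleDensity g r n x ∂Measure.pi (fun _ : Fin n => volume.restrict D) := by
  have hm : Measurable fun x : Fin n → Eucl d => ENNReal.ofReal (∏ i, r (x i)) := by
    refine Measurable.ennreal_ofReal (Finset.measurable_prod _ fun i _ => ?_)
    exact h.contDiff_density.continuous.measurable.comp (measurable_pi_apply i)
  rw [tupleMeasure, integral_withDensity_eq_integral_toReal_smul
    (h.measurable n).ennreal_ofReal (Eventually.of_forall fun _ => ENNReal.ofReal_lt_top)]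
  have hint := h.ae_interior n
  rw [h.pi_eq] at hint ⊢
  rw [ae_withDensity_iff hm] at hint
  rw [integral_withDensity_eq_integral_toReal_smul hm
    (Eventually.of_forall fun _ => ENNReal.ofReal_lt_top)]
  refine integral_congr_ae ?_
  have hD : ∀ᵐ x ∂(Measure.pi fun _ : Fin n => volume.restrict D), ∀ i, x i ∈ D := by
    rw [pi_restrict_eq]
    filter_upwards [ae_restrict_mem (MeasurableSet.univ_pi fun _ => h.compact.measurableSet)]
      with x hx i using hx i trivial
  filter_upwards [hint, hD] with x hx hxD
  have hp : 0 < ∏ i, r (x i) := Finset.prod_pos fun i _ => h.density_pos _ (hxD i)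
  have hx' := hx (ENNReal.ofReal_pos.2 hp).ne'
  rw [ENNReal.toReal_ofReal hp.le, h.det_eq n x hxD, ENNReal.toReal_ofReal (h.det_nonneg n x hx'),
    tupleDensity]
  simp only [smul_eq_mul]
  ring

end

/-! ### The operator and the energy in terms of tuples -/

section

variable {d : ℕ}

/-- The operator `ℋ` on functions of `n` points, with `r` in place of the density `ρ` and `G` in place
of `det J`. -/
noncomputable def opTuple {n : ℕ} (r : Eucl d → ℝ) (G f : (Fin n → Eucl d) → ℝ)
    (x : Fin n → Eucl d) : ℝ :=
  ∑ i, (-⟪(r (x i))⁻¹ • gradient r (x i), tupleGrad f i x⟫_ℝ - tupleLap f i x -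
    (G x)⁻¹ * ⟪tupleGrad G i x, tupleGrad f i x⟫_ℝ)

/-- The energy density of functions of `n` points. -/
noncomputable def energyTuple {n : ℕ} (f f' : (Fin n → Eucl d) → ℝ) (x : Fin n → Eucl d) : ℝ :=
  ∑ i, ⟪tupleGrad f i x, tupleGrad f' i x⟫_ℝ

variable {D : Set (Eucl d)} {μ : Measure (Eucl d)} {ρ : Eucl d → ℝ}
  {J : Eucl d → Eucl d → ℂ} {a : ℝ} {g : ∀ n, (Fin n → Eucl d) → ℝ} {r : Eucl d → ℝ}
  {Q : Measure (FinConfig d)} {n : ℕ}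

theorem energyDensity_ofTuple {F G : FinConfig d → ℝ} {f f' : (Fin n → Eucl d) → ℝ}
    (hF : ∀ x, Function.Injective x → F (FinConfig.ofTuple x) = f x)
    (hG : ∀ x, Function.Injective x → G (FinConfig.ofTuple x) = f' x)
    {x : Fin n → Eucl d} (hx : Function.Injective x) :
    energyDensity F G (FinConfig.ofTuple x) = energyTuple f f' x := by
  rw [energyDensity, sum_pts_ofTuple hx, energyTuple]
  simp only [configGrad_ofTuple hF hx, configGrad_ofTuple hG hx]

theorem IsRegularJanossy.eventuallyEq_det (h : IsRegularJanossy D μ ρ J a g r Q)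
    {x : Fin n → Eucl d} (hx : ∀ i, x i ∈ interior D) : detTuple J n =ᶠ[𝓝 x] g n := by
  have ho : IsOpen (Set.pi univ fun _ : Fin n => interior D) :=
    isOpen_set_pi finite_univ fun _ _ => isOpen_interior
  filter_upwards [ho.mem_nhds fun i _ => hx i] with y hy
  exact h.det_eq n y fun i => interior_subset (hy i trivial)

/-- On good tuples `ρ` and `det J` agree near the points with their `C¹` extensions, so that their
derivatives may be computed from these. -/
theorem IsRegularJanossy.lapH_ofTuple (h : IsRegularJanossy D μ ρ J a g r Q)
    {F : FinConfig d → ℝ} {f : (Fin n → Eucl d) → ℝ}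
    (hF : ∀ x, Function.Injective x → F (FinConfig.ofTuple x) = f x)
    {x : Fin n → Eucl d} (hx : x ∈ goodTuples D J n) :
    lapH ρ J F (FinConfig.ofTuple x) = opTuple r (g n) f x := by
  have hinj := injective_of_mem_goodTuples hx
  rw [lapH, sum_pts_ofTuple hinj, opTuple]
  refine Finset.sum_congr rfl fun i _ => ?_
  have hρ : ρ =ᶠ[𝓝 (x i)] r := by
    filter_upwards [isOpen_interior.mem_nhds (hx.1 i)] with y hy
      using h.density_eq (interior_subset hy)
  have e1 : beta ρ (x i) = (r (x i))⁻¹ • gradient r (x i) := by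
    rw [beta, gradient, gradient, hρ.fderiv_eq, hρ.eq_of_nhds]
  have hd := h.eventuallyEq_det hx.1
  rw [e1, configGrad_ofTuple hF hinj, configLaplacian_ofTuple hF hinj, gradU,
    configGrad_ofTuple (fun x hx => detConfig_ofTuple J hx) hinj, detConfig_ofTuple J hinj,
    tupleGrad_congr hd, hd.eq_of_nhds, inner_neg_left, real_inner_smul_left,
    real_inner_smul_left]
  ring

theorem continuous_energyTuple {f f' : (Fin n → Eucl d) → ℝ} (hf : ContDiff ℝ 1 f)
    (hf' : ContDiff ℝ 1 f') : Continuous (energyTuple f f') :=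
  continuous_finsetSum _ fun i _ => (continuous_tupleGrad hf i).inner (continuous_tupleGrad hf' i)

theorem measurable_opTuple {G f : (Fin n → Eucl d) → ℝ} (hr : ContDiff ℝ 1 r)
    (hG : ContDiff ℝ 1 G) (hf : ContDiff ℝ 2 f) : Measurable (opTuple r G f) := by
  have hf1 : ContDiff ℝ 1 f := hf.of_le (by norm_num)
  refine Finset.measurable_sum _ fun i _ => ?_
  simp only [real_inner_smul_left]
  have hxi : Continuous fun x : Fin n → Eucl d => x i := continuous_apply i
  exact (((hr.continuous.comp hxi).measurable.inv.mul (((continuous_gradient hr).comp hxi).inner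
    (continuous_tupleGrad hf1 i)).measurable).neg.sub (continuous_tupleLap hf i).measurable).sub
    (hG.continuous.measurable.inv.mul
      ((continuous_tupleGrad hG i).inner (continuous_tupleGrad hf1 i)).measurable)

theorem IsRegularJanossy.ae_mem (h : IsRegularJanossy D μ ρ J a g r Q) (n : ℕ) :
    ∀ᵐ x ∂tupleMeasure D μ J n, x ∈ Set.pi univ fun _ : Fin n => D := by
  filter_upwards [h.ae_goodTuples n] with x hx i _ using interior_subset (hx.1 i)

theorem IsRegularJanossy.ae_norm_le (h : IsRegularJanossy D μ ρ J a g r Q)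
    {f : (Fin n → Eucl d) → ℝ} (hf : ContinuousOn f (Set.pi univ fun _ => D)) :
    ∃ C, ∀ᵐ x ∂tupleMeasure D μ J n, ‖f x‖ ≤ C := by
  obtain ⟨C, hC⟩ := (isCompact_univ_pi fun _ : Fin n => h.compact).exists_bound_of_continuousOn hf
  exact ⟨C, by filter_upwards [h.ae_mem n] with x hx using hC x hx⟩

theorem IsRegularJanossy.memLp_of_continuousOn (h : IsRegularJanossy D μ ρ J a g r Q)
    {f : (Fin n → Eucl d) → ℝ} (hfm : Measurable f)
    (hf : ContinuousOn f (Set.pi univ fun _ => D)) (p : ℝ≥0∞) : MemLp f p (tupleMeasure D μ J n) := by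
  have := h.isFiniteMeasure n
  obtain ⟨C, hC⟩ := h.ae_norm_le hf
  exact MemLp.of_bound hfm.aestronglyMeasurable C hC

/-- The integrability condition on the logarithmic derivatives of `det J`. -/
theorem IsRegularJanossy.memLp_logDeriv (h : IsRegularJanossy D μ ρ J a g r Q) (i : Fin n)
    (k : Fin d) : MemLp (fun x => (g n x)⁻¹ * pderivTuple (g n) i k x) 2 (tupleMeasure D μ J n) := by
  have hσ := h.sigmaFinite
  have hfm : Measurable fun x => (g n x)⁻¹ * pderivTuple (g n) i k x :=
    (h.contDiff_det n).continuous.measurable.inv.mul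
      (contDiff_pderivTuple (r := 0) (h.contDiff_det n) (by norm_num) i k).continuous.measurable
  rw [memLp_two_iff_integrable_sq hfm.aestronglyMeasurable]
  refine ⟨(hfm.pow_const 2).aestronglyMeasurable, ?_⟩
  rw [hasFiniteIntegral_iff_ofReal (Eventually.of_forall fun x => sq_nonneg _), tupleMeasure,
    lintegral_withDensity_eq_lintegral_mul _ (h.measurable n).ennreal_ofReal
      (hfm.pow_const 2).ennreal_ofReal]
  have hn : 1 ≤ n := Nat.one_le_of_lt i.pos
  refine lt_of_le_of_lt ?_ (h.integrability n hn i i k k)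
  have hs : MeasurableSet {x : Fin n → Eucl d | 0 < detTuple J n x} :=
    measurableSet_lt measurable_const (h.measurable n)
  have hset : {x : Fin n → Eucl d | (∀ l, x l ∈ D) ∧ 0 < detTuple J n x} =
      {x | 0 < detTuple J n x} ∩ Set.pi univ fun _ => D := by
    ext x
    simp only [mem_ofPred_eq, mem_inter_iff, mem_univ_pi]
    exact and_comm
  rw [hset, ← Measure.restrict_restrict hs, Measure.restrict_pi_pi, ← lintegral_indicator hs]
  refine lintegral_mono_ae ?_
  filter_upwards [h.ae_interior n] with x hx
  simp only [Pi.mul_apply]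
  by_cases hpos : 0 < detTuple J n x
  · rw [indicator_of_mem (show x ∈ {x : Fin n → Eucl d | 0 < detTuple J n x} from hpos),
      ← ENNReal.ofReal_mul hpos.le]
    refine ENNReal.ofReal_le_ofReal (le_trans (le_of_eq ?_) (le_abs_self _))
    have hd := h.eventuallyEq_det hx
    have e : pderivTuple (detTuple J n) i k x = pderivTuple (g n) i k x := by
      rw [pderivTuple, pderivTuple, hd.fderiv_eq]
    have e2 := hd.eq_of_nhds
    rw [e2] at hpos ⊢
    rw [e]
    field_simp
  · rw [ENNReal.ofReal_of_nonpos (not_lt.1 hpos), zero_mul]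
    exact zero_le

theorem IsRegularJanossy.memLp_opTuple (h : IsRegularJanossy D μ ρ J a g r Q)
    {f : (Fin n → Eucl d) → ℝ} (hf : ContDiff ℝ 2 f) :
    MemLp (opTuple r (g n) f) 2 (tupleMeasure D μ J n) := by
  have hf1 : ContDiff ℝ 1 f := hf.of_le (by norm_num)
  have hr := h.contDiff_density
  have hG := h.contDiff_det n
  refine memLp_finsetSum _ fun i _ => ?_
  have hxi : Continuous fun x : Fin n → Eucl d => x i := continuous_apply i
  have c1 : Continuous fun x : Fin n → Eucl d => ⟪gradient r (x i), tupleGrad f i x⟫_ℝ :=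
    ((continuous_gradient hr).comp hxi).inner (continuous_tupleGrad hf1 i)
  have h1 : MemLp (fun x => (r (x i))⁻¹ * ⟪gradient r (x i), tupleGrad f i x⟫_ℝ) 2
      (tupleMeasure D μ J n) := by
    refine h.memLp_of_continuousOn ((hr.continuous.comp hxi).measurable.inv.mul c1.measurable) ?_ 2
    refine ContinuousOn.mul (ContinuousOn.inv₀ (hr.continuous.comp hxi).continuousOn
      fun x hx => (h.density_pos _ (hx i trivial)).ne') c1.continuousOn
  have c2 := continuous_tupleLap hf i
  have h2 : MemLp (tupleLap f i) 2 (tupleMeasure D μ J n) :=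
    h.memLp_of_continuousOn c2.measurable c2.continuousOn 2
  have h3 : MemLp (fun x => (g n x)⁻¹ * ⟪tupleGrad (g n) i x, tupleGrad f i x⟫_ℝ) 2
      (tupleMeasure D μ J n) := by
    have e : (fun x => (g n x)⁻¹ * ⟪tupleGrad (g n) i x, tupleGrad f i x⟫_ℝ) =
        fun x => ∑ k, ((g n x)⁻¹ * pderivTuple (g n) i k x) * pderivTuple f i k x := by
      funext x
      rw [PiLp.inner_apply, Finset.mul_sum]
      refine Finset.sum_congr rfl fun k _ => ?_
      rw [tupleGrad_apply i (hG.differentiable one_ne_zero x),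
        tupleGrad_apply i (hf1.differentiable one_ne_zero x), RCLike.inner_apply]
      simp only [conj_trivial]
      ring
    rw [e]
    refine memLp_finsetSum _ fun k _ => ?_
    have c3 : Continuous (pderivTuple f i k) :=
      (contDiff_pderivTuple (r := 0) hf1 (by norm_num) i k).continuous
    obtain ⟨C, hC⟩ := h.ae_norm_le c3.continuousOn
    refine (h.memLp_logDeriv i k).of_le_mul (c := C)
      ((h.memLp_logDeriv i k).1.mul c3.aestronglyMeasurable) ?_
    filter_upwards [hC] with x hx
    rw [norm_mul, mul_comm]
    exact mul_le_mul_of_nonneg_right hx (norm_nonneg _)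
  simp only [real_inner_smul_left]
  exact (h1.neg.sub h2).sub h3

theorem tupleGrad_prod (hr : ContDiff ℝ 1 r) {x : Fin n → Eucl d} (i : Fin n) (hx : r (x i) ≠ 0) :
    tupleGrad (fun x => ∏ j, r (x j)) i x = (∏ j, r (x j)) • (r (x i))⁻¹ • gradient r (x i) := by
  have e : (fun y => ∏ j, r (Function.update x i y j)) =
      fun y => (∏ j ∈ Finset.univ.erase i, r (x j)) * r y := by
    funext y
    rw [← Finset.prod_erase_mul _ _ (Finset.mem_univ i), Function.update_self]
    congr 1
    exact Finset.prod_congr rfl fun j hj => by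
      rw [Function.update_of_ne (Finset.ne_of_mem_erase hj)]
  rw [tupleGrad, e, gradient, fderiv_const_mul (hr.differentiable one_ne_zero _), map_smul,
    ← Finset.prod_erase_mul _ _ (Finset.mem_univ i), smul_smul, mul_assoc, mul_inv_cancel₀ hx,
    mul_one]
  rfl

/-- At the interior zeros of `det J` its gradient vanishes, so that the density multiplied by `ℋ f`
is given by the same formula at all tuples of the interior. -/
theorem IsRegularJanossy.opTuple_mul_tupleDensity (h : IsRegularJanossy D μ ρ J a g r Q)
    (f : (Fin n → Eucl d) → ℝ) {x : Fin n → Eucl d} (hx : ∀ i, x i ∈ interior D) :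
    opTuple r (g n) f x * tupleDensity g r n x = ∑ i, (tupleDensity g r n x * (-tupleLap f i x) -
      ⟪tupleGrad (tupleDensity g r n) i x, tupleGrad f i x⟫_ℝ) := by
  have hr := h.contDiff_density
  have hG := (h.contDiff_det n).differentiable one_ne_zero x
  have hR : DifferentiableAt ℝ (fun x : Fin n → Eucl d => ∏ j, r (x j)) x :=
    ((contDiff_prod fun i _ => hr.comp (contDiff_apply _ _ i)).differentiable
      (one_ne_zero : (1 : WithTop ℕ∞) ≠ 0)) x
  have hgrad : ∀ i, tupleGrad (tupleDensity g r n) i x =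
      g n x • (∏ j, r (x j)) • (r (x i))⁻¹ • gradient r (x i) +
        (∏ j, r (x j)) • tupleGrad (g n) i x := by
    intro i
    have := tupleGrad_mul i hG hR
    rw [tupleGrad_prod hr i (h.density_pos _ (interior_subset (hx i))).ne'] at this
    exact this
  rw [opTuple, Finset.sum_mul]
  refine Finset.sum_congr rfl fun i _ => ?_
  rw [hgrad, inner_add_left]
  simp only [real_inner_smul_left, tupleDensity]
  rcases (h.det_nonneg n x hx).eq_or_lt with h0 | hpos
  · -- `g n` is non-negative near `x`, so that a zero is a local minimum.
    have hmin : IsLocalMin (g n) x := by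
      have ho : IsOpen (Set.pi univ fun _ : Fin n => interior D) :=
        isOpen_set_pi finite_univ fun _ _ => isOpen_interior
      filter_upwards [ho.mem_nhds fun i _ => hx i] with y hy
      rw [← h0]
      exact h.det_nonneg n y fun i => hy i trivial
    have hz : tupleGrad (g n) i x = 0 := by
      refine ext_inner_right ℝ fun v => ?_
      rw [inner_tupleGrad i hG, hmin.fderiv_eq_zero]
      simp
    rw [hz, ← h0]
    simp
  · field_simp
    ring

/-- The integration by parts formula for functions of `n` points. -/
theorem IsRegularJanossy.integral_opTuple_mul (h : IsRegularJanossy D μ ρ J a g r Q)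
    {f f' : (Fin n → Eucl d) → ℝ} (hf : ContDiff ℝ 2 f) (hf' : ContDiff ℝ 1 f')
    (hparts : ∀ (i : Fin n) (x : Fin n → Eucl d) (q : Eucl d → ℝ), ContDiff ℝ 1 q →
      ∫ y in D, q y * (-Laplacian.laplacian (fun y => f (Function.update x i y)) y) =
        ∫ y in D, ⟪gradient (fun y => f (Function.update x i y)) y, gradient q y⟫_ℝ) :
    ∫ x, opTuple r (g n) f x * f' x ∂tupleMeasure D μ J n =
      ∫ x, energyTuple f f' x ∂tupleMeasure D μ J n := by
  have hf1 : ContDiff ℝ 1 f := hf.of_le (by norm_num)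
  have hp := h.contDiff_tupleDensity n
  rw [h.integral_tupleMeasure, h.integral_tupleMeasure]
  have hint : ∀ᵐ x ∂(Measure.pi fun _ : Fin n => volume.restrict D), ∀ i, x i ∈ interior D := by
    have h1 := h.ae_interior n
    rw [h.pi_eq, ae_withDensity_iff] at h1
    · rw [pi_restrict_eq] at h1 ⊢
      filter_upwards [h1, ae_restrict_mem
        (MeasurableSet.univ_pi fun _ => h.compact.measurableSet)] with x hx hxD
      exact hx (ENNReal.ofReal_pos.2 (Finset.prod_pos fun i _ => h.density_pos _ (hxD i trivial))).ne'
    · refine Measurable.ennreal_ofReal (Finset.measurable_prod _ fun i _ => ?_)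
      exact h.contDiff_density.continuous.measurable.comp (measurable_pi_apply i)
  have c1 : ∀ i, Continuous fun x => (f' x * tupleDensity g r n x) * (-tupleLap f i x) := fun i =>
    (hf'.continuous.mul hp.continuous).mul (continuous_tupleLap hf i).neg
  have c2 : ∀ i, Continuous fun x => f' x *
      ⟪tupleGrad (tupleDensity g r n) i x, tupleGrad f i x⟫_ℝ := fun i =>
    hf'.continuous.mul ((continuous_tupleGrad hp i).inner (continuous_tupleGrad hf1 i))
  have c3 : ∀ i, Continuous fun x =>
      ⟪tupleGrad f i x, tupleGrad (fun x => f' x * tupleDensity g r n x) i x⟫_ℝ := fun i =>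
    (continuous_tupleGrad hf1 i).inner (continuous_tupleGrad (hf'.mul hp) i)
  have i1 := fun i => integrable_tuple_of_continuous h.compact (c1 i)
  have i2 := fun i => integrable_tuple_of_continuous h.compact (c2 i)
  have i3 := fun i => integrable_tuple_of_continuous h.compact (c3 i)
  have i12 : ∀ i, Integrable (fun x => (f' x * tupleDensity g r n x) * (-tupleLap f i x) -
      f' x * ⟪tupleGrad (tupleDensity g r n) i x, tupleGrad f i x⟫_ℝ)
      (Measure.pi fun _ : Fin n => volume.restrict D) := fun i => (i1 i).sub (i2 i)
  have i32 : ∀ i, Integrable (fun x =>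
      ⟪tupleGrad f i x, tupleGrad (fun x => f' x * tupleDensity g r n x) i x⟫_ℝ -
        f' x * ⟪tupleGrad (tupleDensity g r n) i x, tupleGrad f i x⟫_ℝ)
      (Measure.pi fun _ : Fin n => volume.restrict D) := fun i => (i3 i).sub (i2 i)
  calc _ = ∫ x, ∑ i, ((f' x * tupleDensity g r n x) * (-tupleLap f i x) -
          f' x * ⟪tupleGrad (tupleDensity g r n) i x, tupleGrad f i x⟫_ℝ)
          ∂(Measure.pi fun _ : Fin n => volume.restrict D) := by
        refine integral_congr_ae ?_
        filter_upwards [hint] with x hx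
        rw [mul_right_comm, h.opTuple_mul_tupleDensity f hx, Finset.sum_mul]
        refine Finset.sum_congr rfl fun i _ => ?_
        ring
    _ = ∫ x, ∑ i, (⟪tupleGrad f i x, tupleGrad (fun x => f' x * tupleDensity g r n x) i x⟫_ℝ -
          f' x * ⟪tupleGrad (tupleDensity g r n) i x, tupleGrad f i x⟫_ℝ)
          ∂(Measure.pi fun _ : Fin n => volume.restrict D) := by
        rw [integral_finsetSum _ fun i _ => i12 i, integral_finsetSum _ fun i _ => i32 i]
        refine Finset.sum_congr rfl fun i _ => ?_
        rw [integral_sub (i1 i) (i2 i), integral_sub (i3 i) (i2 i),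
          integral_tuple_by_parts h.compact hf (hf'.mul hp) i (hparts i)]
    _ = _ := by
        refine integral_congr_ae (Eventually.of_forall fun x => ?_)
        simp only [energyTuple]
        rw [Finset.sum_mul]
        refine Finset.sum_congr rfl fun i _ => ?_
        rw [tupleGrad_mul i (hf'.differentiable one_ne_zero x) (hp.differentiable one_ne_zero x),
          inner_add_right, real_inner_smul_right, real_inner_smul_right,
          real_inner_comm (tupleGrad f i x) (tupleGrad (tupleDensity g r n) i x)]
        ring

end

/-! ### Green's formula for the test functionals -/

section

variable {d : ℕ}

variable {D : Set (Eucl d)} {μ : Measure (Eucl d)} {ρ : Eucl d → ℝ}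
  {J : Eucl d → Eucl d → ℂ} {a : ℝ} {g : ∀ n, (Fin n → Eucl d) → ℝ} {r : Eucl d → ℝ}
  {Q : Measure (FinConfig d)}

theorem IsRegularJanossy.memLp_of_tuple (h : IsRegularJanossy D μ ρ J a g r Q)
    {Φ : FinConfig d → ℝ} {φ : ∀ n, (Fin n → Eucl d) → ℝ} (hφ : ∀ n, Measurable (φ n))
    (he : ∀ n, ∀ x ∈ goodTuples D J n, Φ (FinConfig.ofTuple x) = φ n x) {N : ℕ}
    (hN : ∀ n, N < n → ∀ x, φ n x = 0) (hi : ∀ n, MemLp (φ n) 2 (tupleMeasure D μ J n)) :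
    MemLp Φ 2 Q := by
  rw [memLp_two_iff_integrable_sq (h.aestronglyMeasurable hφ he h.ae_goodConfigs)]
  exact (h.integral_eq (φ := fun n x => φ n x ^ 2) (fun n => (hφ n).pow_const 2)
    (fun n x hx => by rw [he n x hx]) (N := N) (fun n hn x => by simp [hN n hn x])
    fun n => (hi n).integrable_sq).1

theorem tupleGrad_zero {n : ℕ} (i : Fin n) (x : Fin n → Eucl d) :
    tupleGrad (fun _ => 0) i x = 0 := by simp [tupleGrad, gradient]

theorem tupleLap_zero {n : ℕ} (i : Fin n) (x : Fin n → Eucl d) :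
    tupleLap (fun _ => 0) i x = 0 := by
  rw [tupleLap, laplacian_eq_sum contDiff_const]
  simp

/-- A test functional is given by smooth functions of `n` points, which vanish for large `n` and
satisfy the integration by parts formula. -/
theorem exists_tuple_of_mem_testFunctionals (hD : IsCompact D) {F : FinConfig d → ℝ}
    (hF : F ∈ testFunctionals D) : ∃ (N : ℕ) (f : ∀ n, (Fin n → Eucl d) → ℝ),
      (∀ n x, Function.Injective x → F (FinConfig.ofTuple x) = f n x) ∧
      (∀ n, ContDiff ℝ 2 (f n)) ∧ (∀ n, N < n → f n = fun _ => 0) ∧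
      ∀ n (i : Fin n) (x : Fin n → Eucl d) (q : Eucl d → ℝ), ContDiff ℝ 1 q →
      ∫ y in D, q y * (-Laplacian.laplacian (fun y => f n (Function.update x i y)) y) =
        ∫ y in D, ⟪gradient (fun y => f n (Function.update x i y)) y, gradient q y⟫_ℝ := by
  obtain ⟨M, N, f, φ, -, -, hf, hφ, rfl⟩ := hF
  refine ⟨N, cylTuple f φ N, fun n => cylinder_ofTuple f φ N,
    fun n => (contDiff_cylTuple hf.1 (fun m => (hφ m).1) N n).of_le (by norm_cast),
    fun n hn => ?_, fun n i => cylTuple_by_parts hD hf.1 hφ N i⟩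
  funext x
  rw [cylTuple, if_neg (not_le.2 hn)]

theorem IsRegularJanossy.memLp_testFunctional (h : IsRegularJanossy D μ ρ J a g r Q)
    {F : FinConfig d → ℝ} (hF : F ∈ testFunctionals D) : MemLp F 2 Q := by
  obtain ⟨N, f, he, hf, hN, -⟩ := exists_tuple_of_mem_testFunctionals h.compact hF
  exact h.memLp_of_tuple (fun n => (hf n).continuous.measurable)
    (fun n x hx => he n x (injective_of_mem_goodTuples hx)) (fun n hn x => by rw [hN n hn])
    fun n => h.memLp_of_continuousOn (hf n).continuous.measurable (hf n).continuous.continuousOn 2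

theorem IsRegularJanossy.memLp_lapH (h : IsRegularJanossy D μ ρ J a g r Q)
    {F : FinConfig d → ℝ} (hF : F ∈ testFunctionals D) : MemLp (lapH ρ J F) 2 Q := by
  obtain ⟨N, f, he, hf, hN, -⟩ := exists_tuple_of_mem_testFunctionals h.compact hF
  exact h.memLp_of_tuple
    (fun n => measurable_opTuple h.contDiff_density (h.contDiff_det n) (hf n))
    (fun n x hx => h.lapH_ofTuple (he n) hx)
    (fun n hn x => by rw [hN n hn]; simp [opTuple, tupleGrad_zero, tupleLap_zero])
    fun n => h.memLp_opTuple (hf n)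

/-- Green's formula `E[ℋF G] = ℰ(F, G)`, summed over the number of points. -/
theorem IsRegularJanossy.integrable_energyDensity_and (h : IsRegularJanossy D μ ρ J a g r Q)
    {F G : FinConfig d → ℝ} (hF : F ∈ testFunctionals D) (hG : G ∈ testFunctionals D) :
    Integrable (energyDensity F G) Q ∧
      ∫ B, lapH ρ J F B * G B ∂Q = ∫ B, energyDensity F G B ∂Q := by
  obtain ⟨N, f, he, hf, hN, hparts⟩ := exists_tuple_of_mem_testFunctionals h.compact hF
  obtain ⟨N', f', he', hf', -, -⟩ := exists_tuple_of_mem_testFunctionals h.compact hG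
  have hf1 : ∀ n, ContDiff ℝ 1 (f n) := fun n => (hf n).of_le (by norm_num)
  have hf1' : ∀ n, ContDiff ℝ 1 (f' n) := fun n => (hf' n).of_le (by norm_num)
  have hce := fun n => continuous_energyTuple (hf1 n) (hf1' n)
  have h1 := h.integral_eq (Φ := energyDensity F G) (fun n => (hce n).measurable)
    (fun n x hx => energyDensity_ofTuple (he n) (he' n) (injective_of_mem_goodTuples hx))
    (N := N) (fun n hn x => by rw [hN n hn]; simp [energyTuple, tupleGrad_zero])
    fun n => (memLp_one_iff_integrable.1
      (h.memLp_of_continuousOn (hce n).measurable (hce n).continuousOn 1))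
  have h2 := h.integral_eq (Φ := fun B => lapH ρ J F B * G B)
    (φ := fun n x => opTuple r (g n) (f n) x * f' n x)
    (fun n => (measurable_opTuple h.contDiff_density (h.contDiff_det n) (hf n)).mul
      (hf' n).continuous.measurable)
    (fun n x hx => by
      rw [h.lapH_ofTuple (he n) hx, he' n x (injective_of_mem_goodTuples hx)])
    (N := N) (fun n hn x => by rw [hN n hn]; simp [opTuple, tupleGrad_zero, tupleLap_zero])
    fun n => (h.memLp_opTuple (hf n)).integrable_mul (h.memLp_of_continuousOn
      (hf' n).continuous.measurable (hf' n).continuous.continuousOn 2)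
  refine ⟨h1.1, ?_⟩
  rw [h1.2, h2.2]
  exact Finset.sum_congr rfl fun n _ => by
    rw [h.integral_opTuple_mul (hf n) (hf1' n) (hparts n)]

end

/-! ### Smooth functions with bounded derivatives, and the space of test functionals -/

section

/-- Smooth functions which are bounded together with all their derivatives, on any normed space; on
`Fin M → ℝ` this is `IsCbInfty` by definition. -/
def BddSmooth {E : Type*} [NormedAddCommGroup E] [NormedSpace ℝ E] (f : E → ℝ) : Prop :=
  ContDiff ℝ ((⊤ : ℕ∞) : WithTop ℕ∞) f ∧ ∀ n : ℕ, ∃ C : ℝ, ∀ x, ‖iteratedFDeriv ℝ n f x‖ ≤ C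

namespace BddSmooth

variable {E E' : Type*} [NormedAddCommGroup E] [NormedSpace ℝ E] [NormedAddCommGroup E']
  [NormedSpace ℝ E'] {f f' : E → ℝ}

theorem add (hf : BddSmooth f) (hf' : BddSmooth f') : BddSmooth fun x => f x + f' x := by
  refine ⟨hf.1.add hf'.1, fun n => ?_⟩
  obtain ⟨C, hC⟩ := hf.2 n
  obtain ⟨C', hC'⟩ := hf'.2 n
  refine ⟨C + C', fun x => ?_⟩
  have e := iteratedFDeriv_add_apply (𝕜 := ℝ) (i := n) (x := x)
    ((hf.1.of_le (by norm_cast; exact le_top)).contDiffAt)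
    ((hf'.1.of_le (by norm_cast; exact le_top)).contDiffAt)
  rw [show (fun x => f x + f' x) = f + f' from rfl, e]
  exact (norm_add_le _ _).trans (add_le_add (hC x) (hC' x))

theorem const_mul (hf : BddSmooth f) (c : ℝ) : BddSmooth fun x => c * f x := by
  refine ⟨contDiff_const.mul hf.1, fun n => ?_⟩
  obtain ⟨C, hC⟩ := hf.2 n
  refine ⟨‖c‖ * C, fun x => ?_⟩
  have e := iteratedFDeriv_const_smul_apply (𝕜 := ℝ) (i := n) (x := x) (a := c)
    ((hf.1.of_le (by norm_cast; exact le_top)).contDiffAt)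
  rw [show (fun x => c * f x) = c • f from rfl, e, norm_smul]
  exact mul_le_mul_of_nonneg_left (hC x) (norm_nonneg _)

theorem mul (hf : BddSmooth f) (hf' : BddSmooth f') : BddSmooth fun x => f x * f' x := by
  refine ⟨hf.1.mul hf'.1, fun n => ?_⟩
  choose C hC using hf.2
  choose C' hC' using hf'.2
  refine ⟨∑ i ∈ Finset.range (n + 1), (n.choose i : ℝ) * C i * C' (n - i), fun x => ?_⟩
  refine (norm_iteratedFDeriv_mul_le (𝕜 := ℝ) hf.1 hf'.1 x
    (n := n) (by norm_cast; exact le_top)).trans ?_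
  refine Finset.sum_le_sum fun i _ => ?_
  have h0 : 0 ≤ C i := (norm_nonneg _).trans (hC i x)
  exact mul_le_mul (mul_le_mul_of_nonneg_left (hC i x) (Nat.cast_nonneg _)) (hC' (n - i) x)
    (norm_nonneg _) (mul_nonneg (Nat.cast_nonneg _) h0)

theorem comp_clm (hf : BddSmooth f) (L : E' →L[ℝ] E) : BddSmooth fun x => f (L x) := by
  refine ⟨hf.1.comp L.contDiff, fun n => ?_⟩
  obtain ⟨C, hC⟩ := hf.2 n
  refine ⟨C * ∏ _i : Fin n, ‖L‖, fun x => ?_⟩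
  rw [show (fun x => f (L x)) = f ∘ L from rfl, L.iteratedFDeriv_comp_right hf.1 x
    (by norm_cast; exact le_top)]
  refine (ContinuousMultilinearMap.norm_compContinuousLinearMap_le _ _).trans ?_
  exact mul_le_mul_of_nonneg_right (hC _) (Finset.prod_nonneg fun _ _ => norm_nonneg _)

theorem comp_left (hf : BddSmooth f) {φ : ℝ → ℝ} (hφ : BddSmooth φ) :
    BddSmooth fun x => φ (f x) := by
  refine ⟨hφ.1.comp hf.1, fun n => ?_⟩
  choose C hC using hφ.2
  choose D hD using hf.2
  have hC0 : ∀ i, 0 ≤ C i := fun i => (norm_nonneg _).trans (hC i 0)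
  have hD0 : ∀ i, 0 ≤ D i := fun i => (norm_nonneg _).trans (hD i 0)
  set D' := 1 + ∑ i ∈ Finset.range (n + 1), D i with hD'
  have h1 : 1 ≤ D' := le_add_of_nonneg_right (Finset.sum_nonneg fun i _ => hD0 i)
  refine ⟨n.factorial * (∑ i ∈ Finset.range (n + 1), C i) * D' ^ n, fun x => ?_⟩
  refine norm_iteratedFDeriv_comp_le (𝕜 := ℝ) hφ.1 hf.1 (by norm_cast; exact le_top) x
    (fun i hi => (hC i _).trans ?_) fun i hi1 hi => (hD i x).trans ?_
  · exact Finset.single_le_sum (f := C) (fun i _ => hC0 i)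
      (Finset.mem_range.2 (Nat.lt_succ_of_le hi))
  · have h2 : D i ≤ D' := (Finset.single_le_sum (f := D) (fun i _ => hD0 i)
      (Finset.mem_range.2 (Nat.lt_succ_of_le hi))).trans (by rw [hD']; linarith)
    exact h2.trans (le_self_pow₀ h1 (by omega))

theorem of_hasCompactSupport (hf : ContDiff ℝ ((⊤ : ℕ∞) : WithTop ℕ∞) f)
    (hc : HasCompactSupport f) : BddSmooth f := by
  refine ⟨hf, fun n => ?_⟩
  exact (hc.iteratedFDeriv (𝕜 := ℝ) n).exists_bound_of_continuous
    (hf.continuous_iteratedFDeriv (by norm_cast; exact le_top))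

end BddSmooth

/-- A smooth cut-off of the integers `n ≤ N`. -/
theorem exists_bddSmooth_indicator (N : ℕ) : ∃ χ : ℝ → ℝ, BddSmooth χ ∧
    ∀ n : ℕ, χ n = if n ≤ N then 1 else 0 := by
  let χ : ContDiffBump (0 : ℝ) := ⟨N + 1 / 2, N + 1, by positivity, by linarith⟩
  refine ⟨χ, BddSmooth.of_hasCompactSupport χ.contDiff χ.hasCompactSupport, fun n => ?_⟩
  split_ifs with h
  · refine χ.one_of_mem_closedBall ?_
    rw [mem_closedBall_zero_iff, Real.norm_eq_abs, Nat.abs_cast]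
    have : (n : ℝ) ≤ N := by exact_mod_cast h
    change (n : ℝ) ≤ N + 1 / 2
    linarith
  · refine χ.zero_of_le_dist ?_
    rw [dist_zero_right, Real.norm_eq_abs, Nat.abs_cast]
    change (N : ℝ) + 1 ≤ n
    exact_mod_cast not_le.1 h

variable {d : ℕ} {D : Set (Eucl d)}

theorem zero_mem_testFunctionals : (fun _ => 0) ∈ testFunctionals D := by
  refine ⟨1, 1, fun _ => 0, fun _ _ => 0, le_rfl, le_rfl, ?_, fun _ => isTestFunction_const D 0, ?_⟩
  · exact BddSmooth.of_hasCompactSupport contDiff_const HasCompactSupport.zero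
  · funext B; simp [_root_.cylinder]

theorem const_mul_mem_testFunctionals {F : FinConfig d → ℝ} (hF : F ∈ testFunctionals D) (c : ℝ) :
    (fun B => c * F B) ∈ testFunctionals D := by
  obtain ⟨M, N, f, φ, hM, hN, hf, hφ, rfl⟩ := hF
  refine ⟨M, N, fun z => c * f z, φ, hM, hN, BddSmooth.const_mul hf c, hφ, ?_⟩
  funext B; simp [_root_.cylinder]

/-- The condition `φ 0 = 0` preserves the vanishing on configurations of more than `N` points. -/
theorem comp_mem_testFunctionals {F : FinConfig d → ℝ} (hF : F ∈ testFunctionals D) {φ : ℝ → ℝ}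
    (hφ : BddSmooth φ) (h0 : φ 0 = 0) : (fun B => φ (F B)) ∈ testFunctionals D := by
  obtain ⟨M, N, f, ψ, hM, hN, hf, hψ, rfl⟩ := hF
  refine ⟨M, N, fun z => φ (f z), ψ, hM, hN, BddSmooth.comp_left hf hφ, hψ, ?_⟩
  funext B
  simp only [_root_.cylinder]
  split_ifs <;> simp [h0]

/-- The number of points is the sum of the test function `1`, so that the bounds on the number of
points of two test functionals can be expressed by smooth cut-offs. -/
theorem add_mem_testFunctionals {F G : FinConfig d → ℝ} (hF : F ∈ testFunctionals D)
    (hG : G ∈ testFunctionals D) : (fun B => F B + G B) ∈ testFunctionals D := by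
  obtain ⟨M, N, f, φ, hM, hN, hf, hφ, rfl⟩ := hF
  obtain ⟨M', N', f', φ', hM', hN', hf', hφ', rfl⟩ := hG
  obtain ⟨χ, hχ, hχN⟩ := exists_bddSmooth_indicator N
  obtain ⟨χ', hχ', hχN'⟩ := exists_bddSmooth_indicator N'
  let L : (Fin (M + M' + 1) → ℝ) →L[ℝ] (Fin M → ℝ) :=
    ContinuousLinearMap.pi fun m => ContinuousLinearMap.proj (Fin.castAdd 1 (Fin.castAdd M' m))
  let L' : (Fin (M + M' + 1) → ℝ) →L[ℝ] (Fin M' → ℝ) :=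
    ContinuousLinearMap.pi fun m => ContinuousLinearMap.proj (Fin.castAdd 1 (Fin.natAdd M m))
  let ℓ : (Fin (M + M' + 1) → ℝ) →L[ℝ] ℝ :=
    ContinuousLinearMap.proj (Fin.natAdd (M + M') (0 : Fin 1))
  refine ⟨M + M' + 1, max N N', fun z => f (L z) * χ (ℓ z) + f' (L' z) * χ' (ℓ z),
    Fin.append (Fin.append φ φ') fun _ : Fin 1 => fun _ => 1, by omega,
    hN.trans (le_max_left _ _), ?_, ?_, ?_⟩
  · exact ((BddSmooth.comp_clm hf L).mul (hχ.comp_clm ℓ)).add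
      ((BddSmooth.comp_clm hf' L').mul (hχ'.comp_clm ℓ))
  · intro m
    refine Fin.addCases (fun m => ?_) (fun m => ?_) m
    · refine Fin.addCases (fun m => ?_) (fun m => ?_) m
      · simpa using hφ m
      · simpa using hφ' m
    · simpa using isTestFunction_const D 1
  · funext B
    simp only [_root_.cylinder, L, L', ℓ, ContinuousLinearMap.coe_pi', ContinuousLinearMap.proj_apply,
      Fin.append_left, Fin.append_right, Finset.sum_const, nsmul_eq_mul, mul_one, hχN, hχN',
      le_max_iff]
    by_cases h1 : B.pts.card ≤ N <;> by_cases h2 : B.pts.card ≤ N' <;> simp [h1, h2]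

/-- Smooth approximations of the truncation `t ↦ (t ∨ 0) ∧ 1`, which are contractions: primitives of
smooth approximations of the indicator of `[0, 1]`. -/
theorem exists_smooth_truncation {ε : ℝ} (hε : 0 < ε) : ∃ φ : ℝ → ℝ, BddSmooth φ ∧ φ 0 = 0 ∧
    (∀ t, |deriv φ t| ≤ 1) ∧ ∀ t, |φ t - min (max t 0) 1| ≤ ε := by
  let χ : ContDiffBump (1 / 2 : ℝ) := ⟨1 / 2, 1 / 2 + ε, by norm_num, by linarith⟩
  have hχc : Continuous χ := χ.continuous
  have hχi : ∀ s t, IntervalIntegrable χ volume s t := fun s t => hχc.intervalIntegrable s t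
  have hχ0 : ∀ t, 0 ≤ χ t := fun t => χ.nonneg
  have hχ1 : ∀ t, χ t ≤ 1 := fun t => χ.le_one
  have hin : ∀ t, 0 ≤ t → t ≤ 1 → χ t = 1 := fun t h0 h1 => χ.one_of_mem_closedBall (by
    rw [Metric.mem_closedBall, Real.dist_eq]
    change |t - 1 / 2| ≤ 1 / 2
    rw [abs_le]; constructor <;> linarith)
  have hout : ∀ t, 1 + ε ≤ t → χ t = 0 := fun t ht => χ.zero_of_le_dist (by
    rw [Real.dist_eq]
    change 1 / 2 + ε ≤ |t - 1 / 2|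
    rw [abs_of_nonneg] <;> linarith)
  have hout' : ∀ t, t ≤ -ε → χ t = 0 := fun t ht => χ.zero_of_le_dist (by
    rw [Real.dist_eq]
    change 1 / 2 + ε ≤ |t - 1 / 2|
    rw [abs_of_nonpos] <;> linarith)
  let φ : ℝ → ℝ := fun t => ∫ s in (0 : ℝ)..t, χ s
  have hder : ∀ t, HasDerivAt φ (χ t) t := fun t => hχc.integral_hasStrictDerivAt 0 t |>.hasDerivAt
  have hderiv : deriv φ = χ := funext fun t => (hder t).deriv
  have hmono : Monotone φ := monotone_of_deriv_nonneg (fun t => (hder t).differentiableAt)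
    fun t => by rw [hderiv]; exact hχ0 t
  have hsub : ∀ s t, s ≤ t → φ t - φ s ≤ t - s := by
    intro s t hst
    have := intervalIntegral.integral_mono_on hst (hχi s t) (intervalIntegrable_const (c := (1 : ℝ)))
      fun x _ => hχ1 x
    rw [intervalIntegral.integral_const, smul_eq_mul, mul_one] at this
    have e := intervalIntegral.integral_interval_sub_left (hχi 0 t) (hχi 0 s)
    change (∫ s in (0 : ℝ)..t, χ s) - (∫ s in (0 : ℝ)..s, χ s) ≤ t - s
    rw [e]; exact this
  have hφ0 : φ 0 = 0 := intervalIntegral.integral_same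
  have hφin : ∀ t, 0 ≤ t → t ≤ 1 → φ t = t := by
    intro t h0 h1
    have : φ t = ∫ _ in (0 : ℝ)..t, (1 : ℝ) := by
      refine intervalIntegral.integral_congr fun s hs => ?_
      rw [uIcc_of_le h0] at hs
      exact hin s hs.1 (hs.2.trans h1)
    rw [this]; simp
  have hconst : ∀ s t, s ≤ t → (∀ x ∈ Icc s t, χ x = 0) → φ t = φ s := by
    intro s t hst h0
    have e := intervalIntegral.integral_interval_sub_left (hχi 0 t) (hχi 0 s)
    have : ∫ x in s..t, χ x = 0 := by
      rw [intervalIntegral.integral_congr (g := fun _ => 0) fun x hx => h0 x (by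
        rwa [uIcc_of_le hst] at hx)]
      simp
    exact sub_eq_zero.1 (e.trans this)
  have happ : ∀ t, |φ t - min (max t 0) 1| ≤ ε := by
    intro t
    rcases le_total t 0 with h0 | h0
    · rw [max_eq_right h0, min_eq_left zero_le_one, sub_zero, abs_le]
      refine ⟨?_, (hmono h0).trans (by rw [hφ0]; exact hε.le)⟩
      rcases le_total t (-ε) with h1 | h1
      · have e1 := hconst t (-ε) h1 fun x hx => hout' x hx.2
        have e2 := hsub (-ε) 0 (by linarith)
        rw [← e1]; linarith
      · have e2 := hsub t 0 h0
        linarith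
    · rw [max_eq_left h0]
      rcases le_total t 1 with h1 | h1
      · rw [min_eq_left h1, hφin t h0 h1, sub_self, abs_zero]; exact hε.le
      · have e0 := hφin 1 zero_le_one le_rfl
        rw [min_eq_right h1, abs_le]
        refine ⟨by linarith [hmono h1], ?_⟩
        rcases le_total t (1 + ε) with h2 | h2
        · linarith [hsub 1 t h1]
        · rw [hconst (1 + ε) t h2 fun x hx => hout x hx.1]
          linarith [hsub 1 (1 + ε) (by linarith)]
  refine ⟨φ, ⟨?_, fun n => ?_⟩, hφ0, fun t => ?_, happ⟩
  · refine contDiff_infty_iff_deriv.2 ⟨fun t => (hder t).differentiableAt, ?_⟩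
    rw [hderiv]
    exact χ.contDiff
  · cases n with
    | zero =>
      refine ⟨1 + ε, fun t => ?_⟩
      rw [norm_iteratedFDeriv_zero, Real.norm_eq_abs]
      have h1 : |min (max t 0) 1| ≤ 1 := by
        rw [abs_of_nonneg (le_min (le_max_right _ _) zero_le_one)]
        exact min_le_right _ _
      have h2 := abs_add_le (φ t - min (max t 0) 1) (min (max t 0) 1)
      rw [sub_add_cancel] at h2
      linarith [happ t]
    | succ n =>
      obtain ⟨C, hC⟩ := (BddSmooth.of_hasCompactSupport χ.contDiff χ.hasCompactSupport).2 n
      refine ⟨C, fun t => ?_⟩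
      rw [norm_iteratedFDeriv_eq_norm_iteratedDeriv, iteratedDeriv_succ', hderiv,
        ← norm_iteratedFDeriv_eq_norm_iteratedDeriv]
      exact hC t
  · rw [hderiv, abs_of_nonneg (hχ0 t)]
    exact hχ1 t

end

/-! ### Contractions and density of the test functionals -/

section

variable {d : ℕ} {D : Set (Eucl d)} {μ : Measure (Eucl d)} {ρ : Eucl d → ℝ}
  {J : Eucl d → Eucl d → ℂ} {a : ℝ} {g : ∀ n, (Fin n → Eucl d) → ℝ} {r : Eucl d → ℝ}
  {Q : Measure (FinConfig d)}

theorem energyTuple_comp_le {n : ℕ} {f : (Fin n → Eucl d) → ℝ} {φ : ℝ → ℝ} (hf : ContDiff ℝ 1 f)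
    (hφ : Differentiable ℝ φ) (hφ1 : ∀ t, |deriv φ t| ≤ 1) (x : Fin n → Eucl d) :
    energyTuple (fun x => φ (f x)) (fun x => φ (f x)) x ≤ energyTuple f f x := by
  have hfx : DifferentiableAt ℝ f x := hf.differentiable one_ne_zero x
  have hd : HasFDerivAt (fun x => φ (f x)) (deriv φ (f x) • fderiv ℝ f x) x :=
    (hφ (f x)).hasDerivAt.comp_hasFDerivAt x hfx.hasFDerivAt
  refine Finset.sum_le_sum fun i _ => ?_
  have e : tupleGrad (fun x => φ (f x)) i x = deriv φ (f x) • tupleGrad f i x := by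
    refine ext_inner_right ℝ fun v => ?_
    rw [inner_tupleGrad i hd.differentiableAt, hd.fderiv, real_inner_smul_left,
      inner_tupleGrad i hfx]
    rfl
  rw [e, real_inner_smul_left, real_inner_smul_right, ← mul_assoc, real_inner_self_eq_norm_sq]
  refine mul_le_of_le_one_left (sq_nonneg _) ?_
  rw [← abs_mul_abs_self]
  exact mul_le_one₀ (hφ1 _) (abs_nonneg _) (hφ1 _)

/-- Contractions decrease the energy, by the chain rule. -/
theorem IsRegularJanossy.energy_comp_le (h : IsRegularJanossy D μ ρ J a g r Q)
    {F : FinConfig d → ℝ} (hF : F ∈ testFunctionals D) {φ : ℝ → ℝ} (hφ : BddSmooth φ)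
    (h0 : φ 0 = 0) (hφ1 : ∀ t, |deriv φ t| ≤ 1) :
    ∫ B, energyDensity (fun B => φ (F B)) (fun B => φ (F B)) B ∂Q ≤
      ∫ B, energyDensity F F B ∂Q := by
  have hF' := comp_mem_testFunctionals hF hφ h0
  obtain ⟨N, f, he, hf, -, -⟩ := exists_tuple_of_mem_testFunctionals h.compact hF
  refine integral_mono_ae (h.integrable_energyDensity_and hF' hF').1
    (h.integrable_energyDensity_and hF hF).1 (h.ae_of_tuple fun n x hx => ?_)
  have hinj := injective_of_mem_goodTuples hx
  have he' : ∀ x, Function.Injective x → φ (F (FinConfig.ofTuple x)) = φ (f n x) := fun x hx => by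
    rw [he n x hx]
  rw [energyDensity_ofTuple (F := fun B => φ (F B)) (G := fun B => φ (F B)) he' he' hinj,
    energyDensity_ofTuple (he n) (he n) hinj]
  exact energyTuple_comp_le ((hf n).of_le (by norm_num))
    (hφ.1.differentiable (by norm_num)) hφ1 x

/-- The indicator of the absence of points in an open subset `U` of `D` is a limit of test
functionals. -/
theorem exists_tendsto_indicator_voidSet (hD : IsCompact D) {U : Set (Eucl d)} (hU : IsOpen U)
    (hUD : U ⊆ D) : ∃ F : ℕ → FinConfig d → ℝ, (∀ k, F k ∈ testFunctionals D) ∧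
      (∀ k B, |F k B| ≤ 1) ∧
      ∀ B, Tendsto (fun k => F k B) atTop (𝓝 ((voidSet U).indicator (fun _ => 1) B)) := by
  obtain ⟨φ, hφs, hφ, hφr⟩ := hU.exists_contDiff_support_eq (n := ⊤)
  have hφ0 : ∀ x, 0 ≤ φ x := fun x => (hφr ⟨x, rfl⟩).1
  let χ : ContDiffBump (0 : ℝ) := ⟨1, 2, one_pos, one_lt_two⟩
  have hχ : BddSmooth χ := BddSmooth.of_hasCompactSupport χ.contDiff χ.hasCompactSupport
  let f : ℕ → (Fin 1 → ℝ) → ℝ := fun k z => χ (((k : ℝ) • ContinuousLinearMap.proj (R := ℝ)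
    (φ := fun _ : Fin 1 => ℝ) 0) z)
  refine ⟨fun k => _root_.cylinder (f k) (fun _ => φ) (k + 1), fun k => ⟨1, k + 1, f k, fun _ => φ,
    le_rfl, by omega, BddSmooth.comp_clm hχ _, fun _ => isTestFunction_of_support_subset hD hφ
    (hφs.trans_subset hUD), rfl⟩, fun k B => ?_, fun B => ?_⟩
  · simp only [_root_.cylinder]
    split_ifs
    · rw [abs_of_nonneg χ.nonneg]; exact χ.le_one
    · simp
  · have hc : ∀ᶠ k : ℕ in atTop, _root_.cylinder (f k) (fun _ => φ) (k + 1) B =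
        χ (k * ∑ x ∈ B.pts, φ x) := by
      filter_upwards [eventually_ge_atTop B.pts.card] with k hk
      rw [_root_.cylinder, if_pos (hk.trans (Nat.le_succ k))]
      simp [f]
    refine Tendsto.congr' (EventuallyEq.symm hc) ?_
    by_cases hB : B ∈ voidSet U
    · have hs : ∑ x ∈ B.pts, φ x = 0 := Finset.sum_eq_zero fun x hx =>
        Function.notMem_support.1 fun hh => hB x hx (hφs ▸ hh)
      rw [indicator_of_mem hB, hs]
      simp only [mul_zero]
      rw [χ.one_of_mem_closedBall (Metric.mem_closedBall_self zero_le_one)]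
      exact tendsto_const_nhds
    · rw [indicator_of_notMem hB]
      have hs : 0 < ∑ x ∈ B.pts, φ x := by
        simp only [voidSet, mem_ofPred_eq, not_forall, not_not] at hB
        obtain ⟨x, hx, hxU⟩ := hB
        refine Finset.sum_pos' (fun x _ => hφ0 x) ⟨x, hx, lt_of_le_of_ne (hφ0 x) ?_⟩
        rw [← hφs] at hxU
        exact Ne.symm hxU
      have ht : Tendsto (fun k : ℕ => (k : ℝ) * ∑ x ∈ B.pts, φ x) atTop atTop :=
        tendsto_natCast_atTop_atTop.atTop_mul_const hs
      refine tendsto_const_nhds.congr' ?_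
      filter_upwards [ht.eventually_ge_atTop 2] with k hk
      refine (χ.zero_of_le_dist ?_).symm
      rw [dist_zero_right, Real.norm_eq_abs]
      exact hk.trans (le_abs_self _)

/-- A functional orthogonal to the test functionals vanishes: its integrals over the events of emptiness
of open sets are zero, and these events form a generating π-system. -/
theorem IsRegularJanossy.eq_zero_of_orthogonal [IsProbabilityMeasure Q]
    (h : IsRegularJanossy D μ ρ J a g r Q) {u : FinConfig d → ℝ} (hu : Integrable u Q)
    (horth : ∀ F ∈ testFunctionals D, ∫ B, F B * u B ∂Q = 0) : u =ᵐ[Q] 0 := by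
  have h1 : ∀ U : Set (Eucl d), IsOpen U → U ⊆ D → ∫ B in voidSet U, u B ∂Q = 0 := by
    intro U hU hUD
    obtain ⟨F, hF, hF1, hlim⟩ := exists_tendsto_indicator_voidSet h.compact hU hUD
    have hl : Tendsto (fun k => ∫ B, F k B * u B ∂Q) atTop
        (𝓝 (∫ B, (voidSet U).indicator (fun _ => 1) B * u B ∂Q)) := by
      refine tendsto_integral_of_dominated_convergence (fun B => ‖u B‖)
        (fun k => (h.memLp_testFunctional (hF k)).1.mul hu.1) hu.norm
        (fun k => Eventually.of_forall fun B => ?_)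
        (Eventually.of_forall fun B => (hlim B).mul_const _)
      rw [norm_mul]
      exact mul_le_of_le_one_left (norm_nonneg _) (hF1 k B)
    simp only [fun k => horth (F k) (hF k)] at hl
    have e : ∀ B, (voidSet U).indicator (fun _ => (1 : ℝ)) B * u B = (voidSet U).indicator u B := by
      intro B
      by_cases hB : B ∈ voidSet U <;> simp [hB]
    rw [← integral_indicator (measurableSet_voidSet hU.measurableSet)]
    simp only [e] at hl
    exact (tendsto_nhds_unique tendsto_const_nhds hl).symm
  have h2 : ∀ U : Set (Eucl d), IsOpen U → ∫ B in voidSet U, u B ∂Q = 0 := by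
    intro U hU
    rw [← h1 (U ∩ interior D) (hU.inter isOpen_interior) (inter_subset_right.trans interior_subset)]
    refine setIntegral_congr_set ?_
    filter_upwards [h.ae_goodConfigs] with B hB
    refine propext ⟨fun hv x hx hxU => hv x hx hxU.1, fun hv x hx hxU => hv x hx ⟨hxU, hB.1 x hx⟩⟩
  have hvoid : voidSet (∅ : Set (Eucl d)) = univ := by simp [voidSet]
  have huniv : ∫ B, u B ∂Q = 0 := by
    have := h2 ∅ isOpen_empty
    rwa [hvoid, setIntegral_univ] at this
  refine hu.ae_eq_zero_of_forall_setIntegral_eq_zero fun s hs _ => ?_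
  induction s, hs using MeasurableSpace.induction_on_inter generateFrom_voidSet_open
    isPiSystem_voidSet_open with
  | empty => simp
  | basic s hs =>
    obtain ⟨U, hU, rfl⟩ := hs
    exact h2 U hU
  | compl s hs ih =>
    have := integral_add_compl hs hu
    rw [ih (measure_lt_top _ _), huniv, zero_add] at this
    exact this
  | iUnion s hd hs ih =>
    rw [integral_iUnion hs hd hu.integrableOn]
    simp [fun i => ih i (measure_lt_top _ _)]

end

/-! ### The restriction of the determinantal process to `D` -/

section

variable {d : ℕ}

theorem DensityAssumption.restrict_eq {S D : Set (Eucl d)} {μ : Measure (Eucl d)}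
    {ρ r : Eucl d → ℝ} (h : DensityAssumption S μ ρ D) (hD : IsCompact D) (hDS : D ⊆ S)
    (hr : EqOn ρ r D) :
    μ.restrict D = (volume.restrict D).withDensity fun x => ENNReal.ofReal (r x) := by
  rw [h.density, restrict_withDensity hD.measurableSet, Measure.restrict_restrict hD.measurableSet,
    inter_eq_left.2 hDS]
  refine withDensity_congr_ae ?_
  filter_upwards [ae_restrict_mem hD.measurableSet] with x hx
  rw [hr hx]

/-- The law of the process restricted to `D` satisfies the assumptions of the integration by parts. -/
theorem exists_isRegularJanossy {S D : Set (Eucl d)} (hD : IsCompact D) (hDS : D ⊆ S)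
    (hD0 : volume (frontier D) = 0) {μ : Measure (Eucl d)} {ρ : Eucl d → ℝ}
    {K J : Eucl d → Eucl d → ℂ} {P : Measure (LFConfig S)} [IsProbabilityMeasure P]
    (hdet : IsDeterminantal S μ K P) (hK : KernelAssumption S μ K) (hρ : DensityAssumption S μ ρ D)
    (hJ : IsInteractionKernel μ K D J) (hJdet : SmoothDetAssumption J D)
    (hint : IntegrabilityCondition μ J D) :
    ∃ a g r, IsRegularJanossy D μ ρ J a g r (lawOn P D) := by
  obtain ⟨⟨a, ha, hlaw⟩, hnn, hdi⟩ := exists_lawOn_eq_janossy hD hDS hdet hK hρ hJ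
  have hG : ∀ n, ∃ G : (Fin n → Eucl d) → ℝ, ContDiff ℝ 1 G ∧
      ∀ x : Fin n → Eucl d, (∀ i, x i ∈ D) → detTuple J n x = G x := by
    intro n
    rcases Nat.eq_zero_or_pos n with rfl | hn
    · exact ⟨fun _ => 1, contDiff_const, fun x _ => by simp [detTuple]⟩
    · obtain ⟨G, hG, he⟩ := hJdet n hn
      exact ⟨G, hG, fun x hx => he fun i _ => hx i⟩
  choose g hg hge using hG
  obtain ⟨r, hr, hre⟩ := hρ.c1
  have hpos : ∀ x ∈ D, 0 < r x := fun x hx => by rw [← hre hx]; exact hρ.pos x hx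
  have hfin : IsFiniteMeasure (μ.restrict D) := isFiniteMeasure_restrict.2 (hρ.radon D hD hDS).ne
  have hres := hρ.restrict_eq hD hDS hre
  refine ⟨a, g, r, hD, hD0, ha, measurable_detTuple hJ.1, hg, hge, fun n x hx => ?_, hdi, hr, hre,
    hpos, hρ.sigmaFinite, hfin, hres, hlaw, hint⟩
  -- `g n` is continuous, and it is non-negative almost everywhere on the interior of `D^n`.
  by_contra hneg
  have hm : Measurable fun x : Fin n → Eucl d => ENNReal.ofReal (∏ i, r (x i)) := by
    refine Measurable.ennreal_ofReal (Finset.measurable_prod _ fun i _ => ?_)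
    exact hr.continuous.measurable.comp (measurable_pi_apply i)
  have h1 := hnn n
  rw [pi_eq_withDensity hD hr.continuous hpos hres n, ae_withDensity_iff hm, pi_restrict_eq,
    ae_restrict_iff' (MeasurableSet.univ_pi fun _ => hD.measurableSet)] at h1
  have ho : IsOpen ((Set.pi univ fun _ : Fin n => interior D) ∩ {x | g n x < 0}) :=
    (isOpen_set_pi finite_univ fun _ _ => isOpen_interior).inter
      (isOpen_lt (hg n).continuous continuous_const)
  refine (ho.measure_pos volume ⟨x, fun i _ => hx i, not_le.1 hneg⟩).ne' ?_
  refine measure_mono_null (fun y hy => ?_) (ae_iff.1 h1)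
  have hyD : ∀ i, y i ∈ D := fun i => interior_subset (hy.1 i trivial)
  simp only [mem_ofPred_eq, not_forall]
  refine ⟨fun i _ => hyD i, (ENNReal.ofReal_pos.2 (Finset.prod_pos fun i _ => hpos _ (hyD i))).ne', ?_⟩
  rw [hge n y hyD]
  exact not_le.2 hy.2

end

/-! ### The operator on `L²` -/

section

variable {d : ℕ} {D : Set (Eucl d)} {μ : Measure (Eucl d)} {ρ : Eucl d → ℝ}
  {J : Eucl d → Eucl d → ℂ} {a : ℝ} {g : ∀ n, (Fin n → Eucl d) → ℝ} {r : Eucl d → ℝ}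
  {Q : Measure (FinConfig d)}

theorem inner_eq_integral_of_ae_eq {α : Type*} [MeasurableSpace α] {β : Measure α} {u v : Lp ℝ 2 β}
    {f f' : α → ℝ} (hu : u =ᵐ[β] f) (hv : v =ᵐ[β] f') : ⟪u, v⟫_ℝ = ∫ x, f x * f' x ∂β := by
  rw [L2.inner_def]
  refine integral_congr_ae ?_
  filter_upwards [hu, hv] with x h1 h2
  rw [h1, h2]
  exact mul_comm _ _

/-- The classes of the test functionals. -/
def testSubmodule (D : Set (Eucl d)) (Q : Measure (FinConfig d)) : Submodule ℝ (Lp ℝ 2 Q) where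
  carrier := {u | ∃ F ∈ testFunctionals D, u =ᵐ[Q] F}
  add_mem' := by
    rintro u v ⟨F, hF, hu⟩ ⟨G, hG, hv⟩
    refine ⟨_, add_mem_testFunctionals hF hG, (Lp.coeFn_add u v).trans ?_⟩
    filter_upwards [hu, hv] with x h1 h2
    rw [Pi.add_apply, h1, h2]
  zero_mem' := ⟨_, zero_mem_testFunctionals, Lp.coeFn_zero ..⟩
  smul_mem' := by
    rintro c u ⟨F, hF, hu⟩
    refine ⟨_, const_mul_mem_testFunctionals hF c, (Lp.coeFn_smul c u).trans ?_⟩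
    filter_upwards [hu] with x h1
    rw [Pi.smul_apply, h1, smul_eq_mul]

theorem mem_testSubmodule {u : Lp ℝ 2 Q} :
    u ∈ testSubmodule D Q ↔ ∃ F ∈ testFunctionals D, u =ᵐ[Q] F := Iff.rfl

theorem energyDensity_comm (F G : FinConfig d → ℝ) : energyDensity F G = energyDensity G F := by
  funext B
  exact Finset.sum_congr rfl fun x _ => real_inner_comm _ _

theorem IsRegularJanossy.dense_testSubmodule [IsProbabilityMeasure Q]
    (h : IsRegularJanossy D μ ρ J a g r Q) : Dense (testSubmodule D Q : Set (Lp ℝ 2 Q)) := by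
  rw [Submodule.dense_iff_topologicalClosure_eq_top, Submodule.topologicalClosure_eq_top_iff,
    Submodule.eq_bot_iff]
  intro u hu
  have h1 : u =ᵐ[Q] 0 := by
    refine h.eq_zero_of_orthogonal ((Lp.memLp u).integrable one_le_two) fun F hF => ?_
    have h2 := h.memLp_testFunctional hF
    rw [← inner_eq_integral_of_ae_eq h2.coeFn_toLp (EventuallyEq.refl _ (u : FinConfig d → ℝ))]
    exact (Submodule.mem_orthogonal _ _).1 hu _ ⟨F, hF, h2.coeFn_toLp⟩
  exact (Lp.eq_zero_iff_ae_eq_zero).2 h1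

/-- Green's formula `⟨ℋF, G⟩ = ℰ(F, G)` in `L²`. -/
theorem IsRegularJanossy.inner_lapH (h : IsRegularJanossy D μ ρ J a g r Q)
    {F G : FinConfig d → ℝ} (hF : F ∈ testFunctionals D) (hG : G ∈ testFunctionals D)
    {w v : Lp ℝ 2 Q} (hw : w =ᵐ[Q] lapH ρ J F) (hv : v =ᵐ[Q] G) :
    ⟪w, v⟫_ℝ = ∫ B, energyDensity F G B ∂Q := by
  rw [inner_eq_integral_of_ae_eq hw hv, (h.integrable_energyDensity_and hF hG).2]

/-- By Green's formula and the density of the test functionals, the class of `ℋF` depends only on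
the class of `F`, linearly. -/
theorem IsRegularJanossy.exists_operator [IsProbabilityMeasure Q]
    (h : IsRegularJanossy D μ ρ J a g r Q) : ∃ A : Lp ℝ 2 Q →ₗ.[ℝ] Lp ℝ 2 Q,
      A.domain = testSubmodule D Q ∧ ∀ u : A.domain, ∀ F ∈ testFunctionals D,
        (u : Lp ℝ 2 Q) =ᵐ[Q] F → A u =ᵐ[Q] lapH ρ J F := by
  have hd := h.dense_testSubmodule
  choose F hF hu using fun u : testSubmodule D Q => u.2
  let T : testSubmodule D Q → Lp ℝ 2 Q := fun u => (h.memLp_lapH (hF u)).toLp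
  have hT : ∀ u, T u =ᵐ[Q] lapH ρ J (F u) := fun u => (h.memLp_lapH (hF u)).coeFn_toLp
  have hchar : ∀ {u : Lp ℝ 2 Q} {F' : FinConfig d → ℝ} (_ : F' ∈ testFunctionals D)
      (_ : u =ᵐ[Q] F') {w : Lp ℝ 2 Q} (_ : w =ᵐ[Q] lapH ρ J F') (v : testSubmodule D Q),
      ⟪w, (v : Lp ℝ 2 Q)⟫_ℝ = ⟪u, T v⟫_ℝ := by
    intro u F' hF' hu' w hw v
    rw [h.inner_lapH hF' (hF v) hw (hu v), energyDensity_comm,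
      ← h.inner_lapH (hF v) hF' (hT v) hu', real_inner_comm]
  have hadd : ∀ u v, T (u + v) = T u + T v := fun u v =>
    hd.eq_of_inner_left (𝕜 := ℝ) fun w hw => by
      rw [inner_add_left, hchar (hF _) (hu _) (hT _) ⟨w, hw⟩, hchar (hF _) (hu _) (hT _) ⟨w, hw⟩,
        hchar (hF _) (hu _) (hT _) ⟨w, hw⟩, Submodule.coe_add, inner_add_left]
  have hsmul : ∀ (c : ℝ) u, T (c • u) = c • T u := fun c u =>
    hd.eq_of_inner_left (𝕜 := ℝ) fun w hw => by
      rw [real_inner_smul_left, hchar (hF _) (hu _) (hT _) ⟨w, hw⟩,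
        hchar (hF _) (hu _) (hT _) ⟨w, hw⟩,
        Submodule.coe_smul, real_inner_smul_left]
  refine ⟨⟨testSubmodule D Q, ⟨⟨T, hadd⟩, hsmul⟩⟩, rfl, fun u F' hF' hu' => ?_⟩
  have h1 : T u = (h.memLp_lapH hF').toLp := hd.eq_of_inner_left (𝕜 := ℝ) fun w hw => by
    rw [hchar (hF u) (hu u) (hT u) ⟨w, hw⟩, hchar hF' hu' (h.memLp_lapH hF').coeFn_toLp ⟨w, hw⟩]
  change T u =ᵐ[Q] lapH ρ J F'
  rw [h1]
  exact (h.memLp_lapH hF').coeFn_toLp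

/-- The Markov property: smooth truncations decrease the energy on the core, and the closed form is
lower semicontinuous. -/
theorem IsRegularJanossy.markov [IsProbabilityMeasure Q] (h : IsRegularJanossy D μ ρ J a g r Q)
    {A R : Lp ℝ 2 Q →ₗ.[ℝ] Lp ℝ 2 Q} (hA : A.domain = testSubmodule D Q)
    (hAF : ∀ u : A.domain, ∀ F ∈ testFunctionals D,
      (u : Lp ℝ 2 Q) =ᵐ[Q] F → A u =ᵐ[Q] lapH ρ J F)
    (hR : IsSquareRoot A R) (hc : hR.HasOpCore) (u : R.domain) :
    ∃ v : R.domain, (v : Lp ℝ 2 Q) =ᵐ[Q] (fun x => min (max ((u : Lp ℝ 2 Q) x) 0) 1) ∧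
      ⟪R v, R v⟫_ℝ ≤ ⟪R u, R u⟫_ℝ := by
  have henergy : ∀ (w : A.domain), ∀ F ∈ testFunctionals D, (w : Lp ℝ 2 Q) =ᵐ[Q] F →
      ‖R ⟨w, (hR.2.2 w).1⟩‖ ^ 2 = ∫ B, energyDensity F F B ∂Q := fun w F hF hw => by
    rw [hR.norm_sq_eq w, h.inner_lapH hF hF (hAF w F hF hw) hw]
  obtain ⟨w, hw, hRw⟩ := hc u
  choose F hF hwF using fun n => mem_testSubmodule.1
    (show (w n : Lp ℝ 2 Q) ∈ testSubmodule D Q by rw [← hA]; exact (w n).2)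
  choose φ hφ hφ0 hφ1 hφa using fun n : ℕ =>
    exists_smooth_truncation (ε := 1 / ((n : ℝ) + 1)) Nat.one_div_pos_of_nat
  have hG := fun n => comp_mem_testFunctionals (hF n) (hφ n) (hφ0 n)
  have hGL := fun n => h.memLp_testFunctional (hG n)
  let v : ℕ → A.domain := fun n => ⟨(hGL n).toLp, by
    rw [hA]; exact ⟨_, hG n, (hGL n).coeFn_toLp⟩⟩
  have hv : ∀ n, ((v n : A.domain) : Lp ℝ 2 Q) =ᵐ[Q] fun B => φ n (F n B) :=
    fun n => (hGL n).coeFn_toLp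
  have hle : ∀ n, ‖R ⟨v n, (hR.2.2 (v n)).1⟩‖ ≤ ‖R ⟨w n, (hR.2.2 (w n)).1⟩‖ := fun n => by
    refine (sq_le_sq₀ (norm_nonneg _) (norm_nonneg _)).1 ?_
    rw [henergy _ _ (hG n) (hv n), henergy _ _ (hF n) (hwF n)]
    exact h.energy_comp_le (hF n) (hφ n) (hφ0 n) (hφ1 n)
  have hTm : MemLp (fun x => min (max ((u : Lp ℝ 2 Q) x) 0) 1) 2 Q :=
    MemLp.of_bound (((Lp.memLp (u : Lp ℝ 2 Q)).1.sup aestronglyMeasurable_const).inf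
      aestronglyMeasurable_const) 1 (Eventually.of_forall fun x => by
      rw [Real.norm_eq_abs, abs_of_nonneg (le_min (le_max_right _ _) zero_le_one)]
      exact min_le_right _ _)
  have hlip : ∀ n s t, |φ n s - φ n t| ≤ |s - t| := fun n s t => by
    have := Convex.norm_image_sub_le_of_norm_deriv_le (𝕜 := ℝ) (f := φ n) (C := 1) (s := univ)
      (x := t) (y := s) (fun x _ => (hφ n).1.differentiable (by norm_num) x)
      (fun x _ => hφ1 n x) convex_univ trivial trivial
    simpa using this
  have hdist : ∀ n, ‖((v n : A.domain) : Lp ℝ 2 Q) - hTm.toLp‖ ≤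
      ‖(w n : Lp ℝ 2 Q) - u‖ + 1 / ((n : ℝ) + 1) := by
    intro n
    have h0 : 0 ≤ 1 / ((n : ℝ) + 1) := Nat.one_div_pos_of_nat.le
    have hφu : MemLp (fun B => φ n ((u : Lp ℝ 2 Q) B)) 2 Q := by
      obtain ⟨C, hC⟩ := (hφ n).2 0
      refine MemLp.of_bound ((hφ n).1.continuous.comp_aestronglyMeasurable (Lp.memLp _).1) C
        (Eventually.of_forall fun B => ?_)
      simpa only [norm_iteratedFDeriv_zero] using hC ((u : Lp ℝ 2 Q) B)
    have e1 : ‖((v n : A.domain) : Lp ℝ 2 Q) - hφu.toLp‖ ≤ ‖(w n : Lp ℝ 2 Q) - u‖ := by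
      refine Lp.norm_le_norm_of_ae_le ?_
      filter_upwards [Lp.coeFn_sub ((v n : A.domain) : Lp ℝ 2 Q) hφu.toLp,
        Lp.coeFn_sub (w n : Lp ℝ 2 Q) u, hv n, hφu.coeFn_toLp, hwF n] with B h1 h2 h3 h4 h5
      rw [h1, h2, Pi.sub_apply, Pi.sub_apply, h3, h4, h5]
      exact hlip n _ _
    have e2 : ‖hφu.toLp - hTm.toLp‖ ≤ 1 / ((n : ℝ) + 1) := by
      have h6 := Lp.norm_le_of_ae_bound (p := 2) (f := hφu.toLp - hTm.toLp) h0 (by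
        filter_upwards [Lp.coeFn_sub hφu.toLp hTm.toLp, hφu.coeFn_toLp, hTm.coeFn_toLp]
          with B h1 h2 h3
        rw [h1, Pi.sub_apply, h2, h3]
        exact hφa n _)
      simpa [measureUnivNNReal] using h6
    exact (norm_sub_le_norm_sub_add_norm_sub _ hφu.toLp _).trans (add_le_add e1 e2)
  have hlim : Tendsto (fun n => ((v n : A.domain) : Lp ℝ 2 Q)) atTop (𝓝 hTm.toLp) := by
    refine tendsto_iff_norm_sub_tendsto_zero.2 (squeeze_zero (fun _ => norm_nonneg _) hdist ?_)
    have := (tendsto_iff_norm_sub_tendsto_zero.1 hw).add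
      (tendsto_one_div_add_atTop_nhds_zero_nat (𝕜 := ℝ))
    rwa [add_zero] at this
  obtain ⟨hmem, hnorm⟩ := mem_domain_of_tendsto_of_norm_le hR.1
    (v := fun n => ⟨v n, (hR.2.2 (v n)).1⟩) hlim hle hRw.norm
  refine ⟨⟨hTm.toLp, hmem⟩, hTm.coeFn_toLp, ?_⟩
  rw [real_inner_self_eq_norm_sq, real_inner_self_eq_norm_sq]
  exact pow_le_pow_left₀ (norm_nonneg _) hnorm 2

end

/-! ### The Dirichlet form of the determinantal process -/

theorem mainTheorem2 {d : ℕ} (S D : Set (Eucl d)) (hS : IsOpen S) (hSc : IsConnected S)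
    (hD : IsCompact D) (hDS : D ⊆ S) (hD0 : volume (frontier D) = 0)
    (μ : Measure (Eucl d)) (ρ : Eucl d → ℝ) (K J : Eucl d → Eucl d → ℂ)
    (P : Measure (LFConfig S)) [IsProbabilityMeasure P]
    (hdet : IsDeterminantal S μ K P)
    (hK : KernelAssumption S μ K) (hρ : DensityAssumption S μ ρ D)
    (hJ : IsInteractionKernel μ K D J) (hJdet : SmoothDetAssumption J D)
    (hint : IntegrabilityCondition μ J D) :
    ∃ (A : Lp ℝ 2 (lawOn P D) →ₗ.[ℝ] Lp ℝ 2 (lawOn P D))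
      (a abar : PForm (Lp ℝ 2 (lawOn P D))),
      -- (i) the operator `ℋ` is well defined, with domain `S̃_D`
      ((∀ F ∈ testFunctionals D,
          MemLp F 2 (lawOn P D) ∧ MemLp (lapH ρ J F) 2 (lawOn P D)) ∧
        (∀ u, u ∈ A.domain ↔ ∃ F ∈ testFunctionals D, u =ᵐ[lawOn P D] F) ∧
        (∀ u : A.domain, ∀ F ∈ testFunctionals D,
          (u : Lp ℝ 2 (lawOn P D)) =ᵐ[lawOn P D] F → A u =ᵐ[lawOn P D] lapH ρ J F) ∧
        -- symmetric, non-negative definite, and it has a square root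
        (∀ u v : A.domain, ⟪A u, (v : Lp ℝ 2 (lawOn P D))⟫_ℝ =
          ⟪(u : Lp ℝ 2 (lawOn P D)), A v⟫_ℝ) ∧
        (∀ u : A.domain, 0 ≤ ⟪A u, (u : Lp ℝ 2 (lawOn P D))⟫_ℝ) ∧
        (∃ R, IsSquareRoot A R)) ∧
      -- (ii) the form `ℰ` is well defined, with domain `S̃_D`
      ((∀ F ∈ testFunctionals D, ∀ G ∈ testFunctionals D,
          Integrable (energyDensity F G) (lawOn P D)) ∧
        (a.domain = A.domain) ∧
        (∀ u v : a.domain, ∀ F ∈ testFunctionals D, ∀ G ∈ testFunctionals D,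
          (u : Lp ℝ 2 (lawOn P D)) =ᵐ[lawOn P D] F → (v : Lp ℝ 2 (lawOn P D)) =ᵐ[lawOn P D] G →
          a.form u v = ∫ B, energyDensity F G B ∂lawOn P D) ∧
        a.IsSymm ∧ a.IsNonneg) ∧
      -- (iii) closability, and the closed form in terms of the closure of `ℋ^{1/2}`
      (a.IsClosable ∧ abar.IsClosureOf a ∧
        ∀ R, IsSquareRoot A R →
          (R.domRestrict A.domain).IsClosable ∧
          abar.domain = (R.domRestrict A.domain).closure.domain ∧
          ∀ (u v : abar.domain) (u' v' : (R.domRestrict A.domain).closure.domain),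
            (u : Lp ℝ 2 (lawOn P D)) = u' → (v : Lp ℝ 2 (lawOn P D)) = v' →
            abar.form u v = ⟪(R.domRestrict A.domain).closure u',
              (R.domRestrict A.domain).closure v'⟫_ℝ) ∧
      -- (iv) the closed form is a symmetric Dirichlet form
      abar.IsSymmetricDirichletForm := by
  have := isProbabilityMeasure_lawOn hD hDS P
  obtain ⟨a', g, r, h⟩ := exists_isRegularJanossy hD hDS hD0 hdet hK hρ hJ hJdet hint
  obtain ⟨A, hA, hAF⟩ := h.exists_operator
  have hmem : ∀ u, u ∈ A.domain ↔ ∃ F ∈ testFunctionals D, u =ᵐ[lawOn P D] F := fun u => by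
    rw [hA]
    exact mem_testSubmodule
  have hd : Dense (A.domain : Set (Lp ℝ 2 (lawOn P D))) := by
    rw [hA]
    exact h.dense_testSubmodule
  have hgreen : ∀ u v : A.domain, ∀ F ∈ testFunctionals D, ∀ G ∈ testFunctionals D,
      (u : Lp ℝ 2 (lawOn P D)) =ᵐ[lawOn P D] F → (v : Lp ℝ 2 (lawOn P D)) =ᵐ[lawOn P D] G →
      ⟪A u, (v : Lp ℝ 2 (lawOn P D))⟫_ℝ = ∫ B, energyDensity F G B ∂lawOn P D :=
    fun u v F hF G hG hu hv => h.inner_lapH hF hG (hAF u F hF hu) hv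
  have hs : ∀ u v : A.domain, ⟪A u, (v : Lp ℝ 2 (lawOn P D))⟫_ℝ =
      ⟪(u : Lp ℝ 2 (lawOn P D)), A v⟫_ℝ := by
    intro u v
    obtain ⟨F, hF, hu⟩ := (hmem u).1 u.2
    obtain ⟨G, hG, hv⟩ := (hmem v).1 v.2
    refine Eq.trans ?_ (real_inner_comm _ _)
    rw [hgreen u v F hF G hG hu hv, hgreen v u G hG F hF hv hu, energyDensity_comm]
  have hp : ∀ u : A.domain, 0 ≤ ⟪A u, (u : Lp ℝ 2 (lawOn P D))⟫_ℝ := by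
    intro u
    obtain ⟨F, hF, hu⟩ := (hmem u).1 u.2
    rw [hgreen u u F hF F hF hu hu]
    exact integral_nonneg fun B => Finset.sum_nonneg fun x _ => real_inner_self_nonneg
  obtain ⟨R, hR, hc⟩ := exists_isSquareRoot_core hd hs hp
  refine ⟨A, opForm A, sqForm R, ⟨fun F hF => ⟨h.memLp_testFunctional hF, h.memLp_lapH hF⟩, hmem,
    hAF, hs, hp, R, hR⟩, ⟨fun F hF G hG => (h.integrable_energyDensity_and hF hG).1, rfl,
    fun u v F hF G hG hu hv => (opForm_form A u v).trans (hgreen u v F hF G hG hu hv),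
    fun u v => (hs u v).trans (real_inner_comm _ _), hp⟩,
    ⟨hR.opForm_isClosable, hR.sqForm_isClosureOf hc, fun R' hR' =>
      ⟨hR'.isClosable_domRestrict, hR.sqForm_eq_closure hc hR'⟩⟩,
    ⟨hR.1.dense_domain, sqForm_isSymm R, sqForm_isNonneg R,
      sqForm_isClosed (IsSelfAdjoint.isClosed hR.1), sqForm_weakSector R,
      h.markov hA hAF hR hc⟩⟩
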